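/- **Setting.** Let $p,q\ge 2$ be integers, $\beta>0$, $h\ge 0$. For $\bm X\in[q]^N$ let $\bar X_{\cdot r}:=N^{-1}\sum_{i=1}^N\mathbf 1_{X_i=r}$ ($1\le r\le q$), and let $$\mathbb P_{\beta,h,N}(\bm X)=\frac{1}{q^NZ_N(\beta,h)}\exp\Big(\beta N\sum_{r=1}^q\bar X_{\cdot r}^{\,p}+Nh\bar X_{\cdot 1}\Big)\qquad(\bm X\in[q]^N)$$ be the $p$-tensor Curie–Weiss Potts model, $Z_N$ being the normalizing constant. With $h$ known, $\hat\beta_N$ denotes a maximum likelihood estimator of $\beta$: it maximizes $b\mapsto\mathbb P_{b,h,N}(\bm X)$ over $b\in\mathbb R$ whenever a maximizer exists, and has an arbitrary real value otherwise. On the set $\mathcal P_q$ of $q$-dimensional probability vectors put $H_{\beta,h}(\bm t)=\beta\sum_r t_r^p+ht_1-\sum_r t_r\log t_r$. For $s\in[0,1]$ let $\bm x_s=\big(\tfrac{1+(q-1)s}{q},\tfrac{1-s}{q},\dots,\tfrac{1-s}{q}\big)$ and $f_{\beta,h}(s)=H_{\beta,h}(\bm x_s)$; let $k(x)=\beta x^p-x\log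 x$. The point $(\beta,h)$ is *critical* if $H_{\beta,h}$ has more than one global maximizer and, for each global maximizer $\bm m$, the quadratic form $\sum_r\big(\beta p(p-1)m_r^{p-2}-\tfrac1{m_r}\big)t_r^2$ is negative definite on $\{\bm t\in\mathbb R^q:\sum_r t_r=0\}$. A critical point is *strongly critical* ($\mathcal C^1_{p,q}$) if $f_{\beta,h}$ has more than one global maximizer on $[0,1]$, and *weakly critical* ($\mathcal C^2_{p,q}$) if it has exactly one. Let $\beta_c=\inf\{b\ge 0: f_{b,0}\text{ has a positive global maximizer on }[0,1]\}$. For a global maximizer $\bm m$ of $H_{\beta,h}$, a permutation of $\bm x_s$ with $s=1-q\min_r m_r$, let $$\tau(\bm m)=\sqrt{\frac{\big(-f''_{\beta,h}(s)\big)^{-1}\big(-k''(\tfrac{1-s}{q})\big)^{2-q}}{\prod_{r=1}^q m_r}}.$$ For $\bm m\in\mathbb R^q$ put $\sigma^2(s,\bm m)=-\frac{q^2f''_{\beta,h}(s)}{p^2(q-1)^2}\big(m_1^{p-1}-m_2^{p-1}\big)^{-2}$. For $v>0$, $\mathcal N^{\pm}(0,v)$ is the law of $\pm|Z|$ with $Z\sim\mathcal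 N(0,v)$. Let $\gamma_1=\mathbb P\big(\bm W^\top\bm W\le\tfrac{1-q}{k''(1/q)}\big)$, where $\bm W\sim\mathcal N_q(\bm 0,\Sigma)$ and $$\Sigma=\Big(-\tfrac{q^2}{q-1}f''_{\beta,h}(0)\Big)^{-1}\big(q I_q-J_q\big),$$ with $I_q$ the identity and $J_q$ the all-ones matrix. **Theorem.** Suppose that $(\beta,h)$ is critical. Then $H_{\beta,h}$ has finitely many global maximizers. List them as $\bm m_1,\dots,\bm m_K$ in ascending order of their $L^p$ norms and let $p_1=\tau(\bm m_1)/\sum_{i=1}^K\tau(\bm m_i)$. Then for $\bm X\sim\mathbb P_{\beta,h,N}$, as $N\to\infty$: 1. If $(\beta,h)\in\mathcal C^1_{p,q}\setminus\{(\beta_c,0)\}$, then $f_{\beta,h}$ has exactly two global maximizers $s_2>s_1>0$, $\bm m_1=\bm x_{s_1}$, $\bm m_2=\bm x_{s_2}$, and $$\sqrt N(\hat\beta_N-\beta)\xrightarrow{D}\tfrac{p_1}{2}\,\mathcal N^-\big(0,\sigma^2(s_1,\bm m_1)\big)+\tfrac{1-p_1}{2}\,\mathcal N^+\big(0,\sigma^2(s_2,\bm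 m_2)\big)+\tfrac12\delta_0.$$ 2. If $(\beta,h)\in\mathcal C^2_{p,q}$, then $f_{\beta,h}$ has exactly one global maximizer $s>0$, and $$\sqrt N(\hat\beta_N-\beta)\xrightarrow{D}\mathcal N\big(0,\sigma^2(s,\bm x_s)\big).$$ 3. If $(\beta,h)=(\beta_c,0)$, then $f_{\beta,h}$ has exactly two global maximizers, $0$ and $s>0$, and, as random variables in $[-\infty,\infty]$, $$\sqrt N(\hat\beta_N-\beta)\xrightarrow{D}p_1\gamma_1\delta_{-\infty}+\tfrac{1-p_1}{2}\,\mathcal N^+\big(0,\sigma^2(s,\bm x_s)\big)+\Big(\tfrac{1+p_1}{2}-p_1\gamma_1\Big)\delta_0.$$ -/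

import Mathlib

open MeasureTheory ProbabilityTheory Filter Topology

noncomputable section

namespace TensorPotts

/-! ### The model

Colours are the elements of `Fin q`; colour `0 : Fin q` is the one favoured by the field `h`
(it is written as colour `1` on paper, and coordinate `r` of a vector is `r + 1` on paper). -/

/-- The `r`-th coordinate of the empirical magnetization vector: the fraction of the `N` sites
that have colour `r`. -/
def magnetization (q N : ℕ) (X : Fin N → Fin q) (r : Fin q) : ℝ :=
  (∑ i, if X i = r then (1 : ℝ) else 0) / N

/-- The exponent `β N ∑ᵣ X̄ᵣ ^ p + N h X̄₁`. -/
def energy (p q N : ℕ) [NeZero q] (β h : ℝ) (X : Fin N → Fin q) : ℝ :=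
  β * N * ∑ r, magnetization q N X r ^ p + N * h * magnetization q N X 0

/-- The normalizing constant `Z_N(β, h)`, in the convention where the probabilities are
`exp (energy) / (q ^ N * Z_N)`. -/
def partitionFunction (p q N : ℕ) [NeZero q] (β h : ℝ) : ℝ :=
  (∑ X : Fin N → Fin q, Real.exp (energy p q N β h X)) / (q : ℝ) ^ N

/-- The probability (and likelihood) of a configuration `X ∈ [q]^N`. -/
def pottsProb (p q N : ℕ) [NeZero q] (β h : ℝ) (X : Fin N → Fin q) : ℝ :=
  1 / ((q : ℝ) ^ N * partitionFunction p q N β h) * Real.exp (energy p q N β h X)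

theorem sum_pottsProb (p q N : ℕ) [NeZero q] (β h : ℝ) :
    ∑ X : Fin N → Fin q, pottsProb p q N β h X = 1 := by
  have hq : (q : ℝ) ^ N ≠ 0 := pow_ne_zero _ (Nat.cast_ne_zero.mpr (NeZero.ne q))
  have hZ : (0 : ℝ) < ∑ X : Fin N → Fin q, Real.exp (energy p q N β h X) :=
    Finset.sum_pos (fun _ _ => Real.exp_pos _) Finset.univ_nonempty
  simp only [pottsProb, ← Finset.mul_sum, partitionFunction]
  rw [mul_div_cancel₀ _ hq, one_div, inv_mul_cancel₀ hZ.ne']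

theorem pottsProb_nonneg (p q N : ℕ) [NeZero q] (β h : ℝ) (X : Fin N → Fin q) :
    0 ≤ pottsProb p q N β h X := by
  unfold pottsProb partitionFunction
  positivity

/-- The `p`-tensor Curie-Weiss Potts model as a probability mass function on `[q]^N`. -/
def pottsPMF (p q N : ℕ) [NeZero q] (β h : ℝ) : PMF (Fin N → Fin q) :=
  PMF.ofFintype (fun X => ENNReal.ofReal (pottsProb p q N β h X)) (by
    rw [← ENNReal.ofReal_sum_of_nonneg (fun X _ => pottsProb_nonneg p q N β h X),
      sum_pottsProb, ENNReal.ofReal_one])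

/-- The law `ℙ_{β,h,N}` of the model. -/
abbrev pottsMeasure (p q N : ℕ) [NeZero q] (β h : ℝ) : Measure (Fin N → Fin q) :=
  (pottsPMF p q N β h).toMeasure

/-- `βhat` is a sequence of maximum likelihood estimators of `β` when `h` is known: for every
sample `X`, `βhat N X` maximizes the likelihood `b ↦ ℙ_{b,h,N}(X)` over the real line, whenever
a maximizer exists. Nothing is required of `βhat N X` when there is no maximizer. -/
def IsMLE (p q : ℕ) [NeZero q] (h : ℝ) (βhat : (N : ℕ) → (Fin N → Fin q) → ℝ) : Prop :=
  ∀ (N : ℕ) (X : Fin N → Fin q),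
    (∃ b : ℝ, IsMaxOn (fun b' => pottsProb p q N b' h X) Set.univ b) →
      IsMaxOn (fun b' => pottsProb p q N b' h X) Set.univ (βhat N X)

/-! ### The free energy and the classification of the parameters -/

/-- The negative free energy `H_{β,h}`. -/
def negFreeEnergy (p q : ℕ) [NeZero q] (β h : ℝ) (t : Fin q → ℝ) : ℝ :=
  β * ∑ r, t r ^ p + h * t 0 - ∑ r, t r * Real.log (t r)

/-- The set of global maximizers of `H_{β,h}` on the simplex of probability vectors. -/
def maximizers (p q : ℕ) [NeZero q] (β h : ℝ) : Set (Fin q → ℝ) :=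
  {m | m ∈ stdSimplex ℝ (Fin q) ∧ IsMaxOn (negFreeEnergy p q β h) (stdSimplex ℝ (Fin q)) m}

/-- The quadratic form `Q_{s,β}`. -/
def quadForm (p q : ℕ) (β : ℝ) (s t : Fin q → ℝ) : ℝ :=
  ∑ r, (β * p * (p - 1) * s r ^ (p - 2) - 1 / s r) * t r ^ 2

/-- `(β, h)` is critical: `H_{β,h}` has more than one global maximizer, and at each of them the
quadratic form is negative definite on the hyperplane of vectors with coordinate sum `0`. -/
def IsCritical (p q : ℕ) [NeZero q] (β h : ℝ) : Prop :=
  (maximizers p q β h).Nontrivial ∧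
    ∀ m ∈ maximizers p q β h, ∀ t : Fin q → ℝ, ∑ r, t r = 0 → t ≠ 0 → quadForm p q β m t < 0

/-- The vector `x_s = ((1 + (q - 1) s) / q, (1 - s) / q, …, (1 - s) / q)`. -/
def xvec (q : ℕ) [NeZero q] (s : ℝ) (r : Fin q) : ℝ :=
  if r = 0 then (1 + (q - 1) * s) / q else (1 - s) / q

/-- The function `f_{β,h}(s) = H_{β,h}(x_s)`. -/
def freeFun (p q : ℕ) [NeZero q] (β h s : ℝ) : ℝ :=
  negFreeEnergy p q β h (xvec q s)

/-- The second derivative `f_{β,h}''(s)`. -/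
def freeFun'' (p q : ℕ) [NeZero q] (β h s : ℝ) : ℝ :=
  iteratedDeriv 2 (freeFun p q β h) s

/-- The set of global maximizers of `f_{β,h}` on `[0, 1]`. -/
def freeFunMaximizers (p q : ℕ) [NeZero q] (β h : ℝ) : Set ℝ :=
  {s | s ∈ Set.Icc (0 : ℝ) 1 ∧ IsMaxOn (freeFun p q β h) (Set.Icc 0 1) s}

/-- Strongly critical points: critical, and `f_{β,h}` has more than one global maximizer. -/
def IsStronglyCritical (p q : ℕ) [NeZero q] (β h : ℝ) : Prop :=
  IsCritical p q β h ∧ (freeFunMaximizers p q β h).Nontrivial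

/-- Weakly critical points: critical, and `f_{β,h}` has a unique global maximizer. -/
def IsWeaklyCritical (p q : ℕ) [NeZero q] (β h : ℝ) : Prop :=
  IsCritical p q β h ∧ ∃! s, s ∈ freeFunMaximizers p q β h

/-- The transition point `β_c = inf {β ≥ 0 : f_{β,0} has a positive global maximizer}`. -/
def betaC (p q : ℕ) [NeZero q] : ℝ :=
  sInf {β : ℝ | 0 ≤ β ∧ ∃ s ∈ freeFunMaximizers p q β 0, 0 < s}

/-! ### The constants in the limit laws -/

/-- The second derivative of `k(x) = β x ^ p - x log x`. -/
def k'' (p : ℕ) (β x : ℝ) : ℝ :=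
  iteratedDeriv 2 (fun y : ℝ => β * y ^ p - y * Real.log y) x

/-- The number `s ≥ 0` for which `m` is a permutation of `x_s`, recovered from the smallest
coordinate `(1 - s) / q` of `m`. -/
def sParam (q : ℕ) (m : Fin q → ℝ) : ℝ :=
  1 - q * ⨅ r, m r

/-- The unnormalized weight `τ(m)` of a global maximizer `m`. -/
def tau (p q : ℕ) [NeZero q] (β h : ℝ) (m : Fin q → ℝ) : ℝ :=
  √((-freeFun'' p q β h (sParam q m))⁻¹ *
      (-k'' p β ((1 - sParam q m) / q)) ^ (2 - (q : ℤ)) / ∏ r, m r)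

/-- The `L^p` norm of a vector. -/
def lpNorm (p q : ℕ) (m : Fin q → ℝ) : ℝ :=
  (∑ r, |m r| ^ p) ^ (1 / (p : ℝ))

/-- The variance `-q² f''(s) / (p² (q-1)²) * (m₁^(p-1) - m₂^(p-1))^(-2)`. -/
def asympVar (p q : ℕ) [NeZero q] (β h s : ℝ) (m : Fin q → ℝ) : ℝ :=
  -((q : ℝ) ^ 2 * freeFun'' p q β h s / ((p : ℝ) ^ 2 * ((q : ℝ) - 1) ^ 2)) *
    ((m 0 ^ (p - 1) - m 1 ^ (p - 1)) ^ 2)⁻¹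

/-- The covariance matrix `Σ` of the fluctuations of the magnetization around `x_s`. -/
def sigmaMatrix (p q : ℕ) [NeZero q] (β h s : ℝ) : Matrix (Fin q) (Fin q) ℝ :=
  (-((q : ℝ) ^ 2 / ((q : ℝ) - 1) * freeFun'' p q β h s))⁻¹ •
    Matrix.of fun i j =>
      let ρ : ℝ := k'' p β ((1 + (q - 1) * s) / q) / k'' p β ((1 - s) / q)
      if i = 0 ∧ j = 0 then (q : ℝ) - 1
      else if i = 0 ∨ j = 0 then -1
      else if i = j then 1 + ((q : ℝ) - 2) * ρ
      else -ρ

/-- `γ₁ = ℙ(Wᵀ W ≤ (1 - q) / k''(1 / q))` for `W ∼ 𝒩(0, Σ)`, with `Σ` taken at `s = 0`. -/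
def gamma1 (p q : ℕ) [NeZero q] (β h : ℝ) : ℝ :=
  (multivariateGaussian (0 : EuclideanSpace ℝ (Fin q)) (sigmaMatrix p q β h 0)).real
    {W | ∑ r, W r ^ 2 ≤ (1 - (q : ℝ)) / k'' p β (1 / q)}

/-- The centred normal law with variance `v`. -/
def normalLaw (v : ℝ) : Measure ℝ := gaussianReal 0 v.toNNReal

/-- The positive half-normal law: the law of `|Z|` for `Z ∼ 𝒩(0, v)`. -/
def posHalfNormal (v : ℝ) : Measure ℝ := (normalLaw v).map fun z => |z|

/-- The negative half-normal law: the law of `-|Z|` for `Z ∼ 𝒩(0, v)`. -/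
def negHalfNormal (v : ℝ) : Measure ℝ := (normalLaw v).map fun z => -|z|

/-- Under `ℙ_{β,h,N}`, the random variables `T N` converge in distribution to `ν` (which is, in
particular, a probability measure). -/
def ConvergesUnderPotts (p q : ℕ) [NeZero q] (β h : ℝ) {E : Type*} [TopologicalSpace E]
    [MeasurableSpace E] [OpensMeasurableSpace E] (T : (N : ℕ) → (Fin N → Fin q) → E)
    (ν : Measure E) : Prop :=
  ∃ _ : IsProbabilityMeasure ν,
    TendstoInDistribution T atTop id (fun N => pottsMeasure p q N β h) ν

end TensorPotts

end

/-! The likelihood depends on β only through the statistic S, the sum of the p-th powers of the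
magnetization (`powerSum`), and the model is an exponential family in β. Unless S takes an extremal
value, the estimator is at most b exactly when S is at most its mean under b (`mle_le_iff`), and
extremal values have vanishing probability (`tendsto_pottsMeasure_extremal`). So the distribution
function of √N(β̂ - β) at t is asymptotically the probability, under β, that S lies below its mean
under β + t/√N (`tendsto_mle_cdf`).

Both quantities are ratios of Gibbs sums, evaluated by Laplace's method. Stirling's formula is kept
exact, the sum over counts becomes the integral of a step function on the scale 1/√N, and dominated
convergence produces at each nondegenerate maximizer a Gaussian integral with total mass
proportional to τ (`tendsto_gibbsSum_xvec`). Configurations far from the maximizers are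
exponentially negligible (`tendsto_gibbsSum_of_hasLocalLimit`).

Passing from β to β + t/√N multiplies the weights by exp(t√N S), which separates maximizers with
different values of S by factors exponential in √N. For t < 0 only those with the least S matter,
for t > 0 only those with the largest. Near x_s with s > 0, √N(S - S(x_s)) is asymptotically normal
with some variance V and the tilt moves its mean to tV (`tendsto_meanPowerSum_normal`). The event {Z
≤ tV} for Z of variance V has the probability of {Z' ≤ t} for Z' of variance 1/V. Maximizers with
smaller S lie entirely below the threshold, those with larger S entirely above it. With two values
of S the limit is p₁Φ₁(t) for t < 0 and p₁ + (1 - p₁)Φ₂(t) for t > 0, whose jump at 0 is 1/2; with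
one value it is normal.

If the uniform vector is a maximizer, S has no first order variation there. It fluctuates on the
scale 1/N as a positive quadratic form, so the tilt disappears and the threshold is the mean of that
form for every t < 0 (`tendsto_meanPowerSum_uniform`). The probability γ₁ of lying below the mean
does not depend on t, which is the mass that escapes to -∞.

Negative definiteness forces every maximizer to be a permutation of some x_s
(`exists_xvec_of_mem_maximizers`). Repeated use of Rolle's theorem shows that f has at most three
critical points (`gradFun_not_four_zeros`), hence at most two maximizers (`not_three_maximizers`),
and 0 is one of two exactly at (β_c, 0) (`eq_betaC_of_zero_mem`, `zero_mem_of_eq_betaC`). -/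

noncomputable section

namespace TensorPotts

/-! ### Counts of colours and multinomial coefficients -/

/-- The sum of the `p`-th powers of the coordinates. -/
def powerSum (p : ℕ) {q : ℕ} (t : Fin q → ℝ) : ℝ := ∑ r, t r ^ p

/-- The number of sites with a given colour. -/
def colourCount {q N : ℕ} (X : Fin N → Fin q) (r : Fin q) : ℕ :=
  (Finset.univ.filter fun i => X i = r).card

theorem magnetization_eq {q N : ℕ} (X : Fin N → Fin q) (r : Fin q) :
    magnetization q N X r = colourCount X r / N := by
  simp [magnetization, colourCount]

theorem sum_colourCount {q N : ℕ} (X : Fin N → Fin q) : ∑ r, colourCount X r = N := by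
  have := Finset.card_eq_sum_card_fiberwise (s := (Finset.univ : Finset (Fin N)))
    (t := (Finset.univ : Finset (Fin q))) (f := X) (fun _ _ => Finset.mem_univ _)
  simpa [colourCount] using this.symm

/-- The power (∑ X_r)^N in the polynomial ring is expanded in two ways, over maps from sites to
colours and by the multinomial theorem. Applying the linear functional that sends the monomial with
exponent n to F n gives the identity. -/
theorem sum_config {q N : ℕ} (F : (Fin q → ℕ) → ℝ) :
    ∑ X : Fin N → Fin q, F (colourCount X) =
      ∑ n ∈ Finset.piAntidiag Finset.univ N, (Nat.multinomial Finset.univ n : ℝ) * F n := by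
  classical
  let L : MvPolynomial (Fin q) ℝ →ₗ[ℝ] ℝ :=
    (MvPolynomial.basisMonomials (Fin q) ℝ).constr ℝ (fun n => F n)
  have hL : ∀ n : Fin q → ℕ, L (∏ r, (MvPolynomial.X r : MvPolynomial (Fin q) ℝ) ^ n r) = F n := by
    intro n
    have h1 : ∏ r, (MvPolynomial.X r : MvPolynomial (Fin q) ℝ) ^ n r =
        MvPolynomial.basisMonomials (Fin q) ℝ (Finsupp.equivFunOnFinite.symm n) := by
      rw [MvPolynomial.coe_basisMonomials]
      simp only []
      rw [MvPolynomial.monomial_eq, Finsupp.prod_fintype] <;> simp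
    rw [h1]
    simp only [L, Module.Basis.constr_basis]
    rfl
  have h2 := Fintype.sum_pow (fun r => (MvPolynomial.X r : MvPolynomial (Fin q) ℝ)) N
  rw [Finset.sum_pow_eq_sum_piAntidiag] at h2
  have h3 := congrArg L h2
  rw [map_sum, map_sum] at h3
  rw [Finset.sum_congr rfl (g := fun n => (Nat.multinomial Finset.univ n : ℝ) * F n)
    (fun n _ => by rw [← hL n, ← nsmul_eq_mul, map_nsmul, nsmul_eq_mul])] at h3
  rw [h3]
  refine Finset.sum_congr rfl fun X _ => ?_
  rw [← hL]
  congr 1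
  rw [← Finset.prod_fiberwise (s := Finset.univ) (g := X)]
  refine Finset.prod_congr rfl fun r _ => ?_
  rw [Finset.prod_congr rfl (g := fun _ => MvPolynomial.X r)]
  · simp [colourCount]
  · intro i hi
    rw [(Finset.mem_filter.1 hi).2]

/-- The proportions attached to a vector of counts. -/
def proportion {q : ℕ} (N : ℕ) (n : Fin q → ℕ) (r : Fin q) : ℝ := (n r : ℝ) / N

/-- Entropy of a vector. -/
def entropy {q : ℕ} (t : Fin q → ℝ) : ℝ := -∑ r, t r * Real.log (t r)

theorem negFreeEnergy_eq (p q : ℕ) [NeZero q] (β h : ℝ) (t : Fin q → ℝ) :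
    negFreeEnergy p q β h t = β * powerSum p t + h * t 0 + entropy t := by
  simp [negFreeEnergy, powerSum, entropy, sub_eq_add_neg]

theorem energy_eq (p q N : ℕ) [NeZero q] (β h : ℝ) (X : Fin N → Fin q) :
    energy p q N β h X =
      N * (β * powerSum p (magnetization q N X) + h * magnetization q N X 0) := by
  simp [energy, powerSum]; ring

theorem proportion_mem_stdSimplex {q N : ℕ} (hN : N ≠ 0) {n : Fin q → ℕ}
    (hn : ∑ r, n r = N) : proportion N n ∈ stdSimplex ℝ (Fin q) := by
  refine ⟨fun r => by unfold proportion; positivity, ?_⟩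
  simp only [proportion]
  rw [← Finset.sum_div, ← Nat.cast_sum, hn, div_self (by exact_mod_cast hN)]

theorem magnetization_eq_proportion {q N : ℕ} (X : Fin N → Fin q) :
    magnetization q N X = proportion N (colourCount X) :=
  funext fun r => magnetization_eq X r

theorem magnetization_mem_stdSimplex {q N : ℕ} (hN : N ≠ 0) (X : Fin N → Fin q) :
    magnetization q N X ∈ stdSimplex ℝ (Fin q) := by
  rw [magnetization_eq_proportion]
  exact proportion_mem_stdSimplex hN (sum_colourCount X)

/-- At the point t = n/N the multinomial expansion of (∑ t_r)^N = 1 has nonnegative terms, so the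
term of index n is at most 1; its monomial equals exp(-N · entropy). -/
theorem multinomial_le_exp_entropy {q N : ℕ} (hN : N ≠ 0) {n : Fin q → ℕ}
    (hn : ∑ r, n r = N) :
    (Nat.multinomial Finset.univ n : ℝ) ≤ Real.exp (N * entropy (proportion N n)) := by
  classical
  have hN0 : (N : ℝ) ≠ 0 := by exact_mod_cast hN
  have h1 := Finset.sum_pow_eq_sum_piAntidiag Finset.univ (proportion N n) N
  rw [(proportion_mem_stdSimplex hN hn).2, one_pow] at h1
  have hmem : n ∈ Finset.piAntidiag Finset.univ N := by simp [hn]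
  have h2 := Finset.single_le_sum (f := fun k => (Nat.multinomial Finset.univ k : ℝ) *
    ∏ i, proportion N n i ^ k i) (fun k _ => by unfold proportion; positivity) hmem
  rw [← h1] at h2
  have h3 : ∏ i, proportion N n i ^ n i = Real.exp (-(N * entropy (proportion N n))) := by
    rw [entropy, mul_neg, neg_neg, Finset.mul_sum, Real.exp_sum]
    refine Finset.prod_congr rfl fun i _ => ?_
    rcases Nat.eq_zero_or_pos (n i) with h0 | h0
    · simp [h0, proportion]
    · have : 0 < proportion N n i := by unfold proportion; positivity
      unfold proportion at this
      rw [← mul_assoc, proportion, mul_div_cancel₀ _ hN0, Real.exp_nat_mul, Real.exp_log this]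
  rw [h3, Real.exp_neg, ← div_eq_mul_inv, div_le_one (Real.exp_pos _)] at h2
  exact h2

/-- Stirling's sequence, normalized to have limit `1`. -/
def stirlingFactor (n : ℕ) : ℝ := Stirling.stirlingSeq n / √Real.pi

theorem tendsto_stirlingFactor : Tendsto stirlingFactor atTop (𝓝 1) := by
  have h := Stirling.tendsto_stirlingSeq_sqrt_pi.div_const (√Real.pi)
  rwa [div_self (by positivity)] at h

theorem one_le_stirlingFactor {n : ℕ} (hn : n ≠ 0) : 1 ≤ stirlingFactor n := by
  rw [stirlingFactor, one_le_div (by positivity)]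
  exact Stirling.sqrt_pi_le_stirlingSeq hn

theorem stirlingFactor_le {n : ℕ} (hn : n ≠ 0) : stirlingFactor n ≤ stirlingFactor 1 := by
  obtain ⟨k, rfl⟩ := Nat.exists_eq_succ_of_ne_zero hn
  exact div_le_div_of_nonneg_right (Stirling.stirlingSeq'_antitone (Nat.zero_le k)) (by positivity)

theorem factorial_eq_stirlingFactor {n : ℕ} (hn : n ≠ 0) :
    (n.factorial : ℝ) =
      stirlingFactor n * √(2 * Real.pi) * √n * Real.exp (n * Real.log n - n) := by
  have hn' : (0 : ℝ) < n := by positivity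
  have h1 : Real.exp (n * Real.log n - n) = (n / Real.exp 1) ^ n := by
    rw [Real.exp_sub, div_pow, ← Real.exp_nat_mul, mul_one, Real.exp_nat_mul, Real.exp_log hn']
  rw [h1, stirlingFactor, Stirling.stirlingSeq, Real.sqrt_mul (by norm_num),
    Real.sqrt_mul (by norm_num)]
  field_simp

/-- Stirling's formula as an identity: the error is carried by `stirlingFactor`, which tends to 1
and lies between 1 and its value at 1. The limit and the domination in Laplace's method both come
from these two facts. -/
theorem multinomial_eq_stirling {d N : ℕ} {n : Fin (d + 1) → ℕ}
    (hn : ∑ r, n r = N) (hpos : ∀ r, n r ≠ 0) :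
    (Nat.multinomial Finset.univ n : ℝ) =
      (stirlingFactor N / ∏ r, stirlingFactor (n r)) * (√(2 * Real.pi) ^ d)⁻¹ *
        (√N / ∏ r, √(n r : ℝ)) * Real.exp (N * entropy (proportion N n)) := by
  have hN : N ≠ 0 := by
    rintro rfl
    exact hpos 0 (by simpa using (Finset.sum_eq_zero_iff.1 hn) 0)
  have hspec : ((∏ r, ((n r).factorial : ℝ)) * Nat.multinomial Finset.univ n) = N.factorial := by
    have := Nat.multinomial_spec Finset.univ n
    rw [hn] at this
    exact_mod_cast this
  have hprod : ∏ r, ((n r).factorial : ℝ) = (∏ r, stirlingFactor (n r)) *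
      √(2 * Real.pi) ^ (d + 1) * (∏ r, √(n r : ℝ)) *
      Real.exp (∑ r, ((n r : ℝ) * Real.log (n r) - n r)) := by
    rw [Finset.prod_congr rfl fun r _ => factorial_eq_stirlingFactor (hpos r)]
    simp only [Finset.prod_mul_distrib, Real.exp_sum]
    simp
  have hexp : ∑ r, ((n r : ℝ) * Real.log (n r) - n r) =
      N * Real.log N - N - N * entropy (proportion N n) := by
    have hN' : (N : ℝ) = ∑ r, (n r : ℝ) := by rw [← hn]; push_cast; rfl
    have : N * entropy (proportion N n) = -∑ r, (n r : ℝ) * (Real.log (n r) - Real.log N) := by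
      rw [entropy, mul_neg, Finset.mul_sum]
      congr 1
      refine Finset.sum_congr rfl fun r _ => ?_
      rw [proportion, Real.log_div (by exact_mod_cast hpos r) (by exact_mod_cast hN)]
      have : (N : ℝ) ≠ 0 := by exact_mod_cast hN
      field_simp
    rw [this, Finset.sum_sub_distrib, ← hN']
    simp only [mul_sub, Finset.sum_sub_distrib, ← Finset.sum_mul, ← hN']
    ring
  have hs : ∀ k : ℕ, k ≠ 0 → stirlingFactor k ≠ 0 := fun k hk =>
    (zero_lt_one.trans_le (one_le_stirlingFactor hk)).ne'
  have h1 : ∏ r, stirlingFactor (n r) ≠ 0 := Finset.prod_ne_zero_iff.2 fun r _ => hs _ (hpos r)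
  have h2 : ∏ r, √(n r : ℝ) ≠ 0 := Finset.prod_ne_zero_iff.2 fun r _ => by
    have := Nat.pos_of_ne_zero (hpos r)
    positivity
  have h3 : √(2 * Real.pi) ≠ 0 := by positivity
  rw [hprod, factorial_eq_stirlingFactor hN, hexp, Real.exp_sub _ (N * entropy _)] at hspec
  have h4 := Real.exp_ne_zero (N * entropy (proportion N n))
  have h5 := Real.exp_ne_zero (N * Real.log N - N)
  generalize Real.exp (N * entropy (proportion N n)) = E at *
  generalize Real.exp (N * Real.log N - N) = E' at *
  generalize (Nat.multinomial Finset.univ n : ℝ) = M at *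
  generalize √(2 * Real.pi) = P at *
  field_simp at hspec ⊢
  rw [pow_succ] at hspec
  refine mul_right_cancel₀ h3 ?_
  linear_combination hspec

/-! ### Sums over counts as integrals of step functions -/

/-- The point of the lattice `N⁻¹ ℤ^(d+1)`, with coordinate sum `1`, that has the given numerators
in all coordinates but the first. -/
def latticeVec {d : ℕ} (N : ℕ) (z : Fin d → ℤ) : Fin (d + 1) → ℝ :=
  Fin.cons (1 - ∑ i, (z i : ℝ) / N) (fun i => (z i : ℝ) / N)

/-- The last d counts determine the first, and they index disjoint unit cubes on which the integrand
is constant. -/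
theorem sum_proportion_eq_integral {d N : ℕ} (hN : N ≠ 0) (Φ : (Fin (d + 1) → ℝ) → ℝ)
    (hΦ : ∀ t, (∃ r, t r < 0) → Φ t = 0) :
    ∑ n ∈ Finset.piAntidiag (Finset.univ : Finset (Fin (d + 1))) N, Φ (proportion N n) =
      ∫ x : Fin d → ℝ, Φ (latticeVec N fun i => ⌊x i⌋) := by
  classical
  have hN0 : (0 : ℝ) < N := by positivity
  let cube : (Fin (d + 1) → ℕ) → Set (Fin d → ℝ) := fun n =>
    Set.univ.pi fun i => Set.Ico (n i.succ : ℝ) (n i.succ + 1)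
  have hcube : ∀ n, MeasurableSet (cube n) := fun n =>
    MeasurableSet.univ_pi fun i => measurableSet_Ico
  have hvol : ∀ n, volume.real (cube n) = 1 := fun n => by
    rw [measureReal_def, Real.volume_pi_Ico_toReal]
    · simp
    · intro i; simp
  have hmem : ∀ n x, x ∈ cube n ↔ ∀ i, ⌊x i⌋ = n i.succ := fun n x => by
    simp only [cube, Set.mem_univ_pi, Set.mem_Ico, Int.floor_eq_iff]
    norm_cast
  have hprop : ∀ n ∈ Finset.piAntidiag (Finset.univ : Finset (Fin (d + 1))) N,
      latticeVec N (fun i => (n i.succ : ℤ)) = proportion N n := by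
    intro n hn
    have hs : (n 0 : ℝ) + ∑ i : Fin d, (n i.succ : ℝ) = N := by
      have h := (Finset.mem_piAntidiag.1 hn).1
      rw [Fin.sum_univ_succ] at h
      exact_mod_cast h
    funext r
    refine Fin.cases ?_ (fun i => ?_) r
    · simp only [latticeVec, Fin.cons_zero, proportion, ← Finset.sum_div]
      field_simp
      push_cast
      linarith
    · simp [latticeVec, proportion]
  have hpt : ∀ x : Fin d → ℝ, Φ (latticeVec N fun i => ⌊x i⌋) =
      ∑ n ∈ Finset.piAntidiag (Finset.univ : Finset (Fin (d + 1))) N,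
        (cube n).indicator (fun _ => Φ (proportion N n)) x := by
    intro x
    by_cases hx : ∃ n ∈ Finset.piAntidiag (Finset.univ : Finset (Fin (d + 1))) N, x ∈ cube n
    · obtain ⟨n, hn, hxn⟩ := hx
      rw [Finset.sum_eq_single n]
      · rw [Set.indicator_of_mem hxn, ← hprop n hn]
        congr 2
        funext i
        exact (hmem n x).1 hxn i
      · intro n' hn' hne
        refine Set.indicator_of_notMem (fun hx' => hne ?_) _
        have htail : ∀ i : Fin d, n' i.succ = n i.succ := fun i => by
          have := ((hmem n' x).1 hx' i).symm.trans ((hmem n x).1 hxn i)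
          exact_mod_cast this
        have h1 := (Finset.mem_piAntidiag.1 hn).1
        have h2 := (Finset.mem_piAntidiag.1 hn').1
        rw [Fin.sum_univ_succ] at h1 h2
        rw [Finset.sum_congr rfl fun i _ => htail i] at h2
        funext r
        exact Fin.cases (by omega) htail r
      · exact fun h => absurd hn h
    · rw [Finset.sum_eq_zero fun n hn => Set.indicator_of_notMem (fun h => hx ⟨n, hn, h⟩) _]
      -- If no coordinate of the lattice vector were negative, the floors and their complement to N
      -- would be the counts of a cube containing x.
      refine hΦ _ ?_
      by_contra hneg
      push Not at hneg
      refine hx ⟨Fin.cons (N - ∑ i, ⌊x i⌋).toNat (fun i => ⌊x i⌋.toNat), ?_, ?_⟩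
      · have hz : ∀ i, 0 ≤ ⌊x i⌋ := fun i => by
          have := hneg i.succ
          simp only [latticeVec, Fin.cons_succ] at this
          have h3 := mul_nonneg this hN0.le
          rw [div_mul_cancel₀ _ hN0.ne'] at h3
          exact_mod_cast h3
        have h0 : 0 ≤ (N : ℤ) - ∑ i, ⌊x i⌋ := by
          have := hneg 0
          simp only [latticeVec, Fin.cons_zero, ← Finset.sum_div, sub_nonneg,
            div_le_one hN0] at this
          have h3 : ∑ i, ⌊x i⌋ ≤ (N : ℤ) := by exact_mod_cast this
          omega
        rw [Finset.mem_piAntidiag]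
        refine ⟨?_, fun _ _ => Finset.mem_univ _⟩
        rw [Fin.sum_univ_succ]
        simp only [Fin.cons_zero, Fin.cons_succ]
        zify
        rw [Int.toNat_of_nonneg h0, Finset.sum_congr rfl fun i _ => Int.toNat_of_nonneg (hz i)]
        ring
      · rw [hmem]
        intro i
        have := hneg i.succ
        simp only [latticeVec, Fin.cons_succ] at this
        have h3 := mul_nonneg this hN0.le
        rw [div_mul_cancel₀ _ hN0.ne'] at h3
        have h4 : 0 ≤ ⌊x i⌋ := by exact_mod_cast h3
        simp [Int.toNat_of_nonneg h4]
  simp_rw [hpt]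
  rw [integral_finsetSum]
  · refine Finset.sum_congr rfl fun n _ => ?_
    rw [integral_indicator_const _ (hcube n), hvol, one_smul]
  · intro n _
    refine (integrable_indicator_iff (hcube n)).2 (integrableOn_const (hs := ?_))
    intro h
    have := hvol n
    rw [measureReal_def, h] at this
    simp at this

/-- The lattice point obtained by rounding `m + y / √N`. -/
def latticePoint {d : ℕ} (N : ℕ) (m : Fin (d + 1) → ℝ) (y : Fin d → ℝ) : Fin (d + 1) → ℝ :=
  latticeVec N fun i => ⌊N * m i.succ + √N * y i⌋

/-- The substitution x = N m + √N y, centred at m on the fluctuation scale, has Jacobian (√N)^d. -/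
theorem sum_proportion_eq_integral_latticePoint {d N : ℕ} (hN : N ≠ 0)
    (m : Fin (d + 1) → ℝ) (Φ : (Fin (d + 1) → ℝ) → ℝ) (hΦ : ∀ t, (∃ r, t r < 0) → Φ t = 0) :
    ∑ n ∈ Finset.piAntidiag (Finset.univ : Finset (Fin (d + 1))) N, Φ (proportion N n) =
      √N ^ d * ∫ y : Fin d → ℝ, Φ (latticePoint N m y) := by
  have hs : (0 : ℝ) < √N := by positivity
  have h1 := Measure.integral_comp_smul (volume : Measure (Fin d → ℝ))
    (fun x : Fin d → ℝ => Φ (latticeVec N fun i => ⌊N * m i.succ + x i⌋)) (√N)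
  have h2 := integral_add_left_eq_self (μ := (volume : Measure (Fin d → ℝ)))
    (fun x : Fin d → ℝ => Φ (latticeVec N fun i => ⌊x i⌋)) (fun i => N * m i.succ)
  simp only [Pi.add_apply] at h2
  rw [h2, ← sum_proportion_eq_integral hN Φ hΦ] at h1
  simp only [Pi.smul_apply, smul_eq_mul, Module.finrank_fin_fun] at h1
  simp only [latticePoint]
  rw [h1, abs_of_pos (by positivity), mul_inv_cancel_left₀ (by positivity)]

/-- The Gibbs sum of a function of the magnetization. -/
def gibbsSum (p : ℕ) {q : ℕ} [NeZero q] (β h : ℝ) (N : ℕ) (G : (Fin q → ℝ) → ℝ) : ℝ :=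
  ∑ X : Fin N → Fin q, Real.exp (energy p q N β h X) * G (magnetization q N X)

theorem gibbsSum_eq_sum_proportion (p : ℕ) {q : ℕ} [NeZero q] (β h : ℝ) (N : ℕ)
    (G : (Fin q → ℝ) → ℝ) :
    gibbsSum p β h N G = ∑ n ∈ Finset.piAntidiag (Finset.univ : Finset (Fin q)) N,
      (Nat.multinomial Finset.univ n : ℝ) *
        (Real.exp (N * (β * powerSum p (proportion N n) + h * proportion N n 0)) *
          G (proportion N n)) := by
  rw [← sum_config (fun n => Real.exp (N * (β * powerSum p (proportion N n) +
    h * proportion N n 0)) * G (proportion N n)), gibbsSum]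
  refine Finset.sum_congr rfl fun X _ => ?_
  rw [energy_eq, magnetization_eq_proportion]

/-- The correction to Stirling's formula for the multinomial coefficient. -/
def stirlingRatio {d : ℕ} (N : ℕ) (t : Fin (d + 1) → ℝ) : ℝ :=
  stirlingFactor N / ∏ r, stirlingFactor ⌊N * t r⌋₊

/-- The Jacobian (√N)^d cancels the power of N that Stirling's formula leaves in front. Vanishing of
G on the boundary discards the counts with a zero entry, where the identity of
`multinomial_eq_stirling` is not available. -/
theorem gibbsSum_eq_integral (p : ℕ) {d : ℕ} (β h : ℝ) {N : ℕ} (hN : N ≠ 0)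
    (m : Fin (d + 1) → ℝ) (c : ℝ) (G : (Fin (d + 1) → ℝ) → ℝ) (hG : ∀ t, (∃ r, t r ≤ 0) → G t = 0) :
    Real.exp (-(N * c)) * gibbsSum p β h N G =
      (√(2 * Real.pi) ^ d)⁻¹ * ∫ y : Fin d → ℝ,
        stirlingRatio N (latticePoint N m y) * (∏ r, √(latticePoint N m y r))⁻¹ *
          Real.exp (N * (negFreeEnergy p (d + 1) β h (latticePoint N m y) - c)) *
            G (latticePoint N m y) := by
  have hN0 : (0 : ℝ) < N := by positivity
  have hs : (0 : ℝ) < √N := by positivity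
  rw [gibbsSum_eq_sum_proportion, Finset.mul_sum]
  have key := sum_proportion_eq_integral_latticePoint hN m (fun t => (√N ^ d)⁻¹ *
    ((√(2 * Real.pi) ^ d)⁻¹ * (stirlingRatio N t * (∏ r, √(t r))⁻¹ *
          Real.exp (N * (negFreeEnergy p (d + 1) β h t - c)) * G t)))
    (fun t ⟨r, hr⟩ => by rw [hG t ⟨r, hr.le⟩]; simp)
  rw [integral_const_mul, integral_const_mul, mul_inv_cancel_left₀ (by positivity)] at key
  rw [← key]
  refine Finset.sum_congr rfl fun n hn => ?_
  have hn1 := (Finset.mem_piAntidiag.1 hn).1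
  by_cases h0 : ∃ r, n r = 0
  · obtain ⟨r, hr⟩ := h0
    rw [hG (proportion N n) ⟨r, by simp [proportion, hr]⟩]
    simp
  push Not at h0
  rw [multinomial_eq_stirling hn1 h0, negFreeEnergy_eq]
  have e1 : stirlingRatio N (proportion N n) = stirlingFactor N / ∏ r, stirlingFactor (n r) := by
    rw [stirlingRatio]
    congr 1
    refine Finset.prod_congr rfl fun r _ => ?_
    rw [proportion, mul_div_cancel₀ _ hN0.ne', Nat.floor_natCast]
  have e2 : √N / ∏ r, √(n r : ℝ) = (√N ^ d)⁻¹ * (∏ r, √(proportion N n r))⁻¹ := by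
    have : ∏ r, √(n r : ℝ) = √N ^ (d + 1) * ∏ r, √(proportion N n r) := by
      rw [show √(N : ℝ) ^ (d + 1) = ∏ _r : Fin (d + 1), √(N : ℝ) by simp, ← Finset.prod_mul_distrib]
      refine Finset.prod_congr rfl fun r _ => ?_
      rw [← Real.sqrt_mul hN0.le, proportion, mul_div_cancel₀ _ hN0.ne']
    have hp : ∏ r, √(proportion N n r) ≠ 0 := Finset.prod_ne_zero_iff.2 fun r _ => by
      have := Nat.pos_of_ne_zero (h0 r)
      unfold proportion
      positivity
    rw [this, pow_succ]
    field_simp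
  have e3 : Real.exp (N * (β * powerSum p (proportion N n) + h * proportion N n 0 +
      entropy (proportion N n) - c)) = Real.exp (-(N * c)) *
      Real.exp (N * entropy (proportion N n)) *
      Real.exp (N * (β * powerSum p (proportion N n) + h * proportion N n 0)) := by
    rw [← Real.exp_add, ← Real.exp_add]
    congr 1
    ring
  rw [e1, e2, e3]
  ring

/-! ### Laplace's method at a nondegenerate interior maximizer -/

/-- The vector with coordinate sum `0` that has the given coordinates after the first. -/
def hyper {d : ℕ} (y : Fin d → ℝ) : Fin (d + 1) → ℝ := Fin.cons (-∑ i, y i) y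

theorem continuous_hyper {d : ℕ} : Continuous (hyper (d := d)) := by
  refine continuous_pi fun r => ?_
  refine Fin.cases ?_ (fun i => ?_) r
  · simp only [hyper, Fin.cons_zero]; fun_prop
  · simp only [hyper, Fin.cons_succ]; fun_prop

theorem sum_hyper {d : ℕ} (y : Fin d → ℝ) : ∑ r, hyper y r = 0 := by
  simp [hyper, Fin.sum_univ_succ]

/-- The rounding of `y` for which `latticePoint N m y = m + hyper (roundVec N m y) / √N`. -/
def roundVec {d : ℕ} (N : ℕ) (m : Fin (d + 1) → ℝ) (y : Fin d → ℝ) (i : Fin d) : ℝ :=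
  √N * ((⌊N * m i.succ + √N * y i⌋ : ℝ) / N - m i.succ)

theorem latticePoint_eq {d N : ℕ} (hN : N ≠ 0) {m : Fin (d + 1) → ℝ} (hm : ∑ r, m r = 1)
    (y : Fin d → ℝ) :
    latticePoint N m y = m + (√N)⁻¹ • hyper (roundVec N m y) := by
  have hs : √(N : ℝ) ≠ 0 := by positivity
  rw [Fin.sum_univ_succ] at hm
  funext r
  refine Fin.cases ?_ (fun i => ?_) r
  · simp only [latticePoint, latticeVec, hyper, Fin.cons_zero, Pi.add_apply, Pi.smul_apply,
      smul_eq_mul, roundVec, ← Finset.mul_sum, Finset.sum_sub_distrib]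
    field_simp
    linarith
  · simp only [latticePoint, latticeVec, hyper, Fin.cons_succ, Pi.add_apply, Pi.smul_apply,
      smul_eq_mul, roundVec]
    field_simp
    ring

theorem abs_roundVec_sub_le {d N : ℕ} (hN : N ≠ 0) (m : Fin (d + 1) → ℝ) (y : Fin d → ℝ)
    (i : Fin d) : |roundVec N m y i - y i| ≤ (√N)⁻¹ := by
  have hs : (0 : ℝ) < √N := by positivity
  have hsq : √(N : ℝ) * √N = N := Real.mul_self_sqrt (Nat.cast_nonneg N)
  have h1 := Int.floor_le (N * m i.succ + √N * y i)
  have h2 := (Int.lt_floor_add_one (N * m i.succ + √N * y i)).le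
  have e : roundVec N m y i - y i =
      (⌊N * m i.succ + √N * y i⌋ - (N * m i.succ + √N * y i)) / √N := by
    rw [roundVec, eq_div_iff hs.ne']
    have hN' : (N : ℝ) ≠ 0 := by exact_mod_cast hN
    field_simp
    linear_combination (⌊N * m i.succ + √N * y i⌋ - N * m i.succ) * hsq
  rw [e, abs_div, abs_of_pos hs, div_eq_mul_inv]
  refine mul_le_of_le_one_left (by positivity) ?_
  rw [abs_le]
  constructor <;> linarith

theorem tendsto_inv_sqrt_nat : Tendsto (fun N : ℕ => (√(N : ℝ))⁻¹) atTop (𝓝 0) :=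
  (Real.tendsto_sqrt_atTop.comp tendsto_natCast_atTop_atTop).inv_tendsto_atTop

theorem tendsto_roundVec {d : ℕ} (m : Fin (d + 1) → ℝ) (y : Fin d → ℝ) :
    Tendsto (fun N => roundVec N m y) atTop (𝓝 y) := by
  rw [tendsto_pi_nhds]
  intro i
  rw [tendsto_iff_dist_tendsto_zero]
  refine squeeze_zero' (Eventually.of_forall fun _ => dist_nonneg) ?_ tendsto_inv_sqrt_nat
  filter_upwards [eventually_ne_atTop 0] with N hN
  exact abs_roundVec_sub_le hN m y i

theorem tendsto_add_smul_hyper {d : ℕ} (m : Fin (d + 1) → ℝ) {y : Fin d → ℝ} {u : ℕ → Fin d → ℝ}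
    (hu : Tendsto u atTop (𝓝 y)) :
    Tendsto (fun N : ℕ => m + (√(N : ℝ))⁻¹ • hyper (u N)) atTop (𝓝 m) := by
  have h := (tendsto_inv_sqrt_nat.smul ((continuous_hyper.tendsto y).comp hu)).const_add m
  simpa using h

theorem tendsto_stirlingRatio {d : ℕ} {m : Fin (d + 1) → ℝ} (hpos : ∀ r, 0 < m r)
    {t : ℕ → Fin (d + 1) → ℝ} (ht : Tendsto t atTop (𝓝 m)) :
    Tendsto (fun N => stirlingRatio N (t N)) atTop (𝓝 1) := by
  have h : ∀ r, Tendsto (fun N : ℕ => stirlingFactor ⌊N * t N r⌋₊) atTop (𝓝 1) := fun r =>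
    tendsto_stirlingFactor.comp (tendsto_nat_floor_atTop.comp
      (tendsto_natCast_atTop_atTop.atTop_mul_pos (hpos r) (tendsto_pi_nhds.1 ht r)))
  have h1 : Tendsto (fun N => stirlingRatio N (t N)) atTop
      (𝓝 (1 / ∏ _r : Fin (d + 1), (1 : ℝ))) :=
    tendsto_stirlingFactor.div (tendsto_finsetProd Finset.univ fun r _ => h r) (by simp)
  simpa using h1

theorem stirlingRatio_nonneg {d : ℕ} (N : ℕ) (t : Fin (d + 1) → ℝ) : 0 ≤ stirlingRatio N t := by
  have : ∀ n, 0 ≤ stirlingFactor n := fun n => by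
    unfold stirlingFactor Stirling.stirlingSeq; positivity
  exact div_nonneg (this _) (Finset.prod_nonneg fun _ _ => this _)

theorem stirlingRatio_le {d N : ℕ} (hN : N ≠ 0) {t : Fin (d + 1) → ℝ}
    (ht : ∀ r, ⌊N * t r⌋₊ ≠ 0) : stirlingRatio N t ≤ stirlingFactor 1 := by
  have h1 : 1 ≤ ∏ r, stirlingFactor ⌊N * t r⌋₊ :=
    Finset.one_le_prod fun r _ => one_le_stirlingFactor (ht r)
  refine (div_le_self ?_ h1).trans (stirlingFactor_le hN)
  exact zero_le_one.trans (one_le_stirlingFactor hN)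

/-- N times a coordinate is an integer, so it is at least 1 once it is positive. This makes
`stirlingRatio_le` applicable. -/
theorem floor_latticePoint_ne_zero {d N : ℕ} (hN : N ≠ 0) {m : Fin (d + 1) → ℝ} {y : Fin d → ℝ}
    {r : Fin (d + 1)} (h : 0 < latticePoint N m y r) : ⌊N * latticePoint N m y r⌋₊ ≠ 0 := by
  have hN0 : (0 : ℝ) < N := by positivity
  obtain ⟨k, hk⟩ : ∃ k : ℤ, N * latticePoint N m y r = k := by
    refine Fin.cases ?_ (fun i => ?_) r
    · refine ⟨N - ∑ i, ⌊N * m i.succ + √N * y i⌋, ?_⟩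
      simp only [latticePoint, latticeVec, Fin.cons_zero, ← Finset.sum_div]
      field_simp
      push_cast
      ring
    · refine ⟨⌊N * m i.succ + √N * y i⌋, ?_⟩
      simp only [latticePoint, latticeVec, Fin.cons_succ]
      field_simp
  have h1 : (0 : ℝ) < k := hk ▸ mul_pos hN0 h
  have h2 : (1 : ℝ) ≤ k := by exact_mod_cast (by exact_mod_cast h1 : 0 < k)
  rw [hk]
  exact (Nat.floor_pos.2 h2).ne'

/-- The map factors through the countable set ℤ^d, so F may be arbitrary. -/
theorem measurable_latticePoint {d : ℕ} (N : ℕ) (m : Fin (d + 1) → ℝ)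
    (F : (Fin (d + 1) → ℝ) → ℝ) : Measurable fun y => F (latticePoint N m y) := by
  have h : Measurable fun y : Fin d → ℝ => fun i => ⌊N * m i.succ + √N * y i⌋ := by
    fun_prop
  exact (measurable_of_countable (f := fun z : Fin d → ℤ => F (latticeVec N z))).comp
    (measurable_pi_iff.2 fun i => (measurable_pi_iff.1 h i))

/-- Supplies an integrable majorant independent of N, with u the rounded coordinate and v the true
one. Half of the quadratic rate is lost by u² ≥ v²/2 - 1, and another quarter by absorbing B|v| into
c v²/4 + B²/c. -/
theorem gaussian_rounding_bound {c B u v : ℝ} (hc : 0 < c) (hB : 0 ≤ B) (h : |u - v| ≤ 1) :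
    Real.exp (-c * u ^ 2 + B * |u|) ≤
      Real.exp (c + B + B ^ 2 / c) * Real.exp (-(c / 4) * v ^ 2) := by
  rw [← Real.exp_add]
  refine Real.exp_le_exp.2 ?_
  have h1 : |u| ≤ |v| + 1 := by
    have := abs_sub_abs_le_abs_sub u v
    linarith
  have h2 : v ^ 2 / 2 - 1 ≤ u ^ 2 := by
    have : (u - v) ^ 2 ≤ 1 := by rw [← sq_abs]; nlinarith [abs_nonneg (u - v)]
    nlinarith [sq_nonneg (u + (u - v))]
  have h3 : B * |v| ≤ c / 4 * v ^ 2 + B ^ 2 / c := by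
    have : 0 ≤ (c / 2 * |v| - B) ^ 2 / c := by positivity
    have e : (c / 2 * |v| - B) ^ 2 / c = c / 4 * v ^ 2 - B * |v| + B ^ 2 / c := by
      rw [← sq_abs v]; field_simp
      ring
    linarith
  have h4 : B * |u| ≤ B * |v| + B := by nlinarith
  nlinarith

/-- **Laplace's method** for Gibbs sums localized near an interior point `m` around which the
negative free energy is bounded above by a negative definite quadratic form. -/
theorem tendsto_gibbsSum_local {p d : ℕ} {β h : ℝ} {m : Fin (d + 1) → ℝ} {ε c : ℝ}
    {A : (Fin d → ℝ) → ℝ} (hm : ∑ r, m r = 1) (hε : 0 < ε) (hmε : ∀ r, 2 * ε ≤ m r)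
    (hlim : ∀ y (u : ℕ → Fin d → ℝ), Tendsto u atTop (𝓝 y) → Tendsto (fun N : ℕ =>
      N * (negFreeEnergy p (d + 1) β h (m + (√(N : ℝ))⁻¹ • hyper (u N)) -
        negFreeEnergy p (d + 1) β h m)) atTop (𝓝 (A y)))
    (hc : 0 < c)
    (hbd : ∀ t, ∑ r, t r = 1 → dist t m < ε →
      negFreeEnergy p (d + 1) β h t - negFreeEnergy p (d + 1) β h m ≤
        -c * ∑ i : Fin d, (t i.succ - m i.succ) ^ 2)
    {G : ℕ → (Fin (d + 1) → ℝ) → ℝ} {g : (Fin d → ℝ) → ℝ} {B C : ℝ} (hB : 0 ≤ B)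
    (hGb : ∀ᶠ N : ℕ in atTop, ∀ t ∈ stdSimplex ℝ (Fin (d + 1)), dist t m < ε →
      |G N t| ≤ C * Real.exp (B * √N * ∑ i : Fin d, |t i.succ - m i.succ|))
    (hGlim : ∀ᵐ y : Fin d → ℝ, ∀ u : ℕ → Fin d → ℝ, Tendsto u atTop (𝓝 y) →
      Tendsto (fun N : ℕ => G N (m + (√(N : ℝ))⁻¹ • hyper (u N))) atTop (𝓝 (g y))) :
    Tendsto (fun N : ℕ => Real.exp (-(N * negFreeEnergy p (d + 1) β h m)) *
      gibbsSum p β h N (fun t => if dist t m < ε then G N t else 0)) atTop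
      (𝓝 ((√(2 * Real.pi) ^ d)⁻¹ *
        ∫ y, (∏ r, √(m r))⁻¹ * Real.exp (A y) * g y)) := by
  classical
  have hpos : ∀ r, 0 < m r := fun r => by linarith [hmε r]
  have hcoord : ∀ {t}, dist t m < ε → ∀ r, ε ≤ t r := fun {t} ht r => by
    have h1 : |t r - m r| < ε := (dist_le_pi_dist t m r).trans_lt ht
    linarith [(abs_lt.1 h1).1, hmε r]
  set H := negFreeEnergy p (d + 1) β h with hH
  let F : ℕ → (Fin (d + 1) → ℝ) → ℝ := fun N t =>
    stirlingRatio N t * (∏ r, √(t r))⁻¹ * Real.exp (N * (H t - H m)) *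
      (if dist t m < ε then G N t else 0)
  have hrep : ∀ᶠ N : ℕ in atTop, (√(2 * Real.pi) ^ d)⁻¹ * ∫ y, F N (latticePoint N m y) =
      Real.exp (-(N * H m)) * gibbsSum p β h N (fun t => if dist t m < ε then G N t else 0) := by
    filter_upwards [eventually_ne_atTop 0] with N hN
    rw [gibbsSum_eq_integral p β h hN m (H m)]
    rintro t ⟨r, hr⟩
    -- In the ε-ball every coordinate is at least ε, so the localized function vanishes wherever
    -- some coordinate is nonpositive.
    exact if_neg fun ht => by linarith [hcoord ht r]
  refine Tendsto.congr' hrep (Tendsto.const_mul _ ?_)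
  -- The factors bound the Stirling ratio, the inverse square roots of the coordinates, and the
  -- constant in the growth of G; the absolute value is needed because C has no prescribed sign.
  let K : ℝ := stirlingFactor 1 * (√ε ^ (d + 1))⁻¹ * |C| 
  refine tendsto_integral_filter_of_dominated_convergence
    (fun y => K * ∏ i, Real.exp (c + B + B ^ 2 / c) * Real.exp (-(c / 4) * y i ^ 2))
    ?_ ?_ ?_ ?_
  · exact Eventually.of_forall fun N => (measurable_latticePoint N m _).aestronglyMeasurable
  · filter_upwards [eventually_ne_atTop 0, hGb] with N hN hGN
    refine Eventually.of_forall fun y => ?_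
    have hs1 : 0 ≤ stirlingFactor 1 := zero_le_one.trans (one_le_stirlingFactor one_ne_zero)
    have hK : 0 ≤ K := by positivity
    have hs : (0 : ℝ) < √N := by positivity
    have hsinv : (√(N : ℝ))⁻¹ ≤ 1 := inv_le_one_of_one_le₀
      (Real.one_le_sqrt.2 (by exact_mod_cast Nat.one_le_iff_ne_zero.2 hN))
    have hround : ∀ i, |roundVec N m y i - y i| ≤ 1 := fun i =>
      (abs_roundVec_sub_le hN m y i).trans hsinv
    have hlat := latticePoint_eq hN hm y
    simp only [F]
    generalize hT : latticePoint N m y = t at *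
    by_cases htm : dist t m < ε
    swap
    · rw [if_neg htm]
      simp only [mul_zero, norm_zero]
      positivity
    rw [if_pos htm]
    have htail : ∀ i : Fin d, t i.succ - m i.succ = (√N)⁻¹ * roundVec N m y i := fun i => by
      rw [hlat]; simp [hyper]
    have hsum : ∑ r, t r = 1 := by
      rw [hlat]
      simp only [Pi.add_apply, Pi.smul_apply, smul_eq_mul, Finset.sum_add_distrib,
        ← Finset.mul_sum, sum_hyper, hm]
      simp
    have htpos : ∀ r, 0 < t r := fun r => hε.trans_le (hcoord htm r)
    have b1 : stirlingRatio N t ≤ stirlingFactor 1 := by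
      refine stirlingRatio_le hN fun r => ?_
      have := htpos r
      rw [← hT] at this ⊢
      exact floor_latticePoint_ne_zero hN this
    have b2 : (∏ r, √(t r))⁻¹ ≤ (√ε ^ (d + 1))⁻¹ := by
      refine inv_anti₀ (by positivity) ?_
      calc √ε ^ (d + 1) = ∏ _r : Fin (d + 1), √ε := by simp
        _ ≤ _ := Finset.prod_le_prod (fun _ _ => by positivity) fun r _ =>
          Real.sqrt_le_sqrt (hcoord htm r)
    have b3 : Real.exp (N * (H t - H m)) * Real.exp (B * √N * ∑ i : Fin d, |t i.succ - m i.succ|) ≤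
        ∏ i, Real.exp (c + B + B ^ 2 / c) * Real.exp (-(c / 4) * y i ^ 2) := by
      calc _ ≤ Real.exp (∑ i, (-c * roundVec N m y i ^ 2 + B * |roundVec N m y i|)) := by
            rw [← Real.exp_add]
            refine Real.exp_le_exp.2 ?_
            rw [Finset.sum_add_distrib, ← Finset.mul_sum, ← Finset.mul_sum]
            refine add_le_add ?_ (le_of_eq ?_)
            · have h1 := mul_le_mul_of_nonneg_left (hbd t hsum htm) (Nat.cast_nonneg (α := ℝ) N)
              refine h1.trans (le_of_eq ?_)
              simp only [htail, mul_pow, ← Finset.mul_sum, inv_pow,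
                Real.sq_sqrt (Nat.cast_nonneg (α := ℝ) N)]
              have hN' : (N : ℝ) ≠ 0 := by exact_mod_cast hN
              field_simp
            · simp only [htail, abs_mul, ← Finset.mul_sum, abs_of_pos (inv_pos.2 hs)]
              field_simp
        _ = ∏ i, Real.exp (-c * roundVec N m y i ^ 2 + B * |roundVec N m y i|) := Real.exp_sum _ _
        _ ≤ _ := Finset.prod_le_prod (fun _ _ => by positivity) fun i _ =>
          gaussian_rounding_bound hc hB (hround i)
    have b4 : |G N t| ≤ |C| * Real.exp (B * √N * ∑ i : Fin d, |t i.succ - m i.succ|) :=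
      (hGN t ⟨fun r => (htpos r).le, hsum⟩ htm).trans
        (mul_le_mul_of_nonneg_right (le_abs_self C) (by positivity))
    have hr0 := stirlingRatio_nonneg N t
    rw [Real.norm_eq_abs, abs_mul, abs_of_nonneg (by positivity)]
    calc _ ≤ stirlingFactor 1 * (√ε ^ (d + 1))⁻¹ * Real.exp (N * (H t - H m)) *
          (|C| * Real.exp (B * √N * ∑ i : Fin d, |t i.succ - m i.succ|)) := by
          gcongr
      _ = K * (Real.exp (N * (H t - H m)) *
          Real.exp (B * √N * ∑ i : Fin d, |t i.succ - m i.succ|)) := by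
          simp only [K]; ring
      _ ≤ _ := mul_le_mul_of_nonneg_left b3 hK
  · refine Integrable.const_mul ?_ _
    exact Integrable.fintype_prod fun i =>
      (integrable_exp_neg_mul_sq (by positivity : 0 < c / 4)).const_mul _
  -- The integrand is evaluated at the rounded vector `roundVec N m y`, which depends on N and only
  -- converges to y. For this reason the hypotheses `hlim` and `hGlim` range over all convergent
  -- sequences.
  · filter_upwards [hGlim] with y hy
    have hround := tendsto_roundVec m y
    have ht : Tendsto (fun N => latticePoint N m y) atTop (𝓝 m) := by
      refine Tendsto.congr' ?_ (tendsto_add_smul_hyper m hround)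
      filter_upwards [eventually_ne_atTop 0] with N hN
      rw [latticePoint_eq hN hm]
    have l1 := tendsto_stirlingRatio hpos ht
    have l2 : Tendsto (fun N => (∏ r, √(latticePoint N m y r))⁻¹) atTop (𝓝 (∏ r, √(m r))⁻¹) := by
      refine Tendsto.inv₀ (tendsto_finsetProd _ fun r _ =>
        (Real.continuous_sqrt.tendsto _).comp (tendsto_pi_nhds.1 ht r)) ?_
      exact Finset.prod_ne_zero_iff.2 fun r _ => (Real.sqrt_pos.2 (hpos r)).ne'
    have l3 : Tendsto (fun N : ℕ => Real.exp (N * (H (latticePoint N m y) - H m))) atTop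
        (𝓝 (Real.exp (A y))) := by
      refine (Real.continuous_exp.tendsto _).comp (Tendsto.congr' ?_ (hlim y _ hround))
      filter_upwards [eventually_ne_atTop 0] with N hN
      rw [latticePoint_eq hN hm]
    have l4 : Tendsto (fun N : ℕ => if dist (latticePoint N m y) m < ε then
        G N (latticePoint N m y) else 0) atTop (𝓝 (g y)) := by
      refine Tendsto.congr' ?_ (hy _ hround)
      filter_upwards [eventually_ne_atTop 0, ht.eventually (Metric.ball_mem_nhds m hε)] with N hN hN'
      rw [if_pos hN', latticePoint_eq hN hm]
    have l5 := ((l1.mul l2).mul l3).mul l4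
    rw [one_mul] at l5
    exact l5

/-! ### Second order expansion of the negative free energy -/

/-- The derivative of the remainder at z is f'(z) - f'(a) - c(z - a), of size at most ε|z - a| near
a. The mean value inequality on the segment from a to x then gives ε|x - a|², so differentiability
of f' at the single point a is enough. -/
theorem isLittleO_taylor_two {f f' : ℝ → ℝ} {a c : ℝ} (hf : ∀ᶠ x in 𝓝 a, HasDerivAt f (f' x) x)
    (hf' : HasDerivAt f' c a) :
    (fun x => f x - f a - f' a * (x - a) - c / 2 * (x - a) ^ 2) =o[𝓝 a] fun x => (x - a) ^ 2 := by
  rw [Asymptotics.isLittleO_iff]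
  intro ε hε
  have h1 := (Asymptotics.isLittleO_iff.1 hf'.isLittleO) hε
  obtain ⟨δ, hδ, hball⟩ := Metric.eventually_nhds_iff_ball.1 (hf.and h1)
  refine Metric.eventually_nhds_iff_ball.2 ⟨δ, hδ, fun x hx => ?_⟩
  have hmem : ∀ z ∈ Set.uIcc a x, |z - a| ≤ |x - a| ∧ z ∈ Metric.ball a δ := fun z hz => by
    have h2 : |z - a| ≤ |x - a| := Set.abs_sub_left_of_mem_uIcc hz
    exact ⟨h2, h2.trans_lt hx⟩
  have h3 := (convex_uIcc a x).norm_image_sub_le_of_norm_hasDerivWithin_le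
    (f := fun z => f z - f' a * (z - a) - c / 2 * (z - a) ^ 2)
    (f' := fun z => f' z - f' a - (z - a) * c) (C := ε * |x - a|) (fun z hz => ?_) (fun z hz => ?_)
    Set.left_mem_uIcc Set.right_mem_uIcc
  · simp only [sub_self, mul_zero, sub_zero, Real.norm_eq_abs] at h3 ⊢
    rw [abs_pow, sq |x - a|, ← mul_assoc]
    refine le_trans (le_of_eq ?_) h3
    congr 1
    ring
  · have h4 := ((hball z (hmem z hz).2).1.sub (((hasDerivAt_id z).sub_const a).const_mul (f' a))).sub
      ((((hasDerivAt_id z).sub_const a).pow 2).const_mul (c / 2))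
    refine (h4.congr_deriv ?_).hasDerivWithinAt
    simp
    ring
  · refine ((hball z (hmem z hz).2).2).trans ?_
    exact mul_le_mul_of_nonneg_left (hmem z hz).1 hε.le

/-- The function `k(x) = β x ^ p - x log x`. -/
def kFun (p : ℕ) (β x : ℝ) : ℝ := β * x ^ p - x * Real.log x

/-- The derivative of `k`. -/
def kDeriv (p : ℕ) (β x : ℝ) : ℝ := β * p * x ^ (p - 1) - Real.log x - 1

/-- The second derivative of `k`. -/
def kDeriv2 (p : ℕ) (β x : ℝ) : ℝ := β * p * (p - 1) * x ^ (p - 2) - 1 / x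

theorem hasDerivAt_kFun (p : ℕ) (β : ℝ) {x : ℝ} (hx : x ≠ 0) :
    HasDerivAt (kFun p β) (kDeriv p β x) x := by
  have h := ((hasDerivAt_pow p x).const_mul β).sub (Real.hasDerivAt_mul_log hx)
  refine h.congr_deriv ?_
  rw [kDeriv]; ring

theorem hasDerivAt_kDeriv {p : ℕ} (hp : 2 ≤ p) (β : ℝ) {x : ℝ} (hx : x ≠ 0) :
    HasDerivAt (kDeriv p β) (kDeriv2 p β x) x := by
  have h := (((hasDerivAt_pow (p - 1) x).const_mul (β * p)).sub
    (Real.hasDerivAt_log hx)).sub_const 1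
  refine h.congr_deriv ?_
  rw [kDeriv2, Nat.cast_sub (by omega : 1 ≤ p), one_div, Nat.sub_sub]
  push_cast
  ring

theorem k''_eq {p : ℕ} (hp : 2 ≤ p) (β : ℝ) {x : ℝ} (hx : 0 < x) : k'' p β x = kDeriv2 p β x := by
  rw [k'', iteratedDeriv_succ, iteratedDeriv_one]
  have h : deriv (fun y : ℝ => β * y ^ p - y * Real.log y) =ᶠ[𝓝 x] kDeriv p β := by
    filter_upwards [eventually_ne_nhds hx.ne'] with y hy
    exact (hasDerivAt_kFun p β hy).deriv
  rw [h.deriv_eq, (hasDerivAt_kDeriv hp β hx.ne').deriv]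

theorem isLittleO_kFun {p : ℕ} (hp : 2 ≤ p) (β : ℝ) {x : ℝ} (hx : 0 < x) :
    (fun y => kFun p β y - kFun p β x - kDeriv p β x * (y - x) - kDeriv2 p β x / 2 * (y - x) ^ 2)
      =o[𝓝 x] fun y => (y - x) ^ 2 := by
  refine isLittleO_taylor_two ?_ (hasDerivAt_kDeriv hp β hx.ne')
  filter_upwards [eventually_ne_nhds hx.ne'] with y hy
  exact hasDerivAt_kFun p β hy

theorem negFreeEnergy_eq_sum (p : ℕ) {q : ℕ} [NeZero q] (β h : ℝ) (t : Fin q → ℝ) :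
    negFreeEnergy p q β h t = ∑ r, kFun p β (t r) + h * t 0 := by
  simp only [negFreeEnergy, kFun, Finset.sum_sub_distrib, ← Finset.mul_sum]
  ring

/-- Here l is the Lagrange multiplier of the constraint on the coordinate sum: the first order
terms, with the field included, add up to l times ∑(t_r - m_r) = 0. -/
theorem negFreeEnergy_sub {p d : ℕ} {β h l : ℝ} {m t : Fin (d + 1) → ℝ}
    (hst : ∀ r, kDeriv p β (m r) + (if r = 0 then h else 0) = l) (hmt : ∑ r, (t r - m r) = 0) :
    negFreeEnergy p (d + 1) β h t - negFreeEnergy p (d + 1) β h m =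
      1 / 2 * ∑ r, kDeriv2 p β (m r) * (t r - m r) ^ 2 +
      ∑ r, (kFun p β (t r) - kFun p β (m r) - kDeriv p β (m r) * (t r - m r) -
        kDeriv2 p β (m r) / 2 * (t r - m r) ^ 2) := by
  have h1 : ∑ r, (kDeriv p β (m r) + (if r = 0 then h else 0)) * (t r - m r) = 0 := by
    simp only [hst, ← Finset.mul_sum, hmt, mul_zero]
  simp only [add_mul, ite_mul, zero_mul, Finset.sum_add_distrib, Finset.sum_ite_eq',
    Finset.mem_univ, if_true] at h1
  have h2 : ∑ r, kDeriv2 p β (m r) / 2 * (t r - m r) ^ 2 =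
      1 / 2 * ∑ r, kDeriv2 p β (m r) * (t r - m r) ^ 2 := by
    rw [Finset.mul_sum]
    exact Finset.sum_congr rfl fun r _ => by ring
  rw [negFreeEnergy_eq_sum, negFreeEnergy_eq_sum]
  simp only [Finset.sum_sub_distrib, h2] at h1 ⊢
  linarith

theorem tendsto_nat_mul_littleO {R : ℝ → ℝ} {x v : ℝ} (hR : R =o[𝓝 x] fun y => (y - x) ^ 2)
    {w : ℕ → ℝ} (hw : Tendsto w atTop (𝓝 v)) :
    Tendsto (fun N : ℕ => N * R (x + (√(N : ℝ))⁻¹ * w N)) atTop (𝓝 0) := by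
  have h1 : Tendsto (fun N : ℕ => x + (√(N : ℝ))⁻¹ * w N) atTop (𝓝 x) := by
    simpa using (tendsto_inv_sqrt_nat.mul hw).const_add x
  have h2 := hR.comp_tendsto h1
  have h3 : (fun N : ℕ => N * R (x + (√(N : ℝ))⁻¹ * w N)) =o[atTop] fun N => w N ^ 2 := by
    have h4 := (Asymptotics.isBigO_refl (fun N : ℕ => (N : ℝ)) atTop).mul_isLittleO h2
    refine h4.trans_isBigO (Asymptotics.IsBigO.of_bound 1 ?_)
    filter_upwards [eventually_ne_atTop 0] with N hN
    have hN' : (0 : ℝ) < N := by positivity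
    have e : (N : ℝ) * ((√(N : ℝ))⁻¹ * w N) ^ 2 = w N ^ 2 := by
      rw [mul_pow, inv_pow, Real.sq_sqrt hN'.le]; field_simp
    simp [e]
  have h5 : (fun N => w N ^ 2) =O[atTop] fun _ => (1 : ℝ) := (hw.pow 2).isBigO_one ℝ
  exact (Asymptotics.isLittleO_one_iff ℝ).1 (h3.trans_isBigO h5)

theorem tendsto_negFreeEnergy_scaled {p d : ℕ} (hp : 2 ≤ p) {β h l : ℝ} {m : Fin (d + 1) → ℝ}
    (hpos : ∀ r, 0 < m r) (hst : ∀ r, kDeriv p β (m r) + (if r = 0 then h else 0) = l)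
    {y : Fin d → ℝ} {u : ℕ → Fin d → ℝ} (hu : Tendsto u atTop (𝓝 y)) :
    Tendsto (fun N : ℕ =>
      N * (negFreeEnergy p (d + 1) β h (m + (√(N : ℝ))⁻¹ • hyper (u N)) -
        negFreeEnergy p (d + 1) β h m)) atTop
      (𝓝 (1 / 2 * ∑ r, kDeriv2 p β (m r) * hyper y r ^ 2)) := by
  have hv := tendsto_pi_nhds.1 ((continuous_hyper.tendsto y).comp hu)
  have h1 : Tendsto (fun N : ℕ => 1 / 2 * ∑ r, kDeriv2 p β (m r) * hyper (u N) r ^ 2) atTop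
      (𝓝 (1 / 2 * ∑ r, kDeriv2 p β (m r) * hyper y r ^ 2)) :=
    (tendsto_finsetSum _ fun r _ => ((hv r).pow 2).const_mul _).const_mul _
  have h0 := fun r => tendsto_nat_mul_littleO (isLittleO_kFun hp β (hpos r)) (hv r)
  have h2 := tendsto_finsetSum Finset.univ fun r _ => h0 r
  have h3 := h1.add h2
  rw [Finset.sum_const_zero, add_zero] at h3
  refine Tendsto.congr' ?_ h3
  filter_upwards [eventually_ne_atTop 0] with N hN
  have hN' : (0 : ℝ) < N := by positivity
  rw [negFreeEnergy_sub hst, mul_add, Finset.mul_sum _ _ (N : ℝ)]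
  · congr 1
    simp only [Pi.add_apply, Pi.smul_apply, smul_eq_mul, add_sub_cancel_left, mul_pow, inv_pow,
      Real.sq_sqrt hN'.le]
    rw [mul_left_comm]
    congr 1
    rw [Finset.mul_sum]
    refine Finset.sum_congr rfl fun r _ => ?_
    field_simp
  · simp only [Pi.add_apply, Pi.smul_apply, smul_eq_mul, add_sub_cancel_left, ← Finset.mul_sum,
      sum_hyper, mul_zero]

/-- Near m the Taylor remainders use up at most half of the constant c of the negative definite
second order part. -/
theorem negFreeEnergy_le_quadratic {p d : ℕ} (hp : 2 ≤ p) {β h l : ℝ} {m : Fin (d + 1) → ℝ}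
    (hm : ∑ r, m r = 1) (hpos : ∀ r, 0 < m r)
    (hst : ∀ r, kDeriv p β (m r) + (if r = 0 then h else 0) = l) {c : ℝ} (hc : 0 < c)
    (hQ : ∀ y : Fin d → ℝ, 1 / 2 * ∑ r, kDeriv2 p β (m r) * hyper y r ^ 2 ≤ -c * ∑ i, y i ^ 2) :
    ∀ᶠ ε in 𝓝[>] (0 : ℝ), ∀ t, ∑ r, t r = 1 → dist t m < ε →
      negFreeEnergy p (d + 1) β h t - negFreeEnergy p (d + 1) β h m ≤
        -(c / 2) * ∑ i : Fin d, (t i.succ - m i.succ) ^ 2 := by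
  -- By Cauchy-Schwarz on the first coordinate, the sum of squares of all d + 1 increments is at
  -- most 1 + d times that of the last d, so a remainder of relative size η costs c/2.
  set η : ℝ := c / (2 * (1 + d)) with hη
  have hη0 : 0 < η := by positivity
  have h1 : ∀ r, ∀ᶠ x in 𝓝 (m r), |kFun p β x - kFun p β (m r) - kDeriv p β (m r) * (x - m r) -
      kDeriv2 p β (m r) / 2 * (x - m r) ^ 2| ≤ η * (x - m r) ^ 2 := fun r => by
    filter_upwards [(Asymptotics.isLittleO_iff.1 (isLittleO_kFun hp β (hpos r))) hη0] with x hx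
    simpa using hx
  have h2 : ∀ᶠ t in 𝓝 m, ∀ r, |kFun p β (t r) - kFun p β (m r) - kDeriv p β (m r) * (t r - m r) -
      kDeriv2 p β (m r) / 2 * (t r - m r) ^ 2| ≤ η * (t r - m r) ^ 2 :=
    eventually_all.2 fun r => ((continuous_apply r).tendsto m).eventually (h1 r)
  obtain ⟨δ, hδ, hball⟩ := Metric.eventually_nhds_iff_ball.1 h2
  filter_upwards [Ioo_mem_nhdsGT hδ] with ε hε t ht htm
  have h3 := hball t (htm.trans hε.2)
  have hz : ∑ r, (t r - m r) = 0 := by rw [Finset.sum_sub_distrib, ht, hm, sub_self]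
  let y : Fin d → ℝ := fun i => t i.succ - m i.succ
  have hy : ∀ r, t r - m r = hyper y r := by
    rw [Fin.sum_univ_succ] at hz
    refine Fin.cases ?_ fun i => ?_
    · simp only [hyper, Fin.cons_zero, y]; linarith
    · simp [hyper, y]
  have hsq : ∑ r, hyper y r ^ 2 ≤ (1 + d) * ∑ i, y i ^ 2 := by
    have : (∑ i, y i) ^ 2 ≤ d * ∑ i, y i ^ 2 := by
      simpa using sq_sum_le_card_mul_sum_sq (s := Finset.univ) (f := y)
    simp only [Fin.sum_univ_succ, hyper, Fin.cons_zero, Fin.cons_succ, neg_sq]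
    linarith
  rw [negFreeEnergy_sub hst hz]
  have h4 := Finset.sum_le_sum fun r (_ : r ∈ Finset.univ) => (le_abs_self _).trans (h3 r)
  rw [← Finset.mul_sum] at h4
  have h5 : η * ∑ r, (t r - m r) ^ 2 ≤ c / 2 * ∑ i, y i ^ 2 := by
    simp only [hy]
    calc η * ∑ r, hyper y r ^ 2 ≤ η * ((1 + d) * ∑ i, y i ^ 2) :=
          mul_le_mul_of_nonneg_left hsq hη0.le
      _ = c / 2 * ∑ i, y i ^ 2 := by rw [hη]; field_simp
  have h6 := hQ y
  simp only [hy] at h4 h5 ⊢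
  have e : ∀ i, t (Fin.succ i) - m (Fin.succ i) = y i := fun i => rfl
  have e2 : ∑ i : Fin d, hyper y i.succ ^ 2 = ∑ i, y i ^ 2 := by simp [hyper]
  rw [e2]
  linarith

/-! ### Gaussian integrals with an exchangeable quadratic form -/

theorem pi_gaussianReal_eq_withDensity (d : ℕ) :
    Measure.pi (fun _ : Fin d => gaussianReal 0 1) = (volume : Measure (Fin d → ℝ)).withDensity
      fun u => ENNReal.ofReal (∏ i, gaussianPDFReal 0 1 (u i)) := by
  refine Measure.pi_eq fun s hs => ?_
  rw [withDensity_apply _ (MeasurableSet.univ_pi hs),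
    ← ofReal_integral_eq_lintegral_ofReal]
  · rw [← integral_indicator (MeasurableSet.univ_pi hs)]
    have h1 : (fun u : Fin d → ℝ => (Set.univ.pi s).indicator
        (fun u => ∏ i, gaussianPDFReal 0 1 (u i)) u) =
        fun u => ∏ i, (s i).indicator (gaussianPDFReal 0 1) (u i) := by
      funext u
      by_cases hu : u ∈ Set.univ.pi s
      · rw [Set.indicator_of_mem hu]
        exact Finset.prod_congr rfl fun i _ => (Set.indicator_of_mem (hu i trivial) _).symm
      · rw [Set.indicator_of_notMem hu]
        simp only [Set.mem_univ_pi, not_forall] at hu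
        obtain ⟨i, hi⟩ := hu
        exact (Finset.prod_eq_zero (Finset.mem_univ i) (Set.indicator_of_notMem hi _)).symm
    rw [h1, integral_fintype_prod_volume_eq_prod
      (fun i => (s i).indicator (gaussianPDFReal 0 1)),
      ENNReal.ofReal_prod_of_nonneg]
    · refine Finset.prod_congr rfl fun i _ => ?_
      rw [integral_indicator (hs i), gaussianReal_apply_eq_integral _ one_ne_zero]
    · exact fun i _ => integral_nonneg fun x =>
        Set.indicator_nonneg (fun x _ => gaussianPDFReal_nonneg 0 1 x) x
  · exact (Integrable.fintype_prod fun _ => integrable_gaussianPDFReal 0 1).integrableOn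
  · exact Eventually.of_forall fun u => Finset.prod_nonneg fun i _ => gaussianPDFReal_nonneg 0 1 _

theorem integral_pi_gaussianReal (d : ℕ) (g : (Fin d → ℝ) → ℝ) :
    ∫ u, g u ∂Measure.pi (fun _ : Fin d => gaussianReal 0 1) =
      (√(2 * Real.pi) ^ d)⁻¹ * ∫ u, Real.exp (-(1 / 2) * ∑ i, u i ^ 2) * g u := by
  rw [pi_gaussianReal_eq_withDensity, integral_withDensity_eq_integral_toReal_smul,
    ← integral_const_mul]
  · refine integral_congr_ae (Eventually.of_forall fun u => ?_)
    simp only [smul_eq_mul]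
    rw [ENNReal.toReal_ofReal (Finset.prod_nonneg fun i _ => gaussianPDFReal_nonneg 0 1 _)]
    simp only [gaussianPDFReal, Finset.prod_mul_distrib, ← Real.exp_sum]
    rw [← mul_assoc]
    congr 1
    simp only [NNReal.coe_one, mul_one, Finset.prod_const, Finset.card_univ, Fintype.card_fin,
      inv_pow, sub_zero]
    congr 2
    rw [Finset.mul_sum]
    exact Finset.sum_congr rfl fun i _ => by ring
  · refine Measurable.ennreal_ofReal ?_
    exact Finset.measurable_fun_prod _ fun i _ =>
      (measurable_gaussianPDFReal 0 1).comp (measurable_pi_apply i)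
  · exact Eventually.of_forall fun _ => ENNReal.ofReal_lt_top

/-- The linear map `u ↦ c u + e (∑ u)`, with the coefficients for which it turns the quadratic form
`α |y|² + γ (∑ y)²` into `|u|²`. -/
def whiten (d : ℕ) (α γ : ℝ) (u : Fin d → ℝ) (i : Fin d) : ℝ :=
  (√α)⁻¹ * u i + ((√(α + d * γ))⁻¹ - (√α)⁻¹) / d * ∑ j, u j

theorem measurable_whiten (d : ℕ) (α γ : ℝ) : Measurable (whiten d α γ) := by
  unfold whiten; fun_prop

theorem sum_whiten {d : ℕ} (hd : d ≠ 0) (α γ : ℝ) (u : Fin d → ℝ) :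
    ∑ i, whiten d α γ u i = (√(α + d * γ))⁻¹ * ∑ i, u i := by
  have : (d : ℝ) ≠ 0 := by exact_mod_cast hd
  simp only [whiten, Finset.sum_add_distrib, ← Finset.mul_sum, Finset.sum_const, Finset.card_univ,
    Fintype.card_fin, nsmul_eq_mul]
  field_simp
  ring

/-- The form has eigenvalue α on vectors of sum zero and α + dγ on constant vectors; `whiten`
multiplies these two eigenspaces by the inverse square roots of the eigenvalues. -/
theorem quadratic_whiten {d : ℕ} (hd : d ≠ 0) {α γ : ℝ} (hα : 0 < α) (hγ : 0 < α + d * γ)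
    (u : Fin d → ℝ) :
    α * ∑ i, whiten d α γ u i ^ 2 + γ * (∑ i, whiten d α γ u i) ^ 2 = ∑ i, u i ^ 2 := by
  have hd' : (d : ℝ) ≠ 0 := by exact_mod_cast hd
  have h1 : ∑ i, whiten d α γ u i ^ 2 = (√α)⁻¹ ^ 2 * ∑ i, u i ^ 2 +
      (2 * (√α)⁻¹ * (((√(α + d * γ))⁻¹ - (√α)⁻¹) / d) +
        d * (((√(α + d * γ))⁻¹ - (√α)⁻¹) / d) ^ 2) * (∑ i, u i) ^ 2 := by
    have : ∀ i, whiten d α γ u i ^ 2 = (√α)⁻¹ ^ 2 * u i ^ 2 +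
        2 * (√α)⁻¹ * (((√(α + d * γ))⁻¹ - (√α)⁻¹) / d) * (∑ j, u j) * u i +
        (((√(α + d * γ))⁻¹ - (√α)⁻¹) / d) ^ 2 * (∑ j, u j) ^ 2 := fun i => by
      rw [whiten]; ring
    simp only [this, Finset.sum_add_distrib, ← Finset.mul_sum, Finset.sum_const, Finset.card_univ,
      Fintype.card_fin, nsmul_eq_mul]
    ring
  rw [h1, sum_whiten hd]
  have e1 : (√α)⁻¹ ^ 2 * α = 1 := by rw [inv_pow, Real.sq_sqrt hα.le, inv_mul_cancel₀ hα.ne']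
  have e2 : (√(α + d * γ))⁻¹ ^ 2 * (α + d * γ) = 1 := by
    rw [inv_pow, Real.sq_sqrt hγ.le, inv_mul_cancel₀ hγ.ne']
  generalize (√α)⁻¹ = x at *
  generalize (√(α + d * γ))⁻¹ = z at *
  field_simp
  linear_combination (d * (∑ i, u i ^ 2) - (∑ i, u i) ^ 2) * e1 + (∑ i, u i) ^ 2 * e2

/-- The matrix of `whiten`. -/
def whitenMatrix (d : ℕ) (α γ : ℝ) : Matrix (Fin d) (Fin d) ℝ :=
  (√α)⁻¹ • ((1 : Matrix (Fin d) (Fin d) ℝ) +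
    Matrix.replicateCol Unit (fun _ : Fin d => ((√(α + d * γ))⁻¹ - (√α)⁻¹) / d * √α) *
      Matrix.replicateRow Unit (fun _ : Fin d => (1 : ℝ)))

theorem det_whitenMatrix {d : ℕ} (hd : d ≠ 0) {α : ℝ} (hα : 0 < α) (γ : ℝ) :
    (whitenMatrix d α γ).det = (√α)⁻¹ ^ (d - 1) * (√(α + d * γ))⁻¹ := by
  have hd' : (d : ℝ) ≠ 0 := by exact_mod_cast hd
  rw [whitenMatrix, Matrix.det_smul, Matrix.det_one_add_replicateCol_mul_replicateRow]
  have hs : √α ≠ 0 := by positivity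
  obtain ⟨k, rfl⟩ := Nat.exists_eq_succ_of_ne_zero hd
  simp only [dotProduct, one_mul, Finset.sum_const, Finset.card_univ, Fintype.card_fin,
    nsmul_eq_mul, Nat.succ_eq_add_one, Nat.add_sub_cancel, pow_succ]
  field_simp
  ring

theorem toLin'_whitenMatrix {d : ℕ} {α : ℝ} (hα : 0 < α) (γ : ℝ) (u : Fin d → ℝ) :
    Matrix.toLin' (whitenMatrix d α γ) u = whiten d α γ u := by
  have hs : √α ≠ 0 := by positivity
  funext i
  rw [Matrix.toLin'_apply, whitenMatrix, Matrix.smul_mulVec, Matrix.add_mulVec, Matrix.one_mulVec,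
    ← Matrix.mulVec_mulVec]
  simp only [Pi.smul_apply, Pi.add_apply, smul_eq_mul, Matrix.mulVec, dotProduct,
    Matrix.replicateCol_apply, Matrix.replicateRow_apply, one_mul, Finset.univ_unique,
    Finset.sum_singleton, whiten]
  field_simp

/-- The centred Gaussian law on `ℝ^d` with density proportional to
`exp (-(α |y|² + γ (∑ y)²) / 2)`. -/
def fluctuationLaw (d : ℕ) (α γ : ℝ) : Measure (Fin d → ℝ) :=
  (Measure.pi fun _ : Fin d => gaussianReal 0 1).map (whiten d α γ)

instance (d : ℕ) (α γ : ℝ) : IsProbabilityMeasure (fluctuationLaw d α γ) :=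
  Measure.isProbabilityMeasure_map (measurable_whiten d α γ).aemeasurable

/-- Linear change of variables by `whiten`, whose determinant is the constant on the right.
Integrability of g plays no role, since each rewriting of the integral is valid without it. -/
theorem integral_exp_quadratic {d : ℕ} (hd : d ≠ 0) {α γ : ℝ} (hα : 0 < α) (hγ : 0 < α + d * γ)
    {g : (Fin d → ℝ) → ℝ} (hg : Measurable g) :
    (√(2 * Real.pi) ^ d)⁻¹ *
      ∫ y, Real.exp (-(1 / 2) * (α * ∑ i, y i ^ 2 + γ * (∑ i, y i) ^ 2)) * g y =
      (√α)⁻¹ ^ (d - 1) * (√(α + d * γ))⁻¹ * ∫ y, g y ∂fluctuationLaw d α γ := by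
  have hdet : 0 < (whitenMatrix d α γ).det := by
    rw [det_whitenMatrix hd hα]; positivity
  have h1 := Real.map_matrix_volume_pi_eq_smul_volume_pi hdet.ne'
  have hfun : ⇑(Matrix.toLin' (whitenMatrix d α γ)) = whiten d α γ :=
    funext (toLin'_whitenMatrix hα γ)
  rw [hfun] at h1
  have hmeas : Measurable fun y : Fin d → ℝ =>
      Real.exp (-(1 / 2) * (α * ∑ i, y i ^ 2 + γ * (∑ i, y i) ^ 2)) * g y := by fun_prop
  have h2 := integral_map (μ := volume) (measurable_whiten d α γ).aemeasurable
    hmeas.aestronglyMeasurable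
  rw [h1, integral_smul_measure] at h2
  simp only [quadratic_whiten hd hα hγ] at h2
  rw [fluctuationLaw, integral_map (measurable_whiten d α γ).aemeasurable
    hg.aestronglyMeasurable, integral_pi_gaussianReal, ← h2, ← det_whitenMatrix hd hα,
    ENNReal.toReal_ofReal (abs_nonneg _), abs_of_pos (inv_pos.2 hdet), smul_eq_mul]
  field_simp

/-- In the standard Gaussian coordinates this is a linear functional with d equal coefficients κ/√(α
+ dγ), and its variance is their sum of squares. -/
theorem fluctuationLaw_map_sum {d : ℕ} (hd : d ≠ 0) {α γ : ℝ} (hγ : 0 < α + d * γ) (κ : ℝ) :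
    (fluctuationLaw d α γ).map (fun y => κ * ∑ i, y i) = normalLaw (κ ^ 2 * (d / (α + d * γ))) := by
  have hm : Measurable fun y : Fin d → ℝ => κ * ∑ i, y i := by fun_prop
  rw [fluctuationLaw, Measure.map_map hm (measurable_whiten d α γ)]
  set a : ℝ := κ * (√(α + d * γ))⁻¹ with ha
  have hfun : (fun y : Fin d → ℝ => κ * ∑ i, y i) ∘ whiten d α γ =
      fun u => ∑ i, a * u i := by
    funext u
    simp only [Function.comp, sum_whiten hd, ha, Finset.mul_sum, mul_assoc]
  let L : StrongDual ℝ (EuclideanSpace ℝ (Fin d)) :=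
    ∑ i, a • EuclideanSpace.proj i
  have hL : (fun u : Fin d → ℝ => ∑ i, a * u i) = L ∘ (WithLp.toLp 2) := by
    funext u
    simp [L]
  rw [hfun, hL, ← Measure.map_map L.continuous.measurable (by fun_prop), map_pi_eq_stdGaussian,
    IsGaussian.map_eq_gaussianReal, integral_strongDual_stdGaussian, variance_dual_stdGaussian,
    normalLaw]
  congr 2
  have : L = innerSL ℝ (WithLp.toLp 2 (fun _ => a) : EuclideanSpace ℝ (Fin d)) := by
    ext x
    simp [L, PiLp.inner_apply, mul_comm]
  rw [this, innerSL_apply_norm, EuclideanSpace.norm_sq_eq]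
  simp only [Real.norm_eq_abs, sq_abs, Finset.sum_const, Finset.card_univ, Fintype.card_fin,
    nsmul_eq_mul, ha, mul_pow, inv_pow, Real.sq_sqrt hγ.le]
  field_simp

/-! ### The vectors `x_s` -/

/-- The distinguished coordinate of `x_s`. -/
def aCoord (d : ℕ) (s : ℝ) : ℝ := (1 + d * s) / (d + 1)

/-- The other coordinates of `x_s`. -/
def bCoord (d : ℕ) (s : ℝ) : ℝ := (1 - s) / (d + 1)

theorem xvec_zero_eq (d : ℕ) (s : ℝ) : xvec (d + 1) s 0 = aCoord d s := by
  simp [xvec, aCoord]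

theorem xvec_succ_eq (d : ℕ) (s : ℝ) (i : Fin d) : xvec (d + 1) s i.succ = bCoord d s := by
  simp [xvec, bCoord, Fin.succ_ne_zero]

theorem aCoord_add (d : ℕ) (s : ℝ) : aCoord d s + d * bCoord d s = 1 := by
  unfold aCoord bCoord
  field_simp
  ring

theorem aCoord_sub_bCoord (d : ℕ) (s : ℝ) : aCoord d s - bCoord d s = s := by
  unfold aCoord bCoord
  field_simp
  ring

theorem aCoord_pos {d : ℕ} {s : ℝ} (hs : 0 ≤ s) : 0 < aCoord d s := by
  unfold aCoord; positivity

theorem bCoord_pos {d : ℕ} {s : ℝ} (hs : s < 1) : 0 < bCoord d s := by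
  unfold bCoord
  have : 0 < 1 - s := by linarith
  positivity

theorem sum_xvec (d : ℕ) (s : ℝ) : ∑ r, xvec (d + 1) s r = 1 := by
  rw [Fin.sum_univ_succ, xvec_zero_eq]
  simp only [xvec_succ_eq]
  simpa using aCoord_add d s

theorem xvec_pos {d : ℕ} {s : ℝ} (hs : 0 ≤ s) (hs1 : s < 1) (r : Fin (d + 1)) :
    0 < xvec (d + 1) s r := by
  refine Fin.cases ?_ (fun i => ?_) r
  · rw [xvec_zero_eq]; exact aCoord_pos hs
  · rw [xvec_succ_eq]; exact bCoord_pos hs1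

theorem xvec_mem_stdSimplex {d : ℕ} {s : ℝ} (hs : s ∈ Set.Icc (0 : ℝ) 1) :
    xvec (d + 1) s ∈ stdSimplex ℝ (Fin (d + 1)) := by
  refine ⟨fun r => ?_, sum_xvec d s⟩
  refine Fin.cases ?_ (fun i => ?_) r
  · rw [xvec_zero_eq]; exact (aCoord_pos hs.1).le
  · rw [xvec_succ_eq]; exact div_nonneg (by linarith [hs.2]) (by positivity)

theorem freeFun_eq (p d : ℕ) (β h s : ℝ) : freeFun p (d + 1) β h s =
    kFun p β (aCoord d s) + d * kFun p β (bCoord d s) + h * aCoord d s := by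
  rw [freeFun, negFreeEnergy_eq_sum, Fin.sum_univ_succ, xvec_zero_eq]
  simp [xvec_succ_eq]

theorem hasDerivAt_aCoord (d : ℕ) (s : ℝ) : HasDerivAt (aCoord d) (d / (d + 1)) s := by
  have h := (((hasDerivAt_id s).const_mul (d : ℝ)).const_add 1).div_const ((d : ℝ) + 1)
  refine h.congr_deriv ?_
  ring

theorem hasDerivAt_bCoord (d : ℕ) (s : ℝ) : HasDerivAt (bCoord d) (-(1 / (d + 1))) s := by
  have h := ((hasDerivAt_id s).const_sub 1).div_const ((d : ℝ) + 1)
  refine h.congr_deriv ?_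
  ring

/-- The function whose zeros are the critical points of `f`. -/
def gradFun (p d : ℕ) (β h s : ℝ) : ℝ :=
  kDeriv p β (aCoord d s) + h - kDeriv p β (bCoord d s)

theorem hasDerivAt_freeFun (p d : ℕ) (β h : ℝ) {s : ℝ} (ha : aCoord d s ≠ 0)
    (hb : bCoord d s ≠ 0) :
    HasDerivAt (freeFun p (d + 1) β h) (d / (d + 1) * gradFun p d β h s) s := by
  have h1 := (((hasDerivAt_kFun p β ha).comp s (hasDerivAt_aCoord d s)).add
    (((hasDerivAt_kFun p β hb).comp s (hasDerivAt_bCoord d s)).const_mul (d : ℝ))).add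
    ((hasDerivAt_aCoord d s).const_mul h)
  have h2 : freeFun p (d + 1) β h = fun s =>
    kFun p β (aCoord d s) + d * kFun p β (bCoord d s) + h * aCoord d s :=
    funext (freeFun_eq p d β h)
  rw [h2]
  refine h1.congr_deriv ?_
  rw [gradFun]
  field_simp
  ring

theorem hasDerivAt_gradFun {p : ℕ} (hp : 2 ≤ p) (d : ℕ) (β h : ℝ) {s : ℝ} (ha : aCoord d s ≠ 0)
    (hb : bCoord d s ≠ 0) :
    HasDerivAt (gradFun p d β h) (d / (d + 1) * kDeriv2 p β (aCoord d s) +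
      1 / (d + 1) * kDeriv2 p β (bCoord d s)) s := by
  have h1 := (((hasDerivAt_kDeriv hp β ha).comp s (hasDerivAt_aCoord d s)).add_const h).sub
    ((hasDerivAt_kDeriv hp β hb).comp s (hasDerivAt_bCoord d s))
  refine h1.congr_deriv ?_
  ring

theorem eventually_coord_ne_zero (d : ℕ) {s : ℝ} (ha : aCoord d s ≠ 0) (hb : bCoord d s ≠ 0) :
    ∀ᶠ x in 𝓝 s, aCoord d x ≠ 0 ∧ bCoord d x ≠ 0 :=
  ((hasDerivAt_aCoord d s).continuousAt.eventually_ne ha).and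
    ((hasDerivAt_bCoord d s).continuousAt.eventually_ne hb)

theorem freeFun''_eq {p : ℕ} (hp : 2 ≤ p) (d : ℕ) (β h : ℝ) {s : ℝ} (ha : aCoord d s ≠ 0)
    (hb : bCoord d s ≠ 0) :
    freeFun'' p (d + 1) β h s = d / (d + 1) ^ 2 *
      (d * kDeriv2 p β (aCoord d s) + kDeriv2 p β (bCoord d s)) := by
  rw [freeFun'', iteratedDeriv_succ, iteratedDeriv_one]
  have h1 : deriv (freeFun p (d + 1) β h) =ᶠ[𝓝 s] fun s => d / (d + 1) * gradFun p d β h s := by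
    filter_upwards [eventually_coord_ne_zero d ha hb] with x hx
    exact (hasDerivAt_freeFun p d β h hx.1 hx.2).deriv
  rw [h1.deriv_eq, ((hasDerivAt_gradFun hp d β h ha hb).const_mul _).deriv]
  field_simp

theorem sum_kDeriv2_hyper (p d : ℕ) (β s : ℝ) (y : Fin d → ℝ) :
    ∑ r, kDeriv2 p β (xvec (d + 1) s r) * hyper y r ^ 2 =
      kDeriv2 p β (aCoord d s) * (∑ i, y i) ^ 2 + kDeriv2 p β (bCoord d s) * ∑ i, y i ^ 2 := by
  rw [Fin.sum_univ_succ, xvec_zero_eq]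
  simp only [xvec_succ_eq, hyper, Fin.cons_zero, Fin.cons_succ, neg_sq, Finset.mul_sum]

/-- For s ≥ 0 the repeated coordinate (1 - s)/(d + 1) is the smallest, and it is present because d
is not 0. -/
theorem sParam_xvec {d : ℕ} (hd : d ≠ 0) {s : ℝ} (hs : 0 ≤ s) :
    sParam (d + 1) (xvec (d + 1) s) = s := by
  have h1 : ⨅ r, xvec (d + 1) s r = bCoord d s := by
    have hle : ∀ r, bCoord d s ≤ xvec (d + 1) s r := fun r => by
      refine Fin.cases ?_ (fun i => ?_) r
      · rw [xvec_zero_eq]; linarith [aCoord_sub_bCoord d s]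
      · rw [xvec_succ_eq]
    refine le_antisymm ?_ (le_ciInf hle)
    obtain ⟨k, rfl⟩ := Nat.exists_eq_succ_of_ne_zero hd
    have := ciInf_le (f := xvec (k + 1 + 1) s) ⟨_, by rintro _ ⟨r, rfl⟩; exact hle r⟩
      (Fin.succ 0)
    rwa [xvec_succ_eq] at this
  rw [sParam, h1, bCoord]
  push_cast
  field_simp
  ring

/-- `x_s` is a nondegenerate critical point, with the second order condition for a maximum. -/
structure NondegenerateAt (p d : ℕ) (β h s : ℝ) : Prop where
  nonneg : 0 ≤ s
  lt_one : s < 1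
  stationary : gradFun p d β h s = 0
  neg_b : kDeriv2 p β (bCoord d s) < 0
  neg_ab : kDeriv2 p β (bCoord d s) + d * kDeriv2 p β (aCoord d s) < 0

namespace NondegenerateAt

variable {p d : ℕ} {β h s : ℝ}

theorem ha (H : NondegenerateAt p d β h s) : 0 < aCoord d s := aCoord_pos H.nonneg

theorem hb (H : NondegenerateAt p d β h s) : 0 < bCoord d s := bCoord_pos H.lt_one

theorem stationary' (H : NondegenerateAt p d β h s) (r : Fin (d + 1)) :
    kDeriv p β (xvec (d + 1) s r) + (if r = 0 then h else 0) = kDeriv p β (bCoord d s) := by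
  have := H.stationary
  rw [gradFun] at this
  refine Fin.cases ?_ (fun i => ?_) r
  · rw [xvec_zero_eq, if_pos rfl]; linarith
  · rw [xvec_succ_eq, if_neg (Fin.succ_ne_zero i), add_zero]

/-- Write A and B for the second derivatives of k at the two coordinate values. By (∑ y)² ≤ d ∑ y²,
the form A(∑ y)² + B ∑ y² is at most B ∑ y² when A ≤ 0 and at most (B + dA) ∑ y² when A ≥ 0; both
constants are negative. -/
theorem quadratic_le (H : NondegenerateAt p d β h s) : ∃ c > 0, ∀ y : Fin d → ℝ,
    1 / 2 * ∑ r, kDeriv2 p β (xvec (d + 1) s r) * hyper y r ^ 2 ≤ -c * ∑ i, y i ^ 2 := by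
  set A := kDeriv2 p β (aCoord d s) with hA
  set B := kDeriv2 p β (bCoord d s) with hB
  have h1 : B < 0 := H.neg_b
  have h2 : B + d * A < 0 := H.neg_ab
  refine ⟨min (-B) (-(B + d * A)) / 2, by
    have : 0 < min (-B) (-(B + d * A)) := lt_min (by linarith) (by linarith)
    positivity, fun y => ?_⟩
  rw [sum_kDeriv2_hyper, ← hA, ← hB]
  have h3 : (∑ i, y i) ^ 2 ≤ d * ∑ i, y i ^ 2 := by
    simpa using sq_sum_le_card_mul_sum_sq (s := Finset.univ) (f := y)
  have h4 : 0 ≤ ∑ i, y i ^ 2 := Finset.sum_nonneg fun i _ => sq_nonneg _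
  have h5 := min_le_left (-B) (-(B + d * A))
  have h6 := min_le_right (-B) (-(B + d * A))
  have h7 := mul_le_mul_of_nonneg_right h5 h4
  have h8 := mul_le_mul_of_nonneg_right h6 h4
  rcases le_total A 0 with hA0 | hA0
  · nlinarith [sq_nonneg (∑ i, y i)]
  · nlinarith

end NondegenerateAt

/-- Matches the constant of Laplace's method with τ: -f''(s) is d/(d+1)² times the eigenvalue of the
Gaussian form on constant vectors, and 2 - q = -(d - 1). The factor √d/(d + 1) is the same at every
maximizer and cancels in all ratios. -/
theorem tau_xvec {p : ℕ} (hp : 2 ≤ p) {d : ℕ} (hd : d ≠ 0) {β h s : ℝ}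
    (H : NondegenerateAt p d β h s) :
    √d / (d + 1) * tau p (d + 1) β h (xvec (d + 1) s) =
      (∏ r, √(xvec (d + 1) s r))⁻¹ * ((√(-kDeriv2 p β (bCoord d s)))⁻¹ ^ (d - 1) *
        (√(-kDeriv2 p β (bCoord d s) + d * -kDeriv2 p β (aCoord d s)))⁻¹) := by
  have hα : 0 < -kDeriv2 p β (bCoord d s) := neg_pos.2 H.neg_b
  have hγ : 0 < -kDeriv2 p β (bCoord d s) + d * -kDeriv2 p β (aCoord d s) := by
    linarith [H.neg_ab]
  have hd0 : (0 : ℝ) < d := by positivity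
  have hb' : (1 - s) / ((d + 1 : ℕ) : ℝ) = bCoord d s := by rw [bCoord]; push_cast; rfl
  rw [tau, sParam_xvec hd H.nonneg, freeFun''_eq hp d β h H.ha.ne' H.hb.ne', hb',
    k''_eq hp β H.hb]
  set α := -kDeriv2 p β (bCoord d s) with hαd
  set γ := -kDeriv2 p β (aCoord d s) with hγd
  have e1 : -((d : ℝ) / (d + 1) ^ 2 * (d * kDeriv2 p β (aCoord d s) + kDeriv2 p β (bCoord d s))) =
      d / (d + 1) ^ 2 * (α + d * γ) := by rw [hαd, hγd]; ring
  have e2 : α ^ (2 - ((d + 1 : ℕ) : ℤ)) = (α ^ (d - 1))⁻¹ := by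
    rw [← zpow_natCast, ← zpow_neg]
    congr 1
    rw [Nat.cast_sub (Nat.one_le_iff_ne_zero.2 hd)]
    push_cast
    ring
  have e3 : ∏ r, √(xvec (d + 1) s r) = √(∏ r, xvec (d + 1) s r) :=
    (Real.sqrt_prod _ fun r _ => (xvec_pos H.nonneg H.lt_one r).le).symm
  have hP : 0 < ∏ r, xvec (d + 1) s r :=
    Finset.prod_pos fun r _ => xvec_pos H.nonneg H.lt_one r
  rw [e1, e2, e3, Real.sqrt_div (by positivity), Real.sqrt_mul (by positivity), Real.sqrt_inv,
    Real.sqrt_inv, Real.sqrt_mul (by positivity), Real.sqrt_div hd0.le,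
    Real.sqrt_sq (by positivity), inv_pow]
  have e4 : √(α ^ (d - 1)) = √α ^ (d - 1) := by
    rw [Real.sqrt_eq_iff_mul_self_eq (by positivity) (by positivity), ← mul_pow,
      Real.mul_self_sqrt hα.le]
  rw [e4]
  have : √(d : ℝ) ≠ 0 := by positivity
  field_simp

/-- **Laplace's method** at a nondegenerate maximizer `x_s`, with the limit expressed in terms of
the weight `τ` and the law of the fluctuations. -/
theorem tendsto_gibbsSum_xvec {p : ℕ} (hp : 2 ≤ p) {d : ℕ} (hd : d ≠ 0) {β h s : ℝ}
    (H : NondegenerateAt p d β h s) :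
    ∀ᶠ ε in 𝓝[>] (0 : ℝ), ∀ (G : ℕ → (Fin (d + 1) → ℝ) → ℝ) (g : (Fin d → ℝ) → ℝ) (B C : ℝ),
      Measurable g → 0 ≤ B →
      (∀ᶠ N : ℕ in atTop, ∀ t ∈ stdSimplex ℝ (Fin (d + 1)), dist t (xvec (d + 1) s) < ε →
        |G N t| ≤ C * Real.exp (B * √N * ∑ i : Fin d, |t i.succ - xvec (d + 1) s i.succ|)) →
      (∀ᵐ y : Fin d → ℝ, ∀ u : ℕ → Fin d → ℝ, Tendsto u atTop (𝓝 y) →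
        Tendsto (fun N : ℕ => G N (xvec (d + 1) s + (√(N : ℝ))⁻¹ • hyper (u N))) atTop
          (𝓝 (g y))) →
      Tendsto (fun N : ℕ => Real.exp (-(N * freeFun p (d + 1) β h s)) *
        gibbsSum p β h N (fun t => if dist t (xvec (d + 1) s) < ε then G N t else 0)) atTop
        (𝓝 (√d / (d + 1) * tau p (d + 1) β h (xvec (d + 1) s) *
          ∫ y, g y ∂fluctuationLaw d (-kDeriv2 p β (bCoord d s)) (-kDeriv2 p β (aCoord d s)))) := by
  obtain ⟨c, hc, hQ⟩ := H.quadratic_le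
  have hpos := xvec_pos (d := d) H.nonneg H.lt_one
  have h1 : ∀ᶠ ε in 𝓝[>] (0 : ℝ), ∀ r, 2 * ε ≤ xvec (d + 1) s r := by
    refine eventually_all.2 fun r => ?_
    filter_upwards [Ioo_mem_nhdsGT (half_pos (hpos r))] with ε hε
    linarith [hε.2]
  filter_upwards [h1, self_mem_nhdsWithin,
    negFreeEnergy_le_quadratic hp (sum_xvec d s) hpos H.stationary' hc hQ] with ε hε1 hε hbd
  intro G g B C hg hB hGb hGlim
  have key := tendsto_gibbsSum_local (p := p) (β := β) (h := h) (sum_xvec d s) hε hε1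
    (fun y u hu => tendsto_negFreeEnergy_scaled hp hpos H.stationary' hu) (half_pos hc) hbd hB
    hGb hGlim
  refine (congrArg (Tendsto _ atTop) (congrArg 𝓝 ?_)).mp key
  rw [tau_xvec hp hd H]
  simp only [sum_kDeriv2_hyper, mul_assoc]
  rw [integral_const_mul, mul_left_comm]
  congr 1
  rw [← mul_assoc, ← integral_exp_quadratic hd (neg_pos.2 H.neg_b) (by linarith [H.neg_ab]) hg]
  congr 1
  refine integral_congr_ae (Eventually.of_forall fun y => ?_)
  simp only
  congr 2
  ring

/-! ### Fluctuations at the uniform vector -/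

theorem whiten_eq_smul_add (d : ℕ) (α γ : ℝ) (u v : Fin d → ℝ) :
    whiten d α γ (u + v) = whiten d α γ u + whiten d α γ v := by
  funext i
  simp only [whiten, Pi.add_apply, Finset.sum_add_distrib]
  ring

theorem whiten_smul (d : ℕ) (α γ c : ℝ) (u : Fin d → ℝ) :
    whiten d α γ (c • u) = c • whiten d α γ u := by
  funext i
  simp only [whiten, Pi.smul_apply, smul_eq_mul, ← Finset.mul_sum]
  ring

/-- The linear map that sends a standard Gaussian vector to the fluctuation of the magnetization. -/
def fluctuationMap (d : ℕ) (α γ : ℝ) :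
    EuclideanSpace ℝ (Fin d) →L[ℝ] EuclideanSpace ℝ (Fin (d + 1)) :=
  LinearMap.toContinuousLinearMap
    { toFun := fun u => WithLp.toLp 2 (hyper (whiten d α γ u.ofLp))
      map_add' := fun u v => by
        ext r
        refine Fin.cases ?_ (fun i => ?_) r <;>
          simp [hyper, whiten_eq_smul_add, Finset.sum_add_distrib, add_comm]
      map_smul' := fun c u => by
        ext r
        refine Fin.cases ?_ (fun i => ?_) r <;>
          simp [hyper, whiten_smul, Finset.mul_sum] }

theorem fluctuationMap_apply (d : ℕ) (α γ : ℝ) (u : EuclideanSpace ℝ (Fin d)) :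
    fluctuationMap d α γ u = WithLp.toLp 2 (hyper (whiten d α γ u.ofLp)) := rfl

theorem fluctuationLaw_map_hyper (d : ℕ) (α γ : ℝ) :
    (fluctuationLaw d α γ).map (fun y => (WithLp.toLp 2 (hyper y) : EuclideanSpace ℝ (Fin (d + 1)))) =
      (stdGaussian (EuclideanSpace ℝ (Fin d))).map (fluctuationMap d α γ) := by
  have h1 : Measurable fun y : Fin d → ℝ =>
      (WithLp.toLp 2 (hyper y) : EuclideanSpace ℝ (Fin (d + 1))) :=
    (PiLp.continuous_toLp 2 _).measurable.comp continuous_hyper.measurable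
  rw [fluctuationLaw, Measure.map_map h1 (measurable_whiten d α γ), ← map_pi_eq_stdGaussian,
    Measure.map_map (by fun_prop) (by fun_prop)]
  rfl

/-- This is the covariance form of the fluctuation vector at the uniform point, where both
parameters agree: 1/α times the squared norm of the projection onto the vectors of sum zero. It is
needed for the comparison with `sigmaMatrix` at s = 0. -/
theorem norm_sq_adjoint_fluctuationMap {d : ℕ} (hd : d ≠ 0) {α : ℝ} (hα : 0 < α)
    (t : EuclideanSpace ℝ (Fin (d + 1))) :
    ‖(fluctuationMap d α α).adjoint t‖ ^ 2 =
      α⁻¹ * (∑ r, t r ^ 2 - (∑ r, t r) ^ 2 / (d + 1)) := by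
  have hd0 : (d : ℝ) ≠ 0 := by exact_mod_cast hd
  have hγ : 0 < α + d * α := by positivity
  have hcoord : ∀ i : Fin d, (fluctuationMap d α α).adjoint t i =
      (√α)⁻¹ * t i.succ + ((((√(α + d * α))⁻¹ - (√α)⁻¹) / d) * (∑ j : Fin d, t j.succ) -
        (√(α + d * α))⁻¹ * t 0) := fun i => by
    have h1 : (fluctuationMap d α α).adjoint t i =
        inner ℝ (EuclideanSpace.single i (1 : ℝ)) ((fluctuationMap d α α).adjoint t) := by
      rw [EuclideanSpace.inner_single_left]; simp
    have h2 := sum_whiten hd α α (Pi.single i 1)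
    rw [h1, ContinuousLinearMap.adjoint_inner_right, fluctuationMap_apply, PiLp.inner_apply,
      Fin.sum_univ_succ]
    simp only [hyper, Fin.cons_zero, Fin.cons_succ, PiLp.ofLp_single, h2]
    simp only [Finset.sum_pi_single', Finset.mem_univ, if_true, mul_one, whiten,
      RCLike.inner_apply, conj_trivial, mul_add, Finset.sum_add_distrib, ← Finset.sum_mul]
    simp only [Pi.single_apply, mul_ite, mul_zero, mul_one, Finset.sum_ite_eq', Finset.mem_univ,
      if_true]
    ring
  rw [EuclideanSpace.norm_sq_eq]
  simp only [Real.norm_eq_abs, sq_abs, hcoord]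
  simp only [add_sq, mul_pow, Finset.sum_add_distrib, ← Finset.mul_sum, ← Finset.sum_mul,
    Finset.sum_const, Finset.card_univ, Fintype.card_fin, nsmul_eq_mul]
  rw [Fin.sum_univ_succ, Fin.sum_univ_succ]
  have e1 : (√α)⁻¹ ^ 2 = α⁻¹ := by rw [inv_pow, Real.sq_sqrt hα.le]
  have e2 : (√(α + d * α))⁻¹ ^ 2 = α⁻¹ / (d + 1) := by
    rw [inv_pow, Real.sq_sqrt hγ.le]; field_simp; ring
  generalize (√α)⁻¹ = x at *
  generalize (√(α + d * α))⁻¹ = z at *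
  generalize α⁻¹ = w at *
  generalize ∑ i : Fin d, t i.succ ^ 2 = A
  generalize ∑ i : Fin d, t i.succ = T
  have e2' : z ^ 2 * (d + 1) = w := by rw [e2]; field_simp
  subst e1
  field_simp
  linear_combination (T - d * t 0) ^ 2 * e2'

/-- At s = 0 the two coordinate values coincide, so the ratio ρ in `sigmaMatrix` is 1 and the matrix
has the form of a multiple of (d + 1)I - J. The corresponding Gaussian is the law of `hyper y` under
the fluctuation law. -/
theorem gamma1_eq {p : ℕ} (hp : 2 ≤ p) {d : ℕ} (hd : d ≠ 0) {β h : ℝ}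
    (hα : kDeriv2 p β (1 / (d + 1)) < 0) :
    gamma1 p (d + 1) β h =
      (fluctuationLaw d (-kDeriv2 p β (1 / (d + 1))) (-kDeriv2 p β (1 / (d + 1)))).real
        {y | ∑ r, hyper y r ^ 2 ≤ d / -kDeriv2 p β (1 / (d + 1))} := by
  have hd0 : (0 : ℝ) < d := by positivity
  set α := -kDeriv2 p β (1 / (d + 1)) with hαd
  have hα0 : 0 < α := neg_pos.2 hα
  have hk : k'' p β (1 / ((d + 1 : ℕ) : ℝ)) = -α := by
    rw [k''_eq hp β (by positivity), hαd]; push_cast; ring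
  have hk1 : k'' p β ((1 - 0) / ((d + 1 : ℕ) : ℝ)) = -α := by rw [← hk, sub_zero]
  have hk2 : k'' p β ((1 + (((d + 1 : ℕ) : ℝ) - 1) * 0) / ((d + 1 : ℕ) : ℝ)) = -α := by
    rw [← hk]; simp
  have hf : freeFun'' p (d + 1) β h 0 = -(d / (d + 1) * α) := by
    have ha : aCoord d 0 = 1 / (d + 1) := by simp [aCoord]
    have hb : bCoord d 0 = 1 / (d + 1) := by simp [bCoord]
    rw [freeFun''_eq hp d β h (by rw [ha]; positivity) (by rw [hb]; positivity), ha, hb, hαd]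
    field_simp
  have hS : sigmaMatrix p (d + 1) β h 0 = (α * (d + 1))⁻¹ •
      Matrix.of fun i j : Fin (d + 1) => if i = j then (d : ℝ) else -1 := by
    have e : (-(((d + 1 : ℕ) : ℝ) ^ 2 / (((d + 1 : ℕ) : ℝ) - 1) * freeFun'' p (d + 1) β h 0))⁻¹ =
        (α * (d + 1))⁻¹ := by
      rw [hf, show ((d + 1 : ℕ) : ℝ) - 1 = d by push_cast; ring]; push_cast; congr 1; field_simp
    rw [sigmaMatrix, e]
    congr 1
    ext i j
    simp only [Matrix.of_apply, hk1, hk2, div_self (neg_ne_zero.2 hα0.ne')]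
    push_cast
    by_cases hij : i = j
    · subst hij
      by_cases hi : i = 0
      · simp [hi]
      · simp [hi]; ring
    · by_cases hi : i = 0
      · have : j ≠ 0 := fun h => hij (hi.trans h.symm)
        simp [hi, this, this.symm]
      · simp [hij, hi]
  have hquad : ∀ x : Fin (d + 1) → ℝ, x ⬝ᵥ (sigmaMatrix p (d + 1) β h 0).mulVec x =
      α⁻¹ * (∑ r, x r ^ 2 - (∑ r, x r) ^ 2 / (d + 1)) := fun x => by
    rw [hS, Matrix.smul_mulVec, dotProduct_smul, smul_eq_mul]
    have h1 : ∀ i, (Matrix.of fun i j : Fin (d + 1) => if i = j then (d : ℝ) else -1).mulVec x i =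
        (d + 1) * x i - ∑ r, x r := fun i => by
      simp only [Matrix.mulVec, dotProduct, Matrix.of_apply]
      have : ∀ j, (if i = j then (d : ℝ) else -1) * x j =
          (if i = j then (d + 1) * x j else 0) - x j := fun j => by
        split_ifs <;> ring
      simp [this, Finset.sum_sub_distrib]
    simp only [dotProduct, h1, mul_sub, Finset.sum_sub_distrib, ← Finset.sum_mul]
    have : ∑ i, x i * ((d + 1) * x i) = (d + 1) * ∑ i, x i ^ 2 := by
      rw [Finset.mul_sum]; exact Finset.sum_congr rfl fun i _ => by ring
    rw [this]
    field_simp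
  -- By Cauchy-Schwarz; without semidefiniteness the formula for the characteristic function of
  -- `multivariateGaussian` would not apply.
  have hpsd : (sigmaMatrix p (d + 1) β h 0).PosSemidef := by
    rw [Matrix.posSemidef_iff_dotProduct_mulVec]
    refine ⟨?_, fun x => ?_⟩
    · rw [hS]
      ext i j
      simp [eq_comm]
    · rw [star_trivial, hquad]
      refine mul_nonneg (by positivity) (sub_nonneg.2 ?_)
      rw [div_le_iff₀ (by positivity)]
      have := sq_sum_le_card_mul_sum_sq (s := Finset.univ) (f := x)
      simp at this
      linarith
  have hlaw : multivariateGaussian (0 : EuclideanSpace ℝ (Fin (d + 1)))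
      (sigmaMatrix p (d + 1) β h 0) =
      (fluctuationLaw d α α).map
        (fun y => (WithLp.toLp 2 (hyper y) : EuclideanSpace ℝ (Fin (d + 1)))) := by
    rw [fluctuationLaw_map_hyper]
    have : IsProbabilityMeasure ((stdGaussian (EuclideanSpace ℝ (Fin d))).map
      (fluctuationMap d α α)) := Measure.isProbabilityMeasure_map (by fun_prop)
    -- Both characteristic functions are exp(-Q/2), with Q computed by `hquad` on one side and by
    -- the norm of the adjoint on the other.
    refine Measure.ext_of_charFun ?_
    funext t
    rw [charFun_multivariateGaussian hpsd, charFun_apply, integral_map (by fun_prop) (by fun_prop)]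
    simp_rw [← ContinuousLinearMap.adjoint_inner_right]
    rw [← charFun_apply, charFun_stdGaussian, hquad, ← norm_sq_adjoint_fluctuationMap hd hα0]
    simp
    ring_nf
  rw [gamma1, hlaw, hk, measureReal_def, measureReal_def, Measure.map_apply]
  · congr 2
    ext y
    simp only [Set.mem_preimage, Set.mem_ofPred_eq]
    rw [show (1 - ((d + 1 : ℕ) : ℝ)) / -α = d / α by push_cast; field_simp; ring]
  · exact (PiLp.continuous_toLp 2 _).measurable.comp continuous_hyper.measurable
  · exact measurableSet_le (by fun_prop) measurable_const

theorem sum_hyper_sq {d : ℕ} (y : Fin d → ℝ) :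
    ∑ r, hyper y r ^ 2 = ∑ i, y i ^ 2 + (∑ i, y i) ^ 2 := by
  simp [Fin.sum_univ_succ, hyper, add_comm]

theorem sum_hyper_whiten_sq {d : ℕ} (hd : d ≠ 0) {α : ℝ} (hα : 0 < α) (u : Fin d → ℝ) :
    ∑ r, hyper (whiten d α α u) r ^ 2 = α⁻¹ * ∑ i, u i ^ 2 := by
  have h := quadratic_whiten hd hα (by positivity : 0 < α + d * α) u
  rw [sum_hyper_sq, ← h]
  field_simp

/-- The squared norm is 1/α times a sum of d independent squared standard normals. With α =
-k''(1/q) the value is (1 - q)/k''(1/q), so the threshold in γ₁ is the mean of the quadratic form.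
-/
theorem integral_sum_hyper_sq {d : ℕ} (hd : d ≠ 0) {α : ℝ} (hα : 0 < α) :
    ∫ y, ∑ r, hyper y r ^ 2 ∂fluctuationLaw d α α = d / α := by
  have hm : Measurable fun y : Fin d → ℝ => ∑ r, hyper y r ^ 2 :=
    (continuous_finsetSum _ fun r _ =>
      ((continuous_apply r).comp continuous_hyper).pow 2).measurable
  rw [fluctuationLaw, integral_map (measurable_whiten d α α).aemeasurable hm.aestronglyMeasurable]
  simp only [sum_hyper_whiten_sq hd hα]
  have hmem : MemLp (id : ℝ → ℝ) 2 (gaussianReal 0 1) := memLp_id_gaussianReal 2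
  have hint : Integrable (fun x : ℝ => x ^ 2) (gaussianReal 0 1) := hmem.integrable_sq
  have hone : ∫ x, x ^ 2 ∂gaussianReal 0 1 = 1 := by
    have h1 := variance_eq_sub hmem
    rw [variance_id_gaussianReal] at h1
    simp at h1
    exact h1.symm
  rw [integral_const_mul, integral_finsetSum]
  · have : ∀ i : Fin d, ∫ u : Fin d → ℝ, u i ^ 2 ∂Measure.pi (fun _ => gaussianReal 0 1) = 1 :=
      fun i => by
        rw [← hone]
        exact integral_comp_eval (μ := fun _ : Fin d => gaussianReal 0 1) (i := i)
          hint.aestronglyMeasurable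
    simp only [this]
    simp
    field_simp
  · intro i _
    exact integrable_comp_eval (μ := fun _ : Fin d => gaussianReal 0 1) (i := i) hint

/-- A linear change of variables turns the level set into a subset of a sphere. This removes the
discontinuity of indicator functions in the limits at the uniform vector. -/
theorem volume_hyper_sq_eq {d : ℕ} (hd : d ≠ 0) (c : ℝ) :
    volume {y : Fin d → ℝ | ∑ r, hyper y r ^ 2 = c} = 0 := by
  have hα : (0 : ℝ) < 1 := one_pos
  have hdet : 0 < (whitenMatrix d 1 1).det := by
    rw [det_whitenMatrix hd hα]; positivity
  have h1 := Real.map_matrix_volume_pi_eq_smul_volume_pi hdet.ne'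
  have hfun : ⇑(Matrix.toLin' (whitenMatrix d 1 1)) = whiten d 1 1 :=
    funext (toLin'_whitenMatrix hα 1)
  rw [hfun] at h1
  have hms : MeasurableSet {y : Fin d → ℝ | ∑ r, hyper y r ^ 2 = c} :=
    measurableSet_eq_fun (continuous_finsetSum _ fun r _ =>
      ((continuous_apply r).comp continuous_hyper).pow 2).measurable measurable_const
  have h2 := congrArg (fun μ => μ {y : Fin d → ℝ | ∑ r, hyper y r ^ 2 = c}) h1
  simp only [Measure.map_apply (measurable_whiten d 1 1) hms, Measure.smul_apply,
    smul_eq_mul] at h2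
  have h3 : volume (whiten d 1 1 ⁻¹' {y : Fin d → ℝ | ∑ r, hyper y r ^ 2 = c}) = 0 := by
    have e : whiten d 1 1 ⁻¹' {y : Fin d → ℝ | ∑ r, hyper y r ^ 2 = c} =
        WithLp.toLp 2 ⁻¹' {u : EuclideanSpace ℝ (Fin d) | ‖u‖ ^ 2 = c} := by
      ext u
      simp [sum_hyper_whiten_sq hd hα, EuclideanSpace.norm_sq_eq]
    have hsub : {u : EuclideanSpace ℝ (Fin d) | ‖u‖ ^ 2 = c} ⊆ Metric.sphere 0 (√c) := fun u hu => by
      rw [mem_sphere_zero_iff_norm, ← hu.out, Real.sqrt_sq (norm_nonneg u)]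
    have : Nonempty (Fin d) := ⟨⟨0, Nat.pos_of_ne_zero hd⟩⟩
    have hz : volume {u : EuclideanSpace ℝ (Fin d) | ‖u‖ ^ 2 = c} = 0 :=
      measure_mono_null hsub (Measure.addHaar_sphere _ _ _)
    rw [e, (PiLp.volume_preserving_toLp (Fin d)).measure_preimage
      (measurableSet_eq_fun (by fun_prop) measurable_const).nullMeasurableSet, hz]
  rw [h3] at h2
  have h4 : ENNReal.ofReal |(whitenMatrix d 1 1).det⁻¹| ≠ 0 := by
    rw [abs_of_pos (inv_pos.2 hdet)]
    exact (ENNReal.ofReal_pos.2 (inv_pos.2 hdet)).ne'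
  exact (mul_eq_zero.1 h2.symm).resolve_left h4

theorem volume_sum_eq {d : ℕ} (hd : d ≠ 0) {κ : ℝ} (hκ : κ ≠ 0) (c : ℝ) :
    volume {y : Fin d → ℝ | κ * ∑ i, y i = c} = 0 := by
  let L : (Fin d → ℝ) →ₗ[ℝ] ℝ := κ • ∑ i, LinearMap.proj i
  have hL : ∀ y, L y = κ * ∑ i, y i := fun y => by simp [L]
  let i0 : Fin d := ⟨0, Nat.pos_of_ne_zero hd⟩
  let S : AffineSubspace ℝ (Fin d → ℝ) := (AffineSubspace.mk' c ⊥).comap L.toAffineMap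
  have hS : (S : Set (Fin d → ℝ)) = {y | κ * ∑ i, y i = c} := by
    ext y
    simp [S, hL, sub_eq_zero]
  rw [← hS]
  refine Measure.addHaar_affineSubspace _ _ fun htop => ?_
  -- The functional takes the value c + 1 at this point, so the affine subspace is proper and hence
  -- null.
  have h1 : (Pi.single i0 ((c + 1) / κ) : Fin d → ℝ) ∈ (S : Set (Fin d → ℝ)) := by
    rw [htop]; trivial
  rw [hS] at h1
  simp at h1
  rw [mul_div_cancel₀ _ hκ] at h1
  linarith

/-! ### Expansion of the sum of powers -/

theorem isLittleO_pow {p : ℕ} (x : ℝ) :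
    (fun y : ℝ => y ^ p - x ^ p - p * x ^ (p - 1) * (y - x) -
      p * ((p - 1 : ℕ) * x ^ (p - 2)) / 2 * (y - x) ^ 2) =o[𝓝 x] fun y => (y - x) ^ 2 := by
  refine isLittleO_taylor_two (f := fun y : ℝ => y ^ p) (f' := fun y : ℝ => p * y ^ (p - 1))
    (Eventually.of_forall fun y => hasDerivAt_pow p y) ?_
  have := (hasDerivAt_pow (p - 1) x).const_mul (p : ℝ)
  rwa [Nat.sub_sub] at this

/-- The limit of `√N (S - S(x_s))` along `x_s + hyper y / √N` is this multiple of `∑ y`. -/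
def slope (p d : ℕ) (s : ℝ) : ℝ := -(p * (aCoord d s ^ (p - 1) - bCoord d s ^ (p - 1)))

theorem powerSum_sub (p d : ℕ) (s : ℝ) (N : ℕ) (v : Fin d → ℝ) :
    powerSum p (xvec (d + 1) s + (√(N : ℝ))⁻¹ • hyper v) - powerSum p (xvec (d + 1) s) =
      (√(N : ℝ))⁻¹ * (slope p d s * ∑ i, v i) +
      (√(N : ℝ))⁻¹ ^ 2 * ∑ r, p * ((p - 1 : ℕ) * xvec (d + 1) s r ^ (p - 2)) / 2 * hyper v r ^ 2 +
      ∑ r, ((xvec (d + 1) s r + (√(N : ℝ))⁻¹ * hyper v r) ^ p - xvec (d + 1) s r ^ p -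
        p * xvec (d + 1) s r ^ (p - 1) *
          ((xvec (d + 1) s r + (√(N : ℝ))⁻¹ * hyper v r) - xvec (d + 1) s r) -
        p * ((p - 1 : ℕ) * xvec (d + 1) s r ^ (p - 2)) / 2 *
          ((xvec (d + 1) s r + (√(N : ℝ))⁻¹ * hyper v r) - xvec (d + 1) s r) ^ 2) := by
  have h1 : slope p d s * ∑ i, v i = ∑ r, p * xvec (d + 1) s r ^ (p - 1) * hyper v r := by
    rw [Fin.sum_univ_succ, xvec_zero_eq]
    simp only [xvec_succ_eq, hyper, Fin.cons_zero, Fin.cons_succ, ← Finset.mul_sum, slope]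
    ring
  rw [h1]
  simp only [powerSum, Pi.add_apply, Pi.smul_apply, smul_eq_mul, Finset.mul_sum,
    ← Finset.sum_sub_distrib, ← Finset.sum_add_distrib]
  refine Finset.sum_congr rfl fun r _ => ?_
  ring

theorem tendsto_powerSum_first {p d : ℕ} (s : ℝ) {y : Fin d → ℝ} {u : ℕ → Fin d → ℝ}
    (hu : Tendsto u atTop (𝓝 y)) :
    Tendsto (fun N : ℕ => √(N : ℝ) * (powerSum p (xvec (d + 1) s + (√(N : ℝ))⁻¹ • hyper (u N)) -
      powerSum p (xvec (d + 1) s))) atTop (𝓝 (slope p d s * ∑ i, y i)) := by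
  have hv := tendsto_pi_nhds.1 ((continuous_hyper.tendsto y).comp hu)
  have hu' := tendsto_pi_nhds.1 hu
  have l1 : Tendsto (fun N => slope p d s * ∑ i, u N i) atTop (𝓝 (slope p d s * ∑ i, y i)) :=
    (tendsto_finsetSum _ fun i _ => hu' i).const_mul _
  have l2 : Tendsto (fun N => ∑ r, p * ((p - 1 : ℕ) * xvec (d + 1) s r ^ (p - 2)) / 2 *
      hyper (u N) r ^ 2) atTop (𝓝 (∑ r, p * ((p - 1 : ℕ) * xvec (d + 1) s r ^ (p - 2)) / 2 *
      hyper y r ^ 2)) :=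
    tendsto_finsetSum _ fun r _ => ((hv r).pow 2).const_mul _
  have h0 := fun r => tendsto_nat_mul_littleO (isLittleO_pow (p := p) (xvec (d + 1) s r)) (hv r)
  have l3 := tendsto_finsetSum Finset.univ fun r _ => h0 r
  have l4 := (l1.add (tendsto_inv_sqrt_nat.mul l2)).add (tendsto_inv_sqrt_nat.mul l3)
  rw [zero_mul, zero_mul, add_zero, add_zero] at l4
  refine Tendsto.congr' ?_ l4
  filter_upwards [eventually_ne_atTop 0] with N hN
  have hs : √(N : ℝ) ≠ 0 := by positivity
  have hN' : (0 : ℝ) ≤ N := Nat.cast_nonneg N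
  rw [powerSum_sub, ← Finset.mul_sum]
  simp only [Function.comp]
  generalize ∑ r, ((xvec (d + 1) s r + (√(N : ℝ))⁻¹ * hyper (u N) r) ^ p - xvec (d + 1) s r ^ p -
        p * xvec (d + 1) s r ^ (p - 1) *
          ((xvec (d + 1) s r + (√(N : ℝ))⁻¹ * hyper (u N) r) - xvec (d + 1) s r) -
        p * ((p - 1 : ℕ) * xvec (d + 1) s r ^ (p - 2)) / 2 *
          ((xvec (d + 1) s r + (√(N : ℝ))⁻¹ * hyper (u N) r) - xvec (d + 1) s r) ^ 2) = R
  have e : (√(N : ℝ))⁻¹ * (N * R) = √N * R := by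
    nth_rewrite 2 [← Real.mul_self_sqrt hN']
    field_simp
  rw [e]
  field_simp

/-- Half the second derivative of `x ^ p` at the uniform vector. -/
def curvature (p d : ℕ) : ℝ := p * ((p - 1 : ℕ) * (1 / (d + 1 : ℝ)) ^ (p - 2)) / 2

theorem curvature_pos {p : ℕ} (hp : 2 ≤ p) (d : ℕ) : 0 < curvature p d := by
  have : (0 : ℝ) < p := by positivity
  have : (0 : ℝ) < ((p - 1 : ℕ) : ℝ) := by
    have : 0 < p - 1 := by omega
    positivity
  unfold curvature
  positivity

theorem xvec_zero_param (d : ℕ) (r : Fin (d + 1)) : xvec (d + 1) 0 r = 1 / (d + 1) := by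
  refine Fin.cases ?_ (fun i => ?_) r
  · rw [xvec_zero_eq]; simp [aCoord]
  · rw [xvec_succ_eq]; simp [bCoord]

theorem slope_zero_param (p d : ℕ) : slope p d 0 = 0 := by
  simp [slope, aCoord, bCoord]

theorem slope_ne_zero {p : ℕ} (hp : 2 ≤ p) {d : ℕ} {s : ℝ} (hs : 0 < s) (hs1 : s < 1) :
    slope p d s < 0 := by
  have h1 : bCoord d s < aCoord d s := by linarith [aCoord_sub_bCoord d s]
  have h2 := pow_lt_pow_left₀ h1 (bCoord_pos hs1).le (by omega : p - 1 ≠ 0)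
  have : (0 : ℝ) < p := by positivity
  unfold slope
  nlinarith

/-- At the uniform vector all partial derivatives of S agree, so the linear term vanishes on
increments of sum zero and S varies only on the scale 1/N. -/
theorem tendsto_powerSum_second {p d : ℕ} {y : Fin d → ℝ} {u : ℕ → Fin d → ℝ}
    (hu : Tendsto u atTop (𝓝 y)) :
    Tendsto (fun N : ℕ => N * (powerSum p (xvec (d + 1) 0 + (√(N : ℝ))⁻¹ • hyper (u N)) -
      powerSum p (xvec (d + 1) 0))) atTop (𝓝 (curvature p d * ∑ r, hyper y r ^ 2)) := by
  have hv := tendsto_pi_nhds.1 ((continuous_hyper.tendsto y).comp hu)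
  have l2 : Tendsto (fun N => curvature p d * ∑ r, hyper (u N) r ^ 2) atTop
      (𝓝 (curvature p d * ∑ r, hyper y r ^ 2)) :=
    (tendsto_finsetSum _ fun r _ => (hv r).pow 2).const_mul _
  have h0 := fun r => tendsto_nat_mul_littleO (isLittleO_pow (p := p) (xvec (d + 1) 0 r)) (hv r)
  have l3 := tendsto_finsetSum Finset.univ fun r _ => h0 r
  have l4 := l2.add l3
  rw [Finset.sum_const_zero, add_zero] at l4
  refine Tendsto.congr' ?_ l4
  filter_upwards [eventually_ne_atTop 0] with N hN
  have hN' : (0 : ℝ) < N := by positivity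
  rw [powerSum_sub, slope_zero_param, ← Finset.mul_sum]
  simp only [Function.comp]
  rw [inv_pow, Real.sq_sqrt hN'.le, curvature]
  simp only [xvec_zero_param]
  rw [Finset.mul_sum]
  field_simp
  ring

theorem powerSum_comp_perm (p : ℕ) {q : ℕ} (t : Fin q → ℝ) (σ : Equiv.Perm (Fin q)) :
    powerSum p (t ∘ σ) = powerSum p t :=
  Equiv.sum_comp σ fun r => t r ^ p

theorem sum_abs_sub_le {d : ℕ} {t m : Fin (d + 1) → ℝ} (ht : ∑ r, t r = 1) (hm : ∑ r, m r = 1) :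
    ∑ r, |t r - m r| ≤ 2 * ∑ i : Fin d, |t i.succ - m i.succ| := by
  have h0 : t 0 - m 0 = -∑ i : Fin d, (t i.succ - m i.succ) := by
    rw [Fin.sum_univ_succ] at ht hm
    rw [Finset.sum_sub_distrib]
    linarith
  have h1 : |t 0 - m 0| ≤ ∑ i : Fin d, |t i.succ - m i.succ| := by
    rw [h0, abs_neg]
    exact Finset.abs_sum_le_sum_abs _ _
  rw [Fin.sum_univ_succ]
  linarith

theorem le_one_of_mem_stdSimplex {q : ℕ} {t : Fin q → ℝ} (ht : t ∈ stdSimplex ℝ (Fin q))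
    (r : Fin q) : t r ≤ 1 :=
  ht.2 ▸ Finset.single_le_sum (fun i _ => ht.1 i) (Finset.mem_univ r)

/-- Lipschitz bound that turns exponential growth in √N|S - S(m)| into the growth allowed in
`tendsto_gibbsSum_xvec`. -/
theorem abs_powerSum_sub_le {p d : ℕ} {t m : Fin (d + 1) → ℝ}
    (ht : t ∈ stdSimplex ℝ (Fin (d + 1))) (hm : m ∈ stdSimplex ℝ (Fin (d + 1))) :
    |powerSum p t - powerSum p m| ≤ 2 * p * ∑ i : Fin d, |t i.succ - m i.succ| := by
  have h1 : ∀ r, |t r ^ p - m r ^ p| ≤ p * |t r - m r| := fun r => by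
    refine (abs_pow_sub_pow_le _ _ _).trans ?_
    rw [mul_comm |t r - m r|]
    refine mul_le_of_le_one_right (by positivity) (pow_le_one₀ (by positivity) (max_le ?_ ?_))
    · rw [abs_of_nonneg (ht.1 r)]; exact le_one_of_mem_stdSimplex ht r
    · rw [abs_of_nonneg (hm.1 r)]; exact le_one_of_mem_stdSimplex hm r
  calc |powerSum p t - powerSum p m| ≤ ∑ r, |t r ^ p - m r ^ p| := by
        rw [powerSum, powerSum, ← Finset.sum_sub_distrib]
        exact Finset.abs_sum_le_sum_abs _ _
    _ ≤ ∑ r, p * |t r - m r| := Finset.sum_le_sum fun r _ => h1 r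
    _ = p * ∑ r, |t r - m r| := (Finset.mul_sum _ _ _).symm
    _ ≤ p * (2 * ∑ i : Fin d, |t i.succ - m i.succ|) :=
        mul_le_mul_of_nonneg_left (sum_abs_sub_le ht.2 hm.2) (by positivity)
    _ = _ := by ring

theorem abs_powerSum_sub_le_sq (p d : ℕ) : ∃ K ≥ 0, ∀ᶠ ε in 𝓝[>] (0 : ℝ),
    ∀ t ∈ stdSimplex ℝ (Fin (d + 1)), dist t (xvec (d + 1) 0) < ε →
      |powerSum p t - powerSum p (xvec (d + 1) 0)| ≤
        K * (∑ i : Fin d, |t i.succ - xvec (d + 1) 0 i.succ|) ^ 2 := by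
  set m := xvec (d + 1) 0 with hmd
  have hm : ∑ r, m r = 1 := sum_xvec d 0
  have h1 : ∀ r, ∀ᶠ x in 𝓝 (m r), |x ^ p - m r ^ p - p * m r ^ (p - 1) * (x - m r) -
      p * ((p - 1 : ℕ) * m r ^ (p - 2)) / 2 * (x - m r) ^ 2| ≤ (x - m r) ^ 2 := fun r => by
    filter_upwards [(Asymptotics.isLittleO_iff.1 (isLittleO_pow (p := p) (m r))) one_pos] with x hx
    simpa using hx
  have h2 : ∀ᶠ t in 𝓝 m, ∀ r, |t r ^ p - m r ^ p - p * m r ^ (p - 1) * (t r - m r) -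
      p * ((p - 1 : ℕ) * m r ^ (p - 2)) / 2 * (t r - m r) ^ 2| ≤ (t r - m r) ^ 2 :=
    eventually_all.2 fun r => ((continuous_apply r).tendsto m).eventually (h1 r)
  obtain ⟨δ, hδ, hball⟩ := Metric.eventually_nhds_iff_ball.1 h2
  have hcurv : 0 ≤ curvature p d := by unfold curvature; positivity
  -- The curvature term and a remainder of relative size 1 multiply ∑(t_r - m_r)²; the 4 is the
  -- square of the constant 2 in `sum_abs_sub_le`.
  refine ⟨(curvature p d + 1) * 4, by positivity, ?_⟩
  filter_upwards [Ioo_mem_nhdsGT hδ] with ε hε t ht htm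
  have h3 := hball t (htm.trans hε.2)
  have e : powerSum p t - powerSum p m = ∑ r, (t r ^ p - m r ^ p - p * m r ^ (p - 1) * (t r - m r) -
      p * ((p - 1 : ℕ) * m r ^ (p - 2)) / 2 * (t r - m r) ^ 2) +
      curvature p d * ∑ r, (t r - m r) ^ 2 := by
    have hz : ∑ r, (t r - m r) = 0 := by rw [Finset.sum_sub_distrib, ht.2, hm, sub_self]
    simp only [hmd, xvec_zero_param] at hz ⊢
    rw [Finset.sum_sub_distrib, Finset.sum_sub_distrib, ← Finset.mul_sum, ← Finset.mul_sum, hz]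
    simp only [powerSum, xvec_zero_param, curvature, Finset.sum_sub_distrib]
    ring
  have h4 : ∑ r, (t r - m r) ^ 2 ≤ 4 * (∑ i : Fin d, |t i.succ - m i.succ|) ^ 2 := by
    have h5 : ∑ r, (t r - m r) ^ 2 ≤ (∑ r, |t r - m r|) ^ 2 := by
      simp only [← sq_abs (t _ - m _)]
      exact Finset.sum_sq_le_sq_sum_of_nonneg fun r _ => abs_nonneg _
    have h6 := pow_le_pow_left₀ (Finset.sum_nonneg fun r _ => abs_nonneg _)
      (sum_abs_sub_le ht.2 hm) 2
    linarith
  rw [e]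
  calc _ ≤ ∑ r, (t r - m r) ^ 2 + curvature p d * ∑ r, (t r - m r) ^ 2 := by
        refine (abs_add_le _ _).trans (add_le_add ((Finset.abs_sum_le_sum_abs _ _).trans
          (Finset.sum_le_sum fun r _ => h3 r)) ?_)
        rw [abs_of_nonneg]
        exact mul_nonneg hcurv (Finset.sum_nonneg fun r _ => sq_nonneg _)
    _ = (curvature p d + 1) * ∑ r, (t r - m r) ^ 2 := by ring
    _ ≤ (curvature p d + 1) * (4 * (∑ i : Fin d, |t i.succ - m i.succ|) ^ 2) :=
        mul_le_mul_of_nonneg_left h4 (by positivity)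
    _ = _ := by ring

/-! ### Laplace's method for functions of the sum of powers -/

theorem magnetization_comp {q N : ℕ} (X : Fin N → Fin q) (σ : Equiv.Perm (Fin q)) :
    magnetization q N (σ ∘ X) = magnetization q N X ∘ σ.symm := by
  funext r
  simp only [magnetization, Function.comp, Equiv.eq_symm_apply]

/-- Relabelling the colours is a symmetry when the field vanishes. The alternative σ = 1 lets the
cases h = 0 and h > 0 be treated together from here on. -/
theorem gibbsSum_comp_perm {p q : ℕ} [NeZero q] {β h : ℝ} {σ : Equiv.Perm (Fin q)}
    (hσ : h = 0 ∨ σ = 1) (N : ℕ) (F : (Fin q → ℝ) → ℝ) :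
    gibbsSum p β h N F = gibbsSum p β h N fun t => F (t ∘ σ) := by
  rcases hσ with rfl | rfl
  · rw [gibbsSum, gibbsSum, ← Equiv.sum_comp (Equiv.arrowCongr (Equiv.refl (Fin N)) σ.symm)]
    refine Finset.sum_congr rfl fun X _ => ?_
    have e : (Equiv.arrowCongr (Equiv.refl (Fin N)) σ.symm) X = σ.symm ∘ X := rfl
    rw [e, energy_eq, energy_eq, magnetization_comp, powerSum_comp_perm, Equiv.symm_symm]
    simp
  · rfl

theorem dist_comp_perm {q : ℕ} (t m : Fin q → ℝ) (σ : Equiv.Perm (Fin q)) :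
    dist (t ∘ σ) (m ∘ σ) = dist t m := by
  refine le_antisymm ?_ ?_
  · exact (dist_pi_le_iff dist_nonneg).2 fun r => dist_le_pi_dist t m (σ r)
  · refine (dist_pi_le_iff dist_nonneg).2 fun r => ?_
    have := dist_le_pi_dist (t ∘ σ) (m ∘ σ) (σ.symm r)
    simpa using this

/-- The part of a Gibbs sum near a vector `m`, normalized by its exponential rate `c`. -/
def localSum (p : ℕ) {q : ℕ} [NeZero q] (β h c : ℝ) (ε : ℝ) (m : Fin q → ℝ) (G : ℝ → ℝ)
    (N : ℕ) : ℝ :=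
  Real.exp (-(N * c)) * gibbsSum p β h N (fun t => if dist t m < ε then G (powerSum p t) else 0)

theorem localSum_comp_perm {p q : ℕ} [NeZero q] {β h c ε : ℝ} {m : Fin q → ℝ}
    {σ : Equiv.Perm (Fin q)} (hσ : h = 0 ∨ σ = 1) (G : ℝ → ℝ) (N : ℕ) :
    localSum p β h c ε (m ∘ σ) G N = localSum p β h c ε m G N := by
  rw [localSum, gibbsSum_comp_perm hσ, localSum]
  simp only [dist_comp_perm, powerSum_comp_perm]

theorem tendsto_localSum_const {p : ℕ} (hp : 2 ≤ p) {d : ℕ} (hd : d ≠ 0) {β h s : ℝ}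
    (H : NondegenerateAt p d β h s) :
    ∀ᶠ ε in 𝓝[>] (0 : ℝ), ∀ (G : ℕ → ℝ → ℝ) (C c : ℝ),
      (∀ᶠ N : ℕ in atTop, ∀ t ∈ stdSimplex ℝ (Fin (d + 1)), dist t (xvec (d + 1) s) < ε →
        |G N (powerSum p t)| ≤ C) →
      (∀ x : ℕ → ℝ, Tendsto x atTop (𝓝 (powerSum p (xvec (d + 1) s))) →
        Tendsto (fun N => G N (x N)) atTop (𝓝 c)) →
      Tendsto (fun N : ℕ => localSum p β h (freeFun p (d + 1) β h s) ε (xvec (d + 1) s) (G N) N)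
        atTop (𝓝 (√d / (d + 1) * tau p (d + 1) β h (xvec (d + 1) s) * c)) := by
  filter_upwards [tendsto_gibbsSum_xvec hp hd H] with ε hε G C c hb hl
  have h1 := hε (fun N t => G N (powerSum p t)) (fun _ => c) 0 C measurable_const le_rfl
    (by simpa using hb) (Eventually.of_forall fun y u hu => hl _ ?_)
  · simpa using! h1
  · have hc : Continuous fun t : Fin (d + 1) → ℝ => powerSum p t := by
      unfold powerSum; fun_prop
    exact (hc.tendsto _).comp (tendsto_add_smul_hyper _ hu)

/-- The variance of the limit law of `√N (S - S(x_s))`. -/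
def powerSumVar (p d : ℕ) (β s : ℝ) : ℝ :=
  slope p d s ^ 2 * (d / (-kDeriv2 p β (bCoord d s) + d * -kDeriv2 p β (aCoord d s)))

/-- Nothing is required at the single value ρ, so that indicators with a moving threshold are
admitted: its preimage is a hyperplane, hence null, because the slope is nonzero for s > 0. -/
theorem tendsto_localSum_normal {p : ℕ} (hp : 2 ≤ p) {d : ℕ} (hd : d ≠ 0) {β h s : ℝ}
    (H : NondegenerateAt p d β h s) (hs : 0 < s) :
    ∀ᶠ ε in 𝓝[>] (0 : ℝ), ∀ (G : ℕ → ℝ → ℝ) (g : ℝ → ℝ) (B C ρ : ℝ), Measurable g → 0 ≤ B →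
      (∀ᶠ N : ℕ in atTop, ∀ x, |G N x| ≤
        C * Real.exp (B * √N * |x - powerSum p (xvec (d + 1) s)|)) →
      (∀ z, z ≠ ρ → ∀ v : ℕ → ℝ, Tendsto v atTop (𝓝 z) →
        Tendsto (fun N : ℕ => G N (powerSum p (xvec (d + 1) s) + (√(N : ℝ))⁻¹ * v N)) atTop
          (𝓝 (g z))) →
      Tendsto (fun N : ℕ => localSum p β h (freeFun p (d + 1) β h s) ε (xvec (d + 1) s) (G N) N)
        atTop (𝓝 (√d / (d + 1) * tau p (d + 1) β h (xvec (d + 1) s) *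
          ∫ z, g z ∂normalLaw (powerSumVar p d β s))) := by
  filter_upwards [tendsto_gibbsSum_xvec hp hd H] with ε hε G g B C ρ hg hB hb hl
  have hsl := slope_ne_zero (d := d) hp hs H.lt_one
  have hmeas : Measurable fun y : Fin d → ℝ => slope p d s * ∑ i, y i := by fun_prop
  have h1 := hε (fun N t => G N (powerSum p t)) (fun y => g (slope p d s * ∑ i, y i))
    (B * (2 * p)) |C| (hg.comp hmeas) (by positivity) ?_ ?_
  · rw [powerSumVar, ← fluctuationLaw_map_sum hd (by linarith [H.neg_ab]) (slope p d s),
      integral_map hmeas.aemeasurable hg.aestronglyMeasurable]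
    exact h1
  · filter_upwards [hb] with N hN t ht _
    refine (hN _).trans ?_
    refine mul_le_mul (le_abs_self C) (Real.exp_le_exp.2 ?_) (Real.exp_nonneg _) (abs_nonneg C)
    have h2 := abs_powerSum_sub_le (p := p) ht (xvec_mem_stdSimplex ⟨H.nonneg, H.lt_one.le⟩)
    calc _ ≤ B * √N * (2 * p * ∑ i : Fin d, |t i.succ - xvec (d + 1) s i.succ|) :=
          mul_le_mul_of_nonneg_left h2 (by positivity)
      _ = _ := by ring
  · have hnull : ∀ᵐ y : Fin d → ℝ, slope p d s * ∑ i, y i ≠ ρ := by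
      rw [ae_iff]
      simpa using volume_sum_eq hd hsl.ne ρ
    filter_upwards [hnull] with y hy u hu
    refine Tendsto.congr' ?_ (hl _ hy _ (tendsto_powerSum_first (p := p) s hu))
    filter_upwards [eventually_ne_atTop 0] with N hN
    have : √(N : ℝ) ≠ 0 := by positivity
    rw [inv_mul_cancel_left₀ this, add_sub_cancel]

/-- Counterpart on the scale 1/N. Linear growth in N|S - S(x₀)| has to be allowed because the mean
of this quantity is computed later. -/
theorem tendsto_localSum_uniform {p : ℕ} (hp : 2 ≤ p) {d : ℕ} (hd : d ≠ 0) {β h : ℝ}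
    (H : NondegenerateAt p d β h 0) :
    ∀ᶠ ε in 𝓝[>] (0 : ℝ), ∀ (G : ℕ → ℝ → ℝ) (g : ℝ → ℝ) (B C ρ : ℝ), Measurable g → 0 ≤ B →
      0 ≤ C →
      (∀ᶠ N : ℕ in atTop, ∀ x, |G N x| ≤ C * (1 + N * |x - powerSum p (xvec (d + 1) 0)|) *
        Real.exp (B * √N * |x - powerSum p (xvec (d + 1) 0)|)) →
      (∀ z, z ≠ ρ → ∀ v : ℕ → ℝ, Tendsto v atTop (𝓝 z) →
        Tendsto (fun N : ℕ => G N (powerSum p (xvec (d + 1) 0) + (N : ℝ)⁻¹ * v N)) atTop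
          (𝓝 (g z))) →
      Tendsto (fun N : ℕ => localSum p β h (freeFun p (d + 1) β h 0) ε (xvec (d + 1) 0) (G N) N)
        atTop (𝓝 (√d / (d + 1) * tau p (d + 1) β h (xvec (d + 1) 0) *
          ∫ y, g (curvature p d * ∑ r, hyper y r ^ 2)
            ∂fluctuationLaw d (-kDeriv2 p β (1 / (d + 1))) (-kDeriv2 p β (1 / (d + 1))))) := by
  obtain ⟨K, hK, hq⟩ := abs_powerSum_sub_le_sq p d
  filter_upwards [tendsto_gibbsSum_xvec hp hd H, hq] with ε hε hq G g B C ρ hg hB hC hb hl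
  have hcurv := curvature_pos hp d
  have hmeas : Measurable fun y : Fin d → ℝ => curvature p d * ∑ r, hyper y r ^ 2 :=
    ((continuous_finsetSum _ fun r _ =>
      ((continuous_apply r).comp continuous_hyper).pow 2).measurable).const_mul _
  have h1 := hε (fun N t => G N (powerSum p t)) (fun y => g (curvature p d * ∑ r, hyper y r ^ 2))
    (2 + B * (2 * p)) (C * (1 + K)) (hg.comp hmeas) (by positivity) ?_ ?_
  · have ha : aCoord d 0 = 1 / (d + 1) := by simp [aCoord]
    have hb : bCoord d 0 = 1 / (d + 1) := by simp [bCoord]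
    rw [ha, hb] at h1
    exact h1
  · filter_upwards [hb] with N hN t ht htm
    refine (hN _).trans ?_
    have h2 := abs_powerSum_sub_le (p := p) ht (xvec_mem_stdSimplex ⟨H.nonneg, H.lt_one.le⟩)
    have h3 := hq t ht htm
    set T := ∑ i : Fin d, |t i.succ - xvec (d + 1) 0 i.succ| with hT
    have hT0 : 0 ≤ T := Finset.sum_nonneg fun i _ => abs_nonneg _
    -- Near the uniform vector N|S - S(x₀)| is at most K(√N T)², and this square is absorbed into
    -- the exponential rate.
    have h4 : (√N * T) ^ 2 ≤ Real.exp (2 * (√N * T)) := by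
      have h5 : √N * T ≤ Real.exp (√N * T) := by linarith [Real.add_one_le_exp (√N * T)]
      rw [two_mul, Real.exp_add, ← sq]
      exact pow_le_pow_left₀ (by positivity) h5 2
    have h6 : 1 + N * |powerSum p t - powerSum p (xvec (d + 1) 0)| ≤
        (1 + K) * Real.exp (2 * (√N * T)) := by
      have h7 : (1 : ℝ) ≤ Real.exp (2 * (√N * T)) := Real.one_le_exp (by positivity)
      have h8 : N * |powerSum p t - powerSum p (xvec (d + 1) 0)| ≤ K * (√N * T) ^ 2 := by
        rw [mul_pow, Real.sq_sqrt (Nat.cast_nonneg N)]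
        calc _ ≤ N * (K * T ^ 2) := mul_le_mul_of_nonneg_left h3 (Nat.cast_nonneg N)
          _ = _ := by ring
      have h9 := mul_le_mul_of_nonneg_left h4 hK
      linarith
    calc _ ≤ C * ((1 + K) * Real.exp (2 * (√N * T))) * Real.exp (B * √N * (2 * p * T)) := by
          gcongr
      _ = C * (1 + K) * Real.exp ((2 + B * (2 * p)) * √N * T) := by
          rw [mul_assoc, mul_assoc, ← Real.exp_add, ← mul_assoc]
          congr 2
          ring
  · have hnull : ∀ᵐ y : Fin d → ℝ, curvature p d * ∑ r, hyper y r ^ 2 ≠ ρ := by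
      rw [ae_iff]
      have := volume_hyper_sq_eq hd (ρ / curvature p d)
      simp only [ne_eq, not_not]
      convert this using 3
      ext y
      rw [eq_div_iff hcurv.ne', mul_comm]
    filter_upwards [hnull] with y hy u hu
    refine Tendsto.congr' ?_ (hl _ hy _ (tendsto_powerSum_second (p := p) hu))
    filter_upwards [eventually_ne_atTop 0] with N hN
    have : (N : ℝ) ≠ 0 := by positivity
    rw [inv_mul_cancel_left₀ this, add_sub_cancel]

/-! ### The structure of the global maximizers -/

theorem continuous_negFreeEnergy (p : ℕ) {q : ℕ} [NeZero q] (β h : ℝ) :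
    Continuous (negFreeEnergy p q β h) := by
  have hlog : Continuous fun t : Fin q → ℝ => ∑ r, t r * Real.log (t r) :=
    continuous_finsetSum _ fun r _ => Real.continuous_mul_log.comp (continuous_apply r)
  have hpow : Continuous fun t : Fin q → ℝ => β * ∑ r, t r ^ p + h * t 0 := by fun_prop
  exact hpow.sub hlog

theorem negFreeEnergy_comp_perm {p q : ℕ} [NeZero q] {β h : ℝ} {σ : Equiv.Perm (Fin q)}
    (hσ : h = 0 ∨ σ = 1) (t : Fin q → ℝ) :
    negFreeEnergy p q β h (t ∘ σ) = negFreeEnergy p q β h t := by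
  rcases hσ with rfl | rfl
  · rw [negFreeEnergy_eq_sum, negFreeEnergy_eq_sum, zero_mul, zero_mul]
    congr 1
    exact Equiv.sum_comp σ fun r => kFun p β (t r)
  · rfl

theorem comp_perm_mem_stdSimplex {q : ℕ} {t : Fin q → ℝ} (ht : t ∈ stdSimplex ℝ (Fin q))
    (σ : Equiv.Perm (Fin q)) : t ∘ σ ∈ stdSimplex ℝ (Fin q) :=
  ⟨fun r => ht.1 (σ r), (Equiv.sum_comp σ t).trans ht.2⟩

theorem maximizers_iff {p q : ℕ} [NeZero q] {β h : ℝ} {m : Fin q → ℝ} :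
    m ∈ maximizers p q β h ↔ m ∈ stdSimplex ℝ (Fin q) ∧
      ∀ t ∈ stdSimplex ℝ (Fin q), negFreeEnergy p q β h t ≤ negFreeEnergy p q β h m :=
  Iff.rfl

theorem comp_perm_mem_maximizers {p q : ℕ} [NeZero q] {β h : ℝ} {m : Fin q → ℝ}
    (hm : m ∈ maximizers p q β h) {σ : Equiv.Perm (Fin q)} (hσ : h = 0 ∨ σ = 1) :
    m ∘ σ ∈ maximizers p q β h := by
  rw [maximizers_iff] at hm ⊢
  refine ⟨comp_perm_mem_stdSimplex hm.1 σ, fun t ht => ?_⟩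
  rw [negFreeEnergy_comp_perm hσ]
  exact hm.2 t ht

/-- Transfer of mass `x` from coordinate `j` to coordinate `i`. -/
def transfer {q : ℕ} (m : Fin q → ℝ) (i j : Fin q) (x : ℝ) (r : Fin q) : ℝ :=
  m r + (if r = i then x else 0) - (if r = j then x else 0)

theorem transfer_mem_stdSimplex {q : ℕ} {m : Fin q → ℝ} (hm : m ∈ stdSimplex ℝ (Fin q))
    {i j : Fin q} (hij : i ≠ j) {x : ℝ} (hi : 0 ≤ m i + x) (hj : 0 ≤ m j - x) :
    transfer m i j x ∈ stdSimplex ℝ (Fin q) := by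
  refine ⟨fun r => ?_, ?_⟩
  · unfold transfer
    by_cases h1 : r = i
    · subst h1; simpa [hij] using hi
    · by_cases h2 : r = j
      · subst h2; simpa [h1] using hj
      · simpa [h1, h2] using hm.1 r
  · simp [transfer, Finset.sum_sub_distrib, Finset.sum_add_distrib, hm.2]

theorem negFreeEnergy_transfer {p q : ℕ} [NeZero q] {β h : ℝ} (m : Fin q → ℝ) {i j : Fin q}
    (hij : i ≠ j) (x : ℝ) :
    negFreeEnergy p q β h (transfer m i j x) = negFreeEnergy p q β h m +
      (kFun p β (m i + x) - kFun p β (m i)) + (kFun p β (m j - x) - kFun p β (m j)) +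
      h * ((if 0 = i then x else 0) - (if 0 = j then x else 0)) := by
  have h1 : ∀ r, kFun p β (transfer m i j x r) = kFun p β (m r) +
      (if r = i then kFun p β (m i + x) - kFun p β (m i) else 0) +
      (if r = j then kFun p β (m j - x) - kFun p β (m j) else 0) := fun r => by
    unfold transfer
    by_cases h1 : r = i
    · subst h1; simp [hij]
    · by_cases h2 : r = j
      · subst h2; simp [h1]
      · simp [h1, h2]
  rw [negFreeEnergy_eq_sum, negFreeEnergy_eq_sum]
  simp only [h1, Finset.sum_add_distrib, Finset.sum_ite_eq', Finset.mem_univ, if_true]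
  rw [transfer]
  ring

theorem kFun_zero {p : ℕ} (hp : 2 ≤ p) (β : ℝ) : kFun p β 0 = 0 := by
  rw [kFun, zero_pow (by omega), mul_zero, zero_mul, sub_zero]

/-- Moving a mass x from a positive coordinate to an empty one gains -x log x, which for small x
exceeds the loss, linear in x, at the other coordinate and in the field. -/
theorem maximizer_pos {p q : ℕ} (hp : 2 ≤ p) [NeZero q] {β h : ℝ} (hβ : 0 < β)
    {m : Fin q → ℝ} (hm : m ∈ maximizers p q β h) (i : Fin q) : 0 < m i := by
  rw [maximizers_iff] at hm
  refine (hm.1.1 i).lt_of_ne' fun hi => ?_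
  obtain ⟨j, hj⟩ : ∃ j, 0 < m j := by
    by_contra hall
    push Not at hall
    have := hm.1.2
    rw [Finset.sum_eq_zero fun r _ => le_antisymm (hall r) (hm.1.1 r)] at this
    norm_num at this
  have hij : i ≠ j := by rintro rfl; rw [hi] at hj; exact lt_irrefl _ hj
  have hd := ((hasDerivAt_kFun p β hj.ne').comp_of_eq (0 : ℝ) ((hasDerivAt_id (0 : ℝ)).const_sub (m j))
    (by simp))
  have hslope := hd.tendsto_slope_zero_right
  have hlog : Tendsto (fun x : ℝ => -Real.log x) (𝓝[>] 0) atTop :=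
    tendsto_neg_atBot_atTop.comp Real.tendsto_log_nhdsGT_zero
  have hsum := hlog.atTop_add hslope
  have hev := (hsum.eventually (eventually_gt_atTop |h|)).and
    (Ioo_mem_nhdsGT hj : Set.Ioo 0 (m j) ∈ 𝓝[>] (0 : ℝ))
  obtain ⟨x, hx, hx0, hx1⟩ := hev.exists
  have hmax := hm.2 _ (transfer_mem_stdSimplex hm.1 hij (x := x) (by linarith [hm.1.1 i])
    (by linarith))
  rw [negFreeEnergy_transfer m hij, hi, kFun_zero hp, zero_add, sub_zero] at hmax
  simp only [Function.comp, zero_add, id, sub_zero, smul_eq_mul] at hx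
  have h1 : kFun p β x = β * x ^ p - x * Real.log x := rfl
  have h2 : 0 ≤ β * x ^ p := by positivity
  have h3 : x * (-Real.log x + x⁻¹ * (kFun p β (m j - x) - kFun p β (m j))) =
      -(x * Real.log x) + (kFun p β (m j - x) - kFun p β (m j)) := by
    field_simp
  have h4 := mul_lt_mul_of_pos_left hx hx0
  rw [h3] at h4
  have h5 : -(x * |h|) ≤ h * ((if 0 = i then x else 0) - (if 0 = j then x else 0)) := by
    have := neg_abs_le (h * ((if 0 = i then x else 0) - (if 0 = j then x else 0)))
    rw [abs_mul] at this
    have h6 : |(if 0 = i then x else 0) - (if 0 = j then x else 0)| ≤ x := by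
      split_ifs <;> simp [abs_of_pos hx0, hx0.le]
    nlinarith [abs_nonneg h]
  linarith

/-- The Lagrange condition, obtained without multipliers by differentiating along the transfer of
mass between two coordinates. -/
theorem maximizer_stationary {p q : ℕ} (hp : 2 ≤ p) [NeZero q] {β h : ℝ} (hβ : 0 < β)
    {m : Fin q → ℝ} (hm : m ∈ maximizers p q β h) {i j : Fin q} (hij : i ≠ j) :
    kDeriv p β (m i) + (if 0 = i then h else 0) = kDeriv p β (m j) + (if 0 = j then h else 0) := by
  have hi := maximizer_pos hp hβ hm i
  have hj := maximizer_pos hp hβ hm j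
  rw [maximizers_iff] at hm
  have hd := ((((hasDerivAt_kFun p β hi.ne').comp_of_eq (0 : ℝ)
    ((hasDerivAt_id (0 : ℝ)).const_add (m i)) (by simp)).add
    ((hasDerivAt_kFun p β hj.ne').comp_of_eq (0 : ℝ)
      ((hasDerivAt_id (0 : ℝ)).const_sub (m j)) (by simp))).add
    ((hasDerivAt_id (0 : ℝ)).const_mul
      (h * ((if 0 = i then 1 else 0) - (if 0 = j then 1 else 0)))))
  have hloc : IsLocalMax (fun x : ℝ => kFun p β (m i + x) + kFun p β (m j - x) +
      (h * ((if 0 = i then 1 else 0) - (if 0 = j then 1 else 0))) * x) 0 := by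
    have : Set.Ioo (-(m i)) (m j) ∈ 𝓝 (0 : ℝ) := Ioo_mem_nhds (by linarith) hj
    filter_upwards [this] with x hx
    have hmax := hm.2 _ (transfer_mem_stdSimplex hm.1 hij (x := x) (by linarith [hx.1])
      (by linarith [hx.2]))
    rw [negFreeEnergy_transfer m hij] at hmax
    have e : h * ((if 0 = i then x else 0) - (if 0 = j then x else 0)) =
      (h * ((if 0 = i then 1 else 0) - (if 0 = j then 1 else 0))) * x := by
      split_ifs <;> ring
    simp only [add_zero, sub_zero, mul_zero]
    linarith
  have h0 := hloc.hasDerivAt_eq_zero hd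
  have e : ∀ k : Fin q, (if 0 = k then h else 0) = h * (if 0 = k then 1 else 0) := fun k => by simp
  rw [e, e]
  linarith

theorem kDeriv2_eq {p : ℕ} (hp : 2 ≤ p) (β : ℝ) {x : ℝ} (hx : 0 < x) :
    kDeriv2 p β x = (β * p * (p - 1) * x ^ (p - 1) - 1) / x := by
  have : x ^ (p - 1) = x ^ (p - 2) * x := by rw [← pow_succ]; congr 1; omega
  rw [kDeriv2, this]
  field_simp

/-- The product x k''(x) = βp(p-1)x^(p-1) - 1 increases with x, so negativity of k'' passes to
smaller arguments. -/
theorem kDeriv2_neg_of_le {p : ℕ} (hp : 2 ≤ p) {β : ℝ} (hβ : 0 < β) {x y : ℝ} (hx : 0 < x)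
    (hxy : x ≤ y) (hy : kDeriv2 p β y < 0) : kDeriv2 p β x < 0 := by
  have hp1 : (1 : ℝ) ≤ p := by exact_mod_cast (by omega : 1 ≤ p)
  rw [kDeriv2_eq hp β (hx.trans_le hxy), div_lt_iff₀ (hx.trans_le hxy), zero_mul] at hy
  rw [kDeriv2_eq hp β hx, div_lt_iff₀ hx, zero_mul]
  have h1 := pow_le_pow_left₀ hx.le hxy (p - 1)
  have h2 : 0 ≤ β * p * (p - 1) := mul_nonneg (by positivity) (by linarith)
  have := mul_le_mul_of_nonneg_left h1 h2
  linarith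

theorem kDeriv_lt_of_lt {p : ℕ} (hp : 2 ≤ p) {β : ℝ} (hβ : 0 < β) {x y : ℝ} (hx : 0 < x)
    (hxy : x < y) (hy : kDeriv2 p β y < 0) : kDeriv p β y < kDeriv p β x := by
  have hanti : StrictAntiOn (kDeriv p β) (Set.Icc x y) := by
    refine strictAntiOn_of_deriv_neg (convex_Icc x y) ?_ fun z hz => ?_
    · intro z hz
      exact (hasDerivAt_kDeriv hp β (hx.trans_le hz.1).ne').continuousAt.continuousWithinAt
    · rw [interior_Icc] at hz
      rw [(hasDerivAt_kDeriv hp β (hx.trans hz.1).ne').deriv]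
      exact kDeriv2_neg_of_le hp hβ (hx.trans hz.1) hz.2.le hy
  exact hanti (Set.left_mem_Icc.2 hxy.le) (Set.right_mem_Icc.2 hxy.le) hxy

/-- The quadratic form is tested on the difference of two basis vectors. -/
theorem kDeriv2_add_neg {p q : ℕ} [NeZero q] {β h : ℝ} (hcrit : IsCritical p q β h)
    {m : Fin q → ℝ} (hm : m ∈ maximizers p q β h) {i j : Fin q} (hij : i ≠ j) :
    kDeriv2 p β (m i) + kDeriv2 p β (m j) < 0 := by
  have h1 := hcrit.2 m hm (Pi.single i 1 - Pi.single j 1) (by simp [Finset.sum_sub_distrib])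
    (fun h0 => by
      have := congrFun h0 i
      simp [hij] at this)
  have h2 : quadForm p q β m (Pi.single i 1 - Pi.single j 1) =
      kDeriv2 p β (m i) + kDeriv2 p β (m j) := by
    have : ∀ r, kDeriv2 p β (m r) * (Pi.single i 1 - Pi.single j 1 : Fin q → ℝ) r ^ 2 =
        (if r = i then kDeriv2 p β (m i) else 0) + (if r = j then kDeriv2 p β (m j) else 0) :=
      fun r => by
        simp only [Pi.sub_apply, Pi.single_apply]
        by_cases hri : r = i
        · subst hri; simp [hij]
        · by_cases hrj : r = j
          · subst hrj; simp [hij.symm]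
          · simp [hri, hrj]
    change ∑ r, kDeriv2 p β (m r) * (Pi.single i 1 - Pi.single j 1 : Fin q → ℝ) r ^ 2 = _
    rw [Finset.sum_congr rfl fun r _ => this r]
    simp [Finset.sum_add_distrib]
  linarith

theorem maximizer_zero_ge {p q : ℕ} [NeZero q] {β h : ℝ} (hh : 0 < h) {m : Fin q → ℝ}
    (hm : m ∈ maximizers p q β h) (r : Fin q) : m r ≤ m 0 := by
  have h1 := hm.2 (comp_perm_mem_stdSimplex hm.1 (Equiv.swap 0 r))
  simp only [Set.mem_ofPred_eq] at h1
  rw [negFreeEnergy_eq_sum, negFreeEnergy_eq_sum] at h1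
  have h2 : ∑ k, kFun p β ((m ∘ Equiv.swap 0 r) k) = ∑ k, kFun p β (m k) :=
    Equiv.sum_comp (Equiv.swap 0 r) fun k => kFun p β (m k)
  rw [h2] at h1
  simp only [Function.comp, Equiv.swap_apply_left] at h1
  nlinarith

/-- Let j be a largest coordinate, which can be taken to be 0 when h > 0. Of any two coordinates at
least one has k'' < 0, and negativity passes to smaller arguments, so k'' < 0 at every coordinate
other than j. On that range k' is strictly decreasing, and the stationarity equations force these
coordinates to be equal. -/
theorem exists_xvec_of_mem_maximizers {p : ℕ} (hp : 2 ≤ p) {d : ℕ} (hd : d ≠ 0) {β h : ℝ}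
    (hβ : 0 < β) (hh : 0 ≤ h) (hcrit : IsCritical p (d + 1) β h) {m : Fin (d + 1) → ℝ}
    (hm : m ∈ maximizers p (d + 1) β h) :
    ∃ s j, 0 ≤ s ∧ s < 1 ∧ (h = 0 ∨ j = 0) ∧ m = xvec (d + 1) s ∘ Equiv.swap 0 j ∧
      kDeriv2 p β (bCoord d s) < 0 := by
  have hpos := maximizer_pos hp hβ hm
  obtain ⟨j, hj, hj0⟩ : ∃ j, (∀ r, m r ≤ m j) ∧ (h = 0 ∨ j = 0) := by
    rcases hh.eq_or_lt with h0 | h0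
    · obtain ⟨j, -, hj⟩ := Finset.exists_max_image Finset.univ m Finset.univ_nonempty
      exact ⟨j, fun r => hj r (Finset.mem_univ r), Or.inl h0.symm⟩
    · exact ⟨0, maximizer_zero_ge h0 hm, Or.inr rfl⟩
  have hneg : ∀ r, r ≠ j → kDeriv2 p β (m r) < 0 := fun r hr => by
    have h1 := kDeriv2_add_neg hcrit hm hr
    by_contra h2
    push Not at h2
    have h3 : kDeriv2 p β (m j) < 0 := by linarith
    exact absurd (kDeriv2_neg_of_le hp hβ (hpos r) (hj r) h3) (not_lt.2 h2)
  have heq : ∀ r r', r ≠ j → r' ≠ j → m r = m r' := by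
    have haux : ∀ r r', r ≠ j → r' ≠ j → ¬ m r < m r' := fun r r' hr hr' hlt => by
      have h1 := kDeriv_lt_of_lt hp hβ (hpos r) hlt (hneg r' hr')
      have h2 := maximizer_stationary hp hβ hm (i := r) (j := r') (by rintro rfl; exact lt_irrefl _ hlt)
      have h3 : ∀ k, k ≠ j → (if 0 = k then h else 0) = 0 := fun k hk => by
        rcases hj0 with h0 | h0
        · simp [h0]
        · rw [if_neg]; rintro rfl; exact hk h0.symm
      rw [h3 r hr, h3 r' hr'] at h2
      linarith
    exact fun r r' hr hr' => le_antisymm (not_lt.1 (haux r' r hr' hr)) (not_lt.1 (haux r r' hr hr'))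
  obtain ⟨k, hk⟩ : ∃ k : Fin (d + 1), k ≠ j := by
    have : Nontrivial (Fin (d + 1)) := Fin.nontrivial_iff_two_le.2 (by omega)
    exact exists_ne j
  have hall : ∀ r, r ≠ j → m r = m k := fun r hr => heq r k hr hk
  have hsum : m j + d * m k = 1 := by
    have h1 := hm.1.2
    rw [← Finset.add_sum_erase _ _ (Finset.mem_univ j),
      Finset.sum_congr rfl fun r hr => hall r (Finset.ne_of_mem_erase hr)] at h1
    simpa using h1
  have hb : bCoord d (1 - (d + 1) * m k) = m k := by rw [bCoord]; field_simp; ring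
  have ha : aCoord d (1 - (d + 1) * m k) = m j := by
    have := aCoord_add d (1 - (d + 1) * m k)
    rw [hb] at this
    linarith
  refine ⟨1 - (d + 1) * m k, j, ?_, ?_, hj0, ?_, ?_⟩
  · have := hj k; linarith
  · have := hpos k
    have : 0 < (d + 1 : ℝ) * m k := by positivity
    linarith
  · funext r
    simp only [Function.comp]
    by_cases hr : r = j
    · subst hr
      rw [Equiv.swap_apply_right, xvec_zero_eq, ha]
    · have hne : Equiv.swap 0 j r ≠ 0 := fun h0 => hr (by
        rw [Equiv.swap_apply_eq_iff, Equiv.swap_apply_left] at h0; exact h0)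
      obtain ⟨i, hi⟩ := Fin.exists_succ_eq.2 hne
      rw [← hi, xvec_succ_eq, hb, hall r hr]
  · rw [hb]; exact hneg k hk

/-- The last condition comes from testing the quadratic form on (-d, 1, …, 1), where it equals d(B +
dA), with A and B the second derivatives of k at the two coordinate values. -/
theorem nondegenerateAt_of_mem_maximizers {p : ℕ} (hp : 2 ≤ p) {d : ℕ} (hd : d ≠ 0) {β h s : ℝ}
    (hβ : 0 < β) (hcrit : IsCritical p (d + 1) β h)
    (hs : 0 ≤ s) (hs1 : s < 1) (hm : xvec (d + 1) s ∈ maximizers p (d + 1) β h)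
    (hb : kDeriv2 p β (bCoord d s) < 0) : NondegenerateAt p d β h s := by
  obtain ⟨k, rfl⟩ := Nat.exists_eq_succ_of_ne_zero hd
  refine ⟨hs, hs1, ?_, hb, ?_⟩
  · have := maximizer_stationary hp hβ hm (i := 0) (j := Fin.succ 0) (Fin.succ_ne_zero _).symm
    rw [xvec_zero_eq, xvec_succ_eq, if_pos rfl, if_neg (Fin.succ_ne_zero _).symm] at this
    rw [gradFun]
    linarith
  · have h1 := hcrit.2 _ hm (hyper fun _ => 1) (sum_hyper _) (fun h0 => by
      have := congrFun h0 (Fin.succ 0)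
      simp [hyper] at this)
    change ∑ r, kDeriv2 p β (xvec (k + 1 + 1) s r) * hyper (fun _ => 1) r ^ 2 < 0 at h1
    rw [sum_kDeriv2_hyper] at h1
    simp only [Finset.sum_const, Finset.card_univ, Fintype.card_fin, nsmul_eq_mul, mul_one,
      one_pow] at h1
    have hk : (0 : ℝ) < ((k + 1 : ℕ) : ℝ) := by positivity
    have : ((k + 1 : ℕ) : ℝ) * (kDeriv2 p β (bCoord (k + 1) s) +
        ((k + 1 : ℕ) : ℝ) * kDeriv2 p β (aCoord (k + 1) s)) < 0 := by linarith
    exact (pos_iff_neg_of_mul_neg this).1 hk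

/-! ### Counting the critical points of `f` -/

theorem exists_deriv_zero {f f' : ℝ → ℝ} {a b : ℝ} (hab : a < b)
    (hf : ∀ x ∈ Set.Icc a b, HasDerivAt f (f' x) x) (h : f a = f b) :
    ∃ c ∈ Set.Ioo a b, f' c = 0 :=
  exists_hasDerivAt_eq_zero hab (fun x hx => (hf x hx).continuousAt.continuousWithinAt) h
    fun x hx => hf x (Set.Ioo_subset_Icc_self hx)

/-- The polynomial in the ratio `u = b / a` whose zeros are the critical points of
`d a ^ (p - 1) b + a b ^ (p - 1)`. -/
def ratioPoly (n d : ℕ) (u : ℝ) : ℝ :=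
  d - d ^ 2 * (n + 1) * u - d * u ^ (n + 1) + (n + 1) * u ^ n

theorem hasDerivAt_ratioPoly (n d : ℕ) (u : ℝ) : HasDerivAt (ratioPoly (n + 1) d)
    ((n + 2) * ((n + 1) * u ^ n - d ^ 2 - d * u ^ (n + 1))) u := by
  have h := (((hasDerivAt_id u).const_mul ((d : ℝ) ^ 2 * ((n + 1 : ℕ) + 1))).const_sub (d : ℝ)).sub
    ((hasDerivAt_pow (n + 1 + 1) u).const_mul (d : ℝ)) |>.add
    ((hasDerivAt_pow (n + 1) u).const_mul (((n + 1 : ℕ) : ℝ) + 1))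
  refine h.congr_deriv ?_
  push_cast
  ring_nf

/-- For positive exponent, two zeros give by Rolle a point c between them with (n+1)cⁿ > d² ≥ 4. But
a zero at y < 1 forces (n+2)y ≤ d/(d²-1) ≤ 2/3, and then (n+1)cⁿ ≤ 1. For exponent 0 the polynomial
is affine. -/
theorem ratioPoly_ne_zero_of_two_le {n d : ℕ} (hd : 2 ≤ d) {x y : ℝ} (hx : 0 < x) (hxy : x < y)
    (hy : y < 1) (h1 : ratioPoly n d x = 0) : ratioPoly n d y ≠ 0 := by
  intro h2
  have hd' : (2 : ℝ) ≤ d := by exact_mod_cast hd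
  rcases n with _ | n
  · simp only [ratioPoly, CharP.cast_eq_zero, zero_add, pow_zero, mul_one, pow_one] at h1 h2
    have : ((d : ℝ) ^ 2 + d) * (y - x) = 0 := by linarith
    have h3 : 0 < ((d : ℝ) ^ 2 + d) * (y - x) := mul_pos (by positivity) (by linarith)
    linarith
  · obtain ⟨c, hc, h3⟩ := exists_deriv_zero hxy (fun u _ => hasDerivAt_ratioPoly n d u)
      (h1.trans h2.symm)
    have hc0 : 0 < c := hx.trans hc.1
    have hy0 : 0 < y := hx.trans hxy
    have hn : (0 : ℝ) ≤ n := n.cast_nonneg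
    have h4 : ((n : ℝ) + 1) * c ^ n = d ^ 2 + d * c ^ (n + 1) := by
      have : ((n : ℝ) + 2) ≠ 0 := by positivity
      have := (mul_eq_zero.1 h3).resolve_left this
      linarith
    have h5 : 0 < (d : ℝ) * c ^ (n + 1) := by positivity
    have h6 : ((n : ℝ) + 2) * y * (d ^ 2 - 1) ≤ d := by
      simp only [ratioPoly, pow_succ, Nat.cast_add, Nat.cast_one] at h2
      have h7 : y ^ n ≤ 1 := pow_le_one₀ hy0.le hy.le
      have h8 : 0 ≤ (d : ℝ) * (y ^ n * y * y) := by positivity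
      have h9 : ((n : ℝ) + 2) * y * y ^ n ≤ ((n : ℝ) + 2) * y * 1 :=
        mul_le_mul_of_nonneg_left h7 (by positivity)
      nlinarith
    have h7 : ((n : ℝ) + 2) * y ≤ 2 / 3 := by
      have : (0 : ℝ) ≤ (n + 2) * y := by positivity
      by_contra hlt
      push Not at hlt
      have h8 : 3 * (d : ℝ) ≤ 2 * (d ^ 2 - 1) := by nlinarith
      have h9 := mul_lt_mul_of_pos_right hlt (by nlinarith : (0 : ℝ) < d ^ 2 - 1)
      linarith
    have h8 : ((n : ℝ) + 1) * c ^ n ≤ 1 := by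
      rcases n with _ | n
      · simp
      · have : c ^ n ≤ 1 := pow_le_one₀ hc0.le (by linarith [hc.2])
        rw [pow_succ]
        push_cast at h7 ⊢
        have : ((n : ℝ) + 1 + 1) * (c ^ n * c) ≤ ((n : ℝ) + 1 + 1) * (1 * c) := by gcongr
        nlinarith [hc.2]
    nlinarith

/-- For d = 1 the point 1 is a further zero. From exponent 2 on, three zeros yield by Rolle a zero w
< 1 of the second derivative, which is a positive multiple of wⁿ(n + 1 - w) with the shifted index
n. The exponents 0 and 1 give 2 - 2u and 1 - u². -/
theorem ratioPoly_ne_zero_of_one {n : ℕ} {x y : ℝ} (hx : 0 < x) (hxy : x < y)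
    (hy : y < 1) (h1 : ratioPoly n 1 x = 0) : ratioPoly n 1 y ≠ 0 := by
  intro h2
  rcases n with _ | _ | n
  · simp [ratioPoly] at h1
    linarith
  · simp [ratioPoly] at h1
    nlinarith
  · have h3 : ratioPoly (n + 2) 1 1 = 0 := by simp [ratioPoly]
    obtain ⟨c, hc, hc'⟩ := exists_deriv_zero hxy (fun u _ => hasDerivAt_ratioPoly (n + 1) 1 u)
      (h1.trans h2.symm)
    obtain ⟨e, he, he'⟩ := exists_deriv_zero hy (fun u _ => hasDerivAt_ratioPoly (n + 1) 1 u)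
      (h2.trans h3.symm)
    have hder : ∀ u : ℝ, HasDerivAt (fun u : ℝ => (((n + 1 : ℕ) : ℝ) + 2) *
        ((((n + 1 : ℕ) : ℝ) + 1) * u ^ (n + 1) - ((1 : ℕ) : ℝ) ^ 2 - ((1 : ℕ) : ℝ) * u ^ (n + 1 + 1)))
        ((n + 3) * ((n + 2) * u ^ n * (n + 1 - u))) u := fun u => by
      have h := ((((hasDerivAt_pow (n + 1) u).const_mul (((n + 1 : ℕ) : ℝ) + 1)).sub_const
        (((1 : ℕ) : ℝ) ^ 2)).sub ((hasDerivAt_pow (n + 1 + 1) u).const_mul ((1 : ℕ) : ℝ))).const_mul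
          (((n + 1 : ℕ) : ℝ) + 2)
      refine h.congr_deriv ?_
      simp only [Nat.add_sub_cancel]
      push_cast
      ring
    obtain ⟨w, hw, hw'⟩ := exists_deriv_zero (hc.2.trans he.1) (fun u _ => hder u)
      (hc'.trans he'.symm)
    have hw0 : 0 < w := hx.trans (hc.1.trans hw.1)
    have hw1 : w < 1 := hw.2.trans he.2
    have hn : (0 : ℝ) ≤ n := n.cast_nonneg
    have : 0 < ((n : ℝ) + 3) * ((n + 2) * w ^ n * (n + 1 - w)) := by
      have : 0 < (n : ℝ) + 1 - w := by linarith
      positivity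
    linarith

theorem ratioPoly_zero_unique {n d : ℕ} (hd : d ≠ 0) {x y : ℝ} (hx : 0 < x) (hxy : x < y)
    (hy : y < 1) (h1 : ratioPoly n d x = 0) : ratioPoly n d y ≠ 0 := by
  rcases (by omega : d = 1 ∨ 2 ≤ d) with rfl | hd2
  · exact ratioPoly_ne_zero_of_one hx hxy hy h1
  · exact ratioPoly_ne_zero_of_two_le hd2 hx hxy hy h1

theorem hasDerivAt_crossTerm (n d : ℕ) {s : ℝ} (hs : 0 ≤ s) :
    HasDerivAt (fun s => d * aCoord d s ^ (n + 1) * bCoord d s + aCoord d s * bCoord d s ^ (n + 1))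
      (-(aCoord d s ^ (n + 1) * ratioPoly n d (bCoord d s / aCoord d s) / (d + 1))) s := by
  have ha := hasDerivAt_aCoord d s
  have hb := hasDerivAt_bCoord d s
  have h := (((ha.pow (n + 1)).const_mul (d : ℝ)).mul hb).add (ha.mul (hb.pow (n + 1)))
  refine h.congr_deriv ?_
  have ha0 := (aCoord_pos (d := d) hs).ne'
  rw [ratioPoly, div_pow, div_pow]
  simp only [Nat.add_sub_cancel, pow_succ]
  push_cast
  have e1 : ∀ k, (aCoord d ^ k) s = aCoord d s ^ k := fun k => rfl
  have e2 : ∀ k, (bCoord d ^ k) s = bCoord d s ^ k := fun k => rfl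
  rw [← pow_succ, ← pow_succ, e1, e2]
  field_simp
  ring

/-- Zeros of the derivative of `gradFun` thereby become points of one level set of the cross term d
a^(p-1) b + a b^(p-1), a level that does not depend on s. -/
theorem gradFun_deriv_eq {n d : ℕ} {β s : ℝ} (hs : 0 ≤ s) (hs1 : s < 1) :
    d / (d + 1) * kDeriv2 (n + 2) β (aCoord d s) + 1 / (d + 1) * kDeriv2 (n + 2) β (bCoord d s) =
      (β * (n + 2) * (n + 1) * (d * aCoord d s ^ (n + 1) * bCoord d s +
        aCoord d s * bCoord d s ^ (n + 1)) - 1) / ((d + 1) * (aCoord d s * bCoord d s)) := by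
  have ha0 := (aCoord_pos (d := d) hs).ne'
  have hb0 := (bCoord_pos (d := d) hs1).ne'
  have hab := aCoord_add d s
  rw [kDeriv2, kDeriv2]
  simp only [Nat.add_sub_cancel, pow_succ]
  push_cast
  field_simp
  linear_combination -hab

/-- The stationarity equation has at most three solutions. -/
theorem gradFun_not_four_zeros {p : ℕ} (hp : 2 ≤ p) {d : ℕ} (hd : d ≠ 0) {β h : ℝ} (hβ : 0 < β)
    {w x y z : ℝ} (hw : 0 ≤ w) (hwx : w < x) (hxy : x < y) (hyz : y < z) (hz : z < 1)
    (h1 : gradFun p d β h w = 0) (h2 : gradFun p d β h x = 0) (h3 : gradFun p d β h y = 0) :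
    gradFun p d β h z ≠ 0 := by
  intro h4
  obtain ⟨n, rfl⟩ := Nat.exists_eq_add_of_le' hp
  have hder : ∀ s, w ≤ s → s ≤ z → HasDerivAt (gradFun (n + 2) d β h) _ s := fun s hs hs1 =>
    (hasDerivAt_gradFun hp d β h (aCoord_pos (d := d) (hw.trans hs)).ne'
      (bCoord_pos (d := d) (hs1.trans_lt hz)).ne').congr_deriv
      (gradFun_deriv_eq (hw.trans hs) (hs1.trans_lt hz))
  have hcross : ∀ s, w ≤ s → s ≤ z → (β * ((n : ℝ) + 2) * (n + 1) * (d * aCoord d s ^ (n + 1) * bCoord d s +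
        aCoord d s * bCoord d s ^ (n + 1)) - 1) / ((d + 1) * (aCoord d s * bCoord d s)) = 0 →
      d * aCoord d s ^ (n + 1) * bCoord d s + aCoord d s * bCoord d s ^ (n + 1) =
        1 / (β * (n + 2) * (n + 1)) := fun s hs hs1 h0 => by
    have ha := aCoord_pos (d := d) (hw.trans hs)
    have hb := bCoord_pos (d := d) (hs1.trans_lt hz)
    rw [div_eq_zero_iff, or_iff_left (by positivity)] at h0
    rw [eq_div_iff (by positivity)]
    linarith
  -- Four zeros give three zeros of the derivative, hence three points with equal cross term, hence
  -- two critical points of the cross term, hence two zeros of `ratioPoly` in (0, 1).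
  obtain ⟨c1, hc1, e1⟩ := exists_deriv_zero hwx
    (fun s hs => hder s hs.1 (by linarith [hs.2])) (h1.trans h2.symm)
  obtain ⟨c2, hc2, e2⟩ := exists_deriv_zero hxy
    (fun s hs => hder s (by linarith [hs.1]) (by linarith [hs.2])) (h2.trans h3.symm)
  obtain ⟨c3, hc3, e3⟩ := exists_deriv_zero hyz
    (fun s hs => hder s (by linarith [hs.1]) (by linarith [hs.2])) (h3.trans h4.symm)
  replace e1 := hcross c1 (by linarith [hc1.1]) (by linarith [hc1.2]) e1
  replace e2 := hcross c2 (by linarith [hc2.1]) (by linarith [hc2.2]) e2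
  replace e3 := hcross c3 (by linarith [hc3.1]) (by linarith [hc3.2]) e3
  have hw1 : w < c1 := hc1.1
  have h12 : c1 < c2 := hc1.2.trans hc2.1
  have h23 : c2 < c3 := hc2.2.trans hc3.1
  have h3z : c3 < z := hc3.2
  obtain ⟨t1, ht1, g1⟩ := exists_deriv_zero h12
    (fun s hs => hasDerivAt_crossTerm n d (by linarith [hs.1])) (e1.trans e2.symm)
  obtain ⟨t2, ht2, g2⟩ := exists_deriv_zero h23
    (fun s hs => hasDerivAt_crossTerm n d (by linarith [hs.1])) (e2.trans e3.symm)
  have ht1' := ht1.1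
  have ht12 : t1 < t2 := ht1.2.trans ht2.1
  have ht2' := ht2.2
  have hzero : ∀ t, 0 < t → -(aCoord d t ^ (n + 1) * ratioPoly n d (bCoord d t / aCoord d t) /
      (d + 1)) = 0 → ratioPoly n d (bCoord d t / aCoord d t) = 0 := fun t ht h0 => by
    have ha := aCoord_pos (d := d) ht.le
    rw [neg_eq_zero, div_eq_zero_iff, or_iff_left (by positivity)] at h0
    exact (mul_eq_zero.1 h0).resolve_left (by positivity)
  have ha1 := aCoord_pos (d := d) (s := t1) (by linarith)
  have ha2 := aCoord_pos (d := d) (s := t2) (by linarith)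
  have hb1 := bCoord_pos (d := d) (s := t1) (by linarith)
  have hb2 := bCoord_pos (d := d) (s := t2) (by linarith)
  have hab : ∀ t, aCoord d t - bCoord d t = t := aCoord_sub_bCoord d
  have hba : bCoord d t2 < bCoord d t1 := by
    unfold bCoord
    exact div_lt_div_of_pos_right (by linarith) (by positivity)
  -- The ratio b/a decreases in s, so the larger parameter gives the smaller ratio.
  refine ratioPoly_zero_unique hd (x := bCoord d t2 / aCoord d t2)
    (y := bCoord d t1 / aCoord d t1) (div_pos hb2 ha2) ?_ ?_ (hzero t2 (by linarith) g2)
    (hzero t1 (by linarith) g1)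
  · rw [div_lt_div_iff₀ ha2 ha1]
    have := hab t1
    have := hab t2
    nlinarith
  · rw [div_lt_one ha1]
    have := hab t1
    linarith

/-! ### The maximizers of `f` -/

theorem mem_freeFunMaximizers_iff {p d : ℕ} {β h s : ℝ} :
    s ∈ freeFunMaximizers p (d + 1) β h ↔ s ∈ Set.Icc (0 : ℝ) 1 ∧
      ∀ t ∈ Set.Icc (0 : ℝ) 1, freeFun p (d + 1) β h t ≤ freeFun p (d + 1) β h s :=
  Iff.rfl

theorem mem_freeFunMaximizers_of_xvec {p d : ℕ} {β h s : ℝ} (hs : s ∈ Set.Icc (0 : ℝ) 1)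
    (hm : xvec (d + 1) s ∈ maximizers p (d + 1) β h) : s ∈ freeFunMaximizers p (d + 1) β h :=
  mem_freeFunMaximizers_iff.2 ⟨hs, fun _ ht => (maximizers_iff.1 hm).2 _ (xvec_mem_stdSimplex ht)⟩

theorem bCoord_strictAnti (d : ℕ) : StrictAnti (bCoord d) := fun s t hst => by
  unfold bCoord
  exact div_lt_div_of_pos_right (by linarith) (by positivity)

theorem xvec_injective {d : ℕ} (hd : d ≠ 0) : Function.Injective (xvec (d + 1)) := fun s t h => by
  obtain ⟨k, rfl⟩ := Nat.exists_eq_succ_of_ne_zero hd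
  have := congrFun h (Fin.succ 0)
  rw [xvec_succ_eq, xvec_succ_eq] at this
  exact (bCoord_strictAnti _).injective this

theorem powerSum_xvec (p d : ℕ) (s : ℝ) :
    powerSum p (xvec (d + 1) s) = aCoord d s ^ p + d * bCoord d s ^ p := by
  rw [powerSum, Fin.sum_univ_succ, xvec_zero_eq]
  simp [xvec_succ_eq]

theorem powerSum_xvec_strictMonoOn {p : ℕ} (hp : 2 ≤ p) {d : ℕ} (hd : d ≠ 0) :
    StrictMonoOn (fun s => powerSum p (xvec (d + 1) s)) (Set.Icc 0 1) := by
  have hder : ∀ s, HasDerivAt (fun s => powerSum p (xvec (d + 1) s))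
      (-(d / (d + 1) * slope p d s)) s := fun s => by
    have h := ((hasDerivAt_aCoord d s).pow p).add (((hasDerivAt_bCoord d s).pow p).const_mul (d : ℝ))
    have e : (fun s => powerSum p (xvec (d + 1) s)) =
        aCoord d ^ p + fun s => d * (bCoord d ^ p) s := funext (powerSum_xvec p d)
    rw [e]
    refine h.congr_deriv ?_
    rw [slope]
    ring
  refine strictMonoOn_of_deriv_pos (convex_Icc 0 1)
    (fun s _ => (hder s).continuousAt.continuousWithinAt) fun s hs => ?_
  rw [interior_Icc] at hs
  rw [(hder s).deriv]
  have h1 := slope_ne_zero (d := d) hp hs.1 hs.2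
  have h2 : (0 : ℝ) < d / (d + 1) := by
    have : (0 : ℝ) < d := by positivity
    positivity
  nlinarith

theorem gradFun_zero_param (p d : ℕ) (β h : ℝ) : gradFun p d β h 0 = h := by
  simp [gradFun, aCoord, bCoord]

section Critical

variable {p : ℕ} (hp : 2 ≤ p) {d : ℕ} (hd : d ≠ 0) {β h : ℝ}

include hp hd

/-- The difference f(s) - f(0) is affine in β with slope S(x_s) - S(x₀) > 0. -/
theorem freeFun_transition {s β' : ℝ} (hs : s ∈ Set.Icc (0 : ℝ) 1) (hs0 : 0 < s) (hβ : β < β')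
    (hle : freeFun p (d + 1) β 0 0 ≤ freeFun p (d + 1) β 0 s) :
    freeFun p (d + 1) β' 0 0 < freeFun p (d + 1) β' 0 s := by
  have h1 := powerSum_xvec_strictMonoOn hp hd (Set.left_mem_Icc.2 zero_le_one) hs hs0
  simp only at h1
  rw [freeFun, freeFun, negFreeEnergy_eq, negFreeEnergy_eq] at hle ⊢
  nlinarith

end Critical

section Critical

variable {p : ℕ} (hp : 2 ≤ p) {d : ℕ} (hd : d ≠ 0) {β h : ℝ} (hβ : 0 < β) (hh : 0 ≤ h)
  (hcrit : IsCritical p (d + 1) β h)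

include hp hd hβ hh hcrit

/-- Some maximizer of H is a permutation of a vector x_{s₀}, so the maximum of f on [0, 1] equals
that of H on the simplex. -/
theorem xvec_mem_maximizers {s : ℝ} (hs : s ∈ freeFunMaximizers p (d + 1) β h) :
    xvec (d + 1) s ∈ maximizers p (d + 1) β h := by
  obtain ⟨m, hm, -⟩ := hcrit.1
  obtain ⟨s₀, j, hs0, hs1, hj, rfl, -⟩ := exists_xvec_of_mem_maximizers hp hd hβ hh hcrit hm
  have hσ : h = 0 ∨ Equiv.swap 0 j = 1 := hj.imp_right fun h0 => by rw [h0]; exact Equiv.swap_self 0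
  rw [mem_freeFunMaximizers_iff] at hs
  refine maximizers_iff.2 ⟨xvec_mem_stdSimplex hs.1, fun t ht => ((maximizers_iff.1 hm).2 t ht).trans ?_⟩
  rw [negFreeEnergy_comp_perm hσ]
  exact hs.2 s₀ ⟨hs0, hs1.le⟩

theorem nondegenerateAt_of_mem {s : ℝ} (hs : s ∈ freeFunMaximizers p (d + 1) β h) :
    NondegenerateAt p d β h s := by
  have hm := xvec_mem_maximizers hp hd hβ hh hcrit hs
  obtain ⟨s', j, hs0', hs1', -, he, hb⟩ := exists_xvec_of_mem_maximizers hp hd hβ hh hcrit hm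
  have hs0 := (mem_freeFunMaximizers_iff.1 hs).1.1
  have hss : s = s' := by
    rw [← sParam_xvec hd hs0, ← sParam_xvec hd hs0', he, sParam, sParam]
    congr 2
    exact (Equiv.swap 0 j).iInf_comp (g := xvec (d + 1) s')
  subst hss
  exact nondegenerateAt_of_mem_maximizers hp hd hβ hcrit hs0' hs1' hm hb

theorem exists_perm_of_mem_maximizers {m : Fin (d + 1) → ℝ} (hm : m ∈ maximizers p (d + 1) β h) :
    ∃ s ∈ freeFunMaximizers p (d + 1) β h, ∃ j, (h = 0 ∨ j = 0) ∧
      m = xvec (d + 1) s ∘ Equiv.swap 0 j := by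
  obtain ⟨s, j, hs0, hs1, hj, rfl, -⟩ := exists_xvec_of_mem_maximizers hp hd hβ hh hcrit hm
  refine ⟨s, mem_freeFunMaximizers_of_xvec ⟨hs0, hs1.le⟩ ?_, j, hj, rfl⟩
  have hσ : h = 0 ∨ (Equiv.swap 0 j)⁻¹ = 1 := hj.imp_right fun h0 => by
    rw [h0, Equiv.swap_self]; rfl
  have := comp_perm_mem_maximizers hm hσ
  rw [Function.comp_assoc] at this
  convert this
  ext r
  simp

/-- By nondegeneracy the derivative of f is negative just to the right of s and positive just to the
left of t, so it vanishes in between. -/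
theorem exists_gradFun_zero_between {s t : ℝ} (hs : s ∈ freeFunMaximizers p (d + 1) β h)
    (ht : t ∈ freeFunMaximizers p (d + 1) β h) (hst : s < t) :
    ∃ z, s < z ∧ z < t ∧ gradFun p d β h z = 0 := by
  have Hs := nondegenerateAt_of_mem hp hd hβ hh hcrit hs
  have Ht := nondegenerateAt_of_mem hp hd hβ hh hcrit ht
  have hmain : ∀ {x : ℝ}, NondegenerateAt p d β h x → ∀ᶠ y in 𝓝 x,
      (x < y → gradFun p d β h y < 0) ∧ (y < x → 0 < gradFun p d β h y) := fun {x} Hx => by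
    have hneg : d / (d + 1) * kDeriv2 p β (aCoord d x) + 1 / (d + 1) * kDeriv2 p β (bCoord d x) < 0 := by
      have := Hx.neg_ab
      have h2 : (0 : ℝ) < 1 / (d + 1) := by positivity
      have h3 := mul_neg_of_pos_of_neg h2 this
      have h4 : d / (d + 1) * kDeriv2 p β (aCoord d x) + 1 / (d + 1) * kDeriv2 p β (bCoord d x) =
        1 / (d + 1) * (kDeriv2 p β (bCoord d x) + d * kDeriv2 p β (aCoord d x)) := by ring
      linarith
    have h1 := (hasDerivAt_gradFun hp d β h (aCoord_pos (d := d) Hx.nonneg).ne'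
      (bCoord_pos (d := d) Hx.lt_one).ne').tendsto_slope
    rw [slope_fun_def_field] at h1
    have h2 := eventually_nhdsWithin_iff.1 (h1.eventually (eventually_lt_nhds hneg))
    filter_upwards [h2] with y hy
    rw [Hx.stationary] at hy
    constructor
    · intro hxy
      have := hy hxy.ne'
      rw [sub_zero, div_lt_iff₀ (by linarith), zero_mul] at this
      exact this
    · intro hxy
      have := hy hxy.ne
      rw [sub_zero, div_lt_iff_of_neg (by linarith), zero_mul] at this
      exact this
  have h1 := ((hmain Hs).filter_mono nhdsWithin_le_nhds).and
    (Ioo_mem_nhdsGT hst : Set.Ioo s t ∈ 𝓝[>] s)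
  obtain ⟨x, ⟨hx, -⟩, hsx, hxt⟩ := h1.exists
  have h2 := ((hmain Ht).filter_mono nhdsWithin_le_nhds).and
    (Ioo_mem_nhdsLT hxt : Set.Ioo x t ∈ 𝓝[<] t)
  obtain ⟨y, ⟨-, hy⟩, hxy, hyt⟩ := h2.exists
  have hcont : ContinuousOn (gradFun p d β h) (Set.Icc x y) := fun z hz =>
    (hasDerivAt_gradFun hp d β h (aCoord_pos (d := d) (by linarith [Hs.nonneg, hz.1])).ne'
      (bCoord_pos (d := d) (by linarith [Ht.lt_one, hz.2])).ne').continuousAt.continuousWithinAt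
  obtain ⟨z, hz, hz0⟩ := intermediate_value_Icc hxy.le hcont ⟨(hx hsx).le, (hy hyt).le⟩
  exact ⟨z, by linarith [hz.1], by linarith [hz.2], hz0⟩

/-- The three maximizers and a critical point between the first two would be four zeros of
`gradFun`. -/
theorem not_three_maximizers {s t u : ℝ} (hs : s ∈ freeFunMaximizers p (d + 1) β h)
    (ht : t ∈ freeFunMaximizers p (d + 1) β h) (hu : u ∈ freeFunMaximizers p (d + 1) β h)
    (hst : s < t) (htu : t < u) : False := by
  have Hs := nondegenerateAt_of_mem hp hd hβ hh hcrit hs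
  have Ht := nondegenerateAt_of_mem hp hd hβ hh hcrit ht
  have Hu := nondegenerateAt_of_mem hp hd hβ hh hcrit hu
  obtain ⟨z, hz, hz', hz0⟩ := exists_gradFun_zero_between hp hd hβ hh hcrit hs ht hst
  exact gradFun_not_four_zeros hp hd hβ Hs.nonneg hz hz' htu Hu.lt_one Hs.stationary hz0
    Ht.stationary Hu.stationary

theorem field_eq_zero_of_zero_mem (h0 : 0 ∈ freeFunMaximizers p (d + 1) β h) : h = 0 := by
  have := (nondegenerateAt_of_mem hp hd hβ hh hcrit h0).stationary
  rwa [gradFun_zero_param] at this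

/-- Without field 0 is a critical point of f as well; together with s, t and a point between them
this makes four. -/
theorem field_pos_of_two_positive {s t : ℝ} (hs : s ∈ freeFunMaximizers p (d + 1) β h)
    (ht : t ∈ freeFunMaximizers p (d + 1) β h) (hs0 : 0 < s) (hst : s < t) : 0 < h := by
  refine hh.lt_of_ne' fun h0 => ?_
  have Hs := nondegenerateAt_of_mem hp hd hβ hh hcrit hs
  have Ht := nondegenerateAt_of_mem hp hd hβ hh hcrit ht
  obtain ⟨z, hz, hz', hz0⟩ := exists_gradFun_zero_between hp hd hβ hh hcrit hs ht hst
  refine gradFun_not_four_zeros hp hd hβ le_rfl hs0 hz hz' Ht.lt_one ?_ Hs.stationary hz0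
    Ht.stationary
  rw [gradFun_zero_param, h0]

/-- If 0 were the only maximizer of f, the uniform vector would be the only maximizer of H, against
criticality. -/
theorem exists_pos_mem :
    ∃ s ∈ freeFunMaximizers p (d + 1) β h, 0 < s := by
  by_contra hcon
  push Not at hcon
  have hzero : ∀ s ∈ freeFunMaximizers p (d + 1) β h, s = 0 := fun s hs =>
    le_antisymm (hcon s hs) (mem_freeFunMaximizers_iff.1 hs).1.1
  obtain ⟨m, hm, m', hm', hne⟩ := hcrit.1
  refine hne ?_
  have hconst : ∀ m ∈ maximizers p (d + 1) β h, m = xvec (d + 1) 0 := fun m hm => by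
    obtain ⟨s, hs, j, -, rfl⟩ := exists_perm_of_mem_maximizers hp hd hβ hh hcrit hm
    rw [hzero s hs]
    ext r
    simp [xvec]
  rw [hconst m hm, hconst m' hm']

/-- Here β belongs to the set whose infimum is β_c. No smaller b does, since by `freeFun_transition`
a positive maximizer at b would beat 0 strictly at β. -/
theorem eq_betaC_of_zero_mem (h0 : 0 ∈ freeFunMaximizers p (d + 1) β h) {s : ℝ}
    (hs : s ∈ freeFunMaximizers p (d + 1) β h) (hs0 : 0 < s) : (β, h) = (betaC p (d + 1), 0) := by
  obtain rfl := field_eq_zero_of_zero_mem hp hd hβ hh hcrit h0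
  refine Prod.ext ?_ rfl
  refine (IsLeast.csInf_eq (s := {β : ℝ | 0 ≤ β ∧ ∃ s ∈ freeFunMaximizers p (d + 1) β 0, 0 < s})
    ⟨⟨hβ.le, s, hs, hs0⟩, ?_⟩).symm
  rintro b ⟨-, t, ht, ht0⟩
  by_contra hlt
  push Not at hlt
  rw [mem_freeFunMaximizers_iff] at ht h0
  exact absurd (h0.2 t ht.1) (not_le.2 (freeFun_transition hp hd ht.1 ht0 hlt
    (ht.2 0 (Set.left_mem_Icc.2 zero_le_one))))

end Critical

/-- If 0 lost strictly to some s at β_c, it would by continuity also lose at a slightly smaller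
positive b; there f would have a positive maximizer, against the definition of the infimum. -/
theorem zero_mem_of_eq_betaC {p d : ℕ} {β h : ℝ} (hβ : 0 < β)
    (hc : (β, h) = (betaC p (d + 1), 0)) :
    0 ∈ freeFunMaximizers p (d + 1) β h := by
  have e1 : β = betaC p (d + 1) := congrArg Prod.fst hc
  obtain rfl : h = 0 := congrArg Prod.snd hc
  refine mem_freeFunMaximizers_iff.2 ⟨Set.left_mem_Icc.2 zero_le_one, fun s hs => ?_⟩
  by_contra hlt
  push Not at hlt
  have hcont : Continuous fun b : ℝ => freeFun p (d + 1) b 0 s - freeFun p (d + 1) b 0 0 := by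
    simp only [freeFun, negFreeEnergy]
    fun_prop
  have h1 : ∀ᶠ b in 𝓝 β, 0 < freeFun p (d + 1) b 0 s - freeFun p (d + 1) b 0 0 :=
    hcont.continuousAt.eventually (lt_mem_nhds (by linarith))
  have h2 := (h1.filter_mono nhdsWithin_le_nhds).and (Ioo_mem_nhdsLT hβ : Set.Ioo 0 β ∈ 𝓝[<] β)
  obtain ⟨b, hb, hb0, hbβ⟩ := h2.exists
  have hfc : ContinuousOn (freeFun p (d + 1) b 0) (Set.Icc 0 1) := by
    refine ((continuous_negFreeEnergy p b 0).comp (continuous_pi fun r => ?_)).continuousOn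
    simp only [xvec]
    split_ifs <;> fun_prop
  obtain ⟨t, ht, htm⟩ := isCompact_Icc.exists_isMaxOn
    (Set.nonempty_Icc.2 (zero_le_one (α := ℝ))) hfc
  have ht0 : 0 < t := by
    refine ht.1.lt_of_ne' fun h0 => ?_
    subst h0
    have := htm hs
    simp only [Set.mem_ofPred_eq] at this
    linarith
  have : betaC p (d + 1) ≤ b := csInf_le ⟨0, fun x hx => hx.1⟩ ⟨hb0.le, t, ⟨ht, htm⟩, ht0⟩
  linarith

/-! ### The contribution of the configurations far from the maximizers -/

theorem exists_gap {p q : ℕ} [NeZero q] {β h c ε : ℝ} (hε : 0 < ε)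
    (hc : ∀ m ∈ maximizers p q β h, negFreeEnergy p q β h m = c)
    (hne : (maximizers p q β h).Nonempty) :
    ∃ η > 0, ∀ t ∈ stdSimplex ℝ (Fin q), (∀ m ∈ maximizers p q β h, ε ≤ dist t m) →
      negFreeEnergy p q β h t ≤ c - η := by
  set K : Set (Fin q → ℝ) := stdSimplex ℝ (Fin q) ∩
    ⋂ m ∈ maximizers p q β h, {t | ε ≤ dist t m} with hK
  have hKc : IsCompact K := (isCompact_stdSimplex ℝ (Fin q)).inter_right
    (isClosed_biInter fun m _ => isClosed_le continuous_const (continuous_id.dist continuous_const))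
  have hmem : ∀ t, t ∈ K ↔ t ∈ stdSimplex ℝ (Fin q) ∧ ∀ m ∈ maximizers p q β h, ε ≤ dist t m :=
    fun t => by simp [hK]
  obtain ⟨m₀, hm₀⟩ := hne
  rcases K.eq_empty_or_nonempty with h0 | h0
  · refine ⟨1, one_pos, fun t ht htm => ?_⟩
    have : t ∈ K := (hmem t).2 ⟨ht, htm⟩
    rw [h0] at this
    exact this.elim
  · obtain ⟨t₀, ht₀, hmax⟩ := hKc.exists_isMaxOn h0 (continuous_negFreeEnergy p β h).continuousOn
    have hlt : negFreeEnergy p q β h t₀ < c := by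
      refine lt_of_le_of_ne (hc m₀ hm₀ ▸ (maximizers_iff.1 hm₀).2 t₀ ((hmem t₀).1 ht₀).1) fun h1 => ?_
      have hmm : t₀ ∈ maximizers p q β h := maximizers_iff.2 ⟨((hmem t₀).1 ht₀).1, fun t ht =>
        h1 ▸ hc m₀ hm₀ ▸ (maximizers_iff.1 hm₀).2 t ht⟩
      have := ((hmem t₀).1 ht₀).2 t₀ hmm
      rw [dist_self] at this
      linarith
    refine ⟨c - negFreeEnergy p q β h t₀, by linarith, fun t ht htm => ?_⟩
    have := hmax ((hmem t).2 ⟨ht, htm⟩)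
    simp only [Set.mem_ofPred_eq] at this
    linarith

theorem card_piAntidiag_le (q N : ℕ) :
    ((Finset.piAntidiag (Finset.univ : Finset (Fin q)) N).card : ℝ) ≤ (N + 1 : ℝ) ^ q := by
  have hsub : Finset.piAntidiag (Finset.univ : Finset (Fin q)) N ⊆
      Fintype.piFinset fun _ => Finset.range (N + 1) := fun n hn => by
    rw [Finset.mem_piAntidiag] at hn
    refine Fintype.mem_piFinset.2 fun r => Finset.mem_range.2 (Nat.lt_succ_of_le ?_)
    rw [← hn.1]
    exact Finset.single_le_sum (fun _ _ => Nat.zero_le _) (Finset.mem_univ r)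
  have := Finset.card_le_card hsub
  rw [Fintype.card_piFinset] at this
  simp only [Finset.card_range, Finset.prod_const, Finset.card_univ, Fintype.card_fin] at this
  exact_mod_cast this

/-- There are only polynomially many count vectors, and by the entropy bound the weight of each is
at most exp(N H). No Stirling expansion is needed here, so the boundary of the simplex is harmless.
-/
theorem abs_gibbsSum_far_le {p q : ℕ} [NeZero q] {β h c η A : ℝ} {N : ℕ} (hN : N ≠ 0)
    (G : (Fin q → ℝ) → ℝ) (hA : ∀ t ∈ stdSimplex ℝ (Fin q), |G t| ≤ A)
    (hG : ∀ t ∈ stdSimplex ℝ (Fin q), G t ≠ 0 → negFreeEnergy p q β h t ≤ c - η) :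
    |Real.exp (-(N * c)) * gibbsSum p β h N G| ≤
      (N + 1 : ℝ) ^ q * (Real.exp (-(N * η)) * A) := by
  rw [gibbsSum_eq_sum_proportion, Finset.mul_sum]
  refine (Finset.abs_sum_le_sum_abs _ _).trans ?_
  have hA0 : 0 ≤ A := (abs_nonneg _).trans
    (hA _ (magnetization_mem_stdSimplex hN (fun _ : Fin N => (0 : Fin q))))
  have hterm : ∀ n ∈ Finset.piAntidiag (Finset.univ : Finset (Fin q)) N,
      |Real.exp (-(N * c)) * ((Nat.multinomial Finset.univ n : ℝ) *
        (Real.exp (N * (β * powerSum p (proportion N n) + h * proportion N n 0)) *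
          G (proportion N n)))| ≤ Real.exp (-(N * η)) * A := fun n hn => by
    rw [Finset.mem_piAntidiag] at hn
    have ht := proportion_mem_stdSimplex hN hn.1
    set t := proportion N n with htd
    by_cases h0 : G t = 0
    · rw [h0]; simp only [mul_zero, abs_zero]; positivity
    · rw [abs_mul, abs_mul, abs_mul, abs_of_pos (Real.exp_pos _), abs_of_pos (Real.exp_pos _),
        Nat.abs_cast, ← mul_assoc, ← mul_assoc]
      refine mul_le_mul ?_ (hA t ht) (abs_nonneg _) (Real.exp_nonneg _)
      calc _ ≤ Real.exp (-(N * c)) * Real.exp (N * entropy t) *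
            Real.exp (N * (β * powerSum p t + h * t 0)) := by
            gcongr
            exact multinomial_le_exp_entropy hN hn.1
        _ = Real.exp (N * (negFreeEnergy p q β h t - c)) := by
            rw [← Real.exp_add, ← Real.exp_add, negFreeEnergy_eq]
            congr 1
            ring
        _ ≤ _ := by
            refine Real.exp_le_exp.2 ?_
            have := mul_le_mul_of_nonneg_left (hG t ht h0) (Nat.cast_nonneg (α := ℝ) N)
            linarith
  refine (Finset.sum_le_sum hterm).trans ?_
  rw [Finset.sum_const, nsmul_eq_mul]
  exact mul_le_mul_of_nonneg_right (card_piAntidiag_le q N) (by positivity)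

theorem tendsto_far_bound (q : ℕ) {η : ℝ} (hη : 0 < η) (A B : ℝ) :
    Tendsto (fun N : ℕ => (N + 1 : ℝ) ^ q * (Real.exp (-(N * η)) *
      (A * (1 + N) * Real.exp (B * √N)))) atTop (𝓝 0) := by
  have h1 := (Real.tendsto_pow_mul_exp_neg_atTop_nhds_zero (q + 1)).comp
    ((tendsto_natCast_atTop_atTop (R := ℝ)).atTop_mul_const (half_pos hη) |>.comp
      (tendsto_add_atTop_nat 1))
  have h2 : Tendsto (fun N : ℕ => |A| * Real.exp (B ^ 2 / (2 * η) + η / 2) * (2 / η) ^ (q + 1) *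
      ((((N + 1 : ℕ) : ℝ) * (η / 2)) ^ (q + 1) * Real.exp (-(((N + 1 : ℕ) : ℝ) * (η / 2))))) atTop
      (𝓝 0) := by
    simpa using! h1.const_mul (|A| * Real.exp (B ^ 2 / (2 * η) + η / 2) * (2 / η) ^ (q + 1))
  refine squeeze_zero_norm (fun N => ?_) h2
  have hN : (0 : ℝ) ≤ N := N.cast_nonneg
  have hsq : √(N : ℝ) ^ 2 = N := Real.sq_sqrt hN
  -- Half of the exponential decay pays for the factor exp(B√N).
  have h3 : B * √N ≤ B ^ 2 / (2 * η) + N * (η / 2) := by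
    have : 0 ≤ (B - η * √N) ^ 2 / (2 * η) := by positivity
    have e : (B - η * √N) ^ 2 / (2 * η) = B ^ 2 / (2 * η) + √N ^ 2 * (η / 2) - B * √N := by
      field_simp
      ring
    rw [e, hsq] at this
    linarith
  have h4 : Real.exp (-(N * η)) * Real.exp (B * √N) ≤
      Real.exp (B ^ 2 / (2 * η) + η / 2) * Real.exp (-(((N + 1 : ℕ) : ℝ) * (η / 2))) := by
    rw [← Real.exp_add, ← Real.exp_add]
    refine Real.exp_le_exp.2 ?_
    push_cast
    linarith
  rw [Real.norm_eq_abs, abs_mul, abs_mul, abs_mul, abs_mul, abs_of_pos (Real.exp_pos _),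
    abs_of_pos (Real.exp_pos _), abs_of_nonneg (by positivity : (0 : ℝ) ≤ (N + 1 : ℝ) ^ q),
    abs_of_nonneg (by positivity : (0 : ℝ) ≤ 1 + N)]
  calc _ = (N + 1 : ℝ) ^ (q + 1) * |A| * (Real.exp (-(N * η)) * Real.exp (B * √N)) := by
        rw [pow_succ]; ring
    _ ≤ (N + 1 : ℝ) ^ (q + 1) * |A| *
        (Real.exp (B ^ 2 / (2 * η) + η / 2) * Real.exp (-(((N + 1 : ℕ) : ℝ) * (η / 2)))) := by
        gcongr
    _ = _ := by
        rw [mul_pow]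
        push_cast
        have : (2 / η) ^ (q + 1) * (η / 2) ^ (q + 1) = 1 := by
          rw [← mul_pow]
          field_simp
          simp
        linear_combination -((N + 1 : ℝ) ^ (q + 1) * |A| *
          (Real.exp (B ^ 2 / (2 * η) + η / 2) * Real.exp (-((N + 1 : ℝ) * (η / 2))))) * this

theorem gibbsSum_add (p : ℕ) {q : ℕ} [NeZero q] (β h : ℝ) (N : ℕ) (F G : (Fin q → ℝ) → ℝ) :
    gibbsSum p β h N (fun t => F t + G t) = gibbsSum p β h N F + gibbsSum p β h N G := by
  simp only [gibbsSum, mul_add, Finset.sum_add_distrib]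

theorem gibbsSum_sum (p : ℕ) {q : ℕ} [NeZero q] (β h : ℝ) (N : ℕ) {ι : Type*} (s : Finset ι)
    (F : ι → (Fin q → ℝ) → ℝ) :
    gibbsSum p β h N (fun t => ∑ i ∈ s, F i t) = ∑ i ∈ s, gibbsSum p β h N (F i) := by
  simp only [gibbsSum, Finset.mul_sum]
  exact Finset.sum_comm

/-- `G` has local limit `l` at `m`: the part of the Gibbs sum of `G` near `m` converges to `l`. -/
def HasLocalLimit (p : ℕ) {q : ℕ} [NeZero q] (β h : ℝ) (m : Fin q → ℝ) (G : ℕ → ℝ → ℝ)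
    (l : ℝ) : Prop :=
  ∀ᶠ ε in 𝓝[>] (0 : ℝ),
    Tendsto (fun N : ℕ => localSum p β h (negFreeEnergy p q β h m) ε m (G N) N) atTop (𝓝 l)

/-- Gibbs sums are asymptotically the sum of the contributions of the maximizers. -/
theorem tendsto_gibbsSum_of_hasLocalLimit {p q : ℕ} [NeZero q] {β h c : ℝ}
    (M : Finset (Fin q → ℝ)) (hM : ↑M = maximizers p q β h) (hne : M.Nonempty)
    (hc : ∀ m ∈ M, negFreeEnergy p q β h m = c) {G : ℕ → ℝ → ℝ} {A B : ℝ}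
    (hG : ∀ᶠ N : ℕ in atTop, ∀ t ∈ stdSimplex ℝ (Fin q),
      |G N (powerSum p t)| ≤ A * (1 + N) * Real.exp (B * √N))
    {l : (Fin q → ℝ) → ℝ} (hl : ∀ m ∈ M, HasLocalLimit p β h m G (l m)) :
    Tendsto (fun N : ℕ => Real.exp (-(N * c)) * gibbsSum p β h N fun t : Fin q → ℝ => G N (powerSum p t))
      atTop (𝓝 (∑ m ∈ M, l m)) := by
  classical
  have hmemM : ∀ m, m ∈ maximizers p q β h ↔ m ∈ M := fun m => by rw [← hM]; rfl
  have hloc : ∀ᶠ ε in 𝓝[>] (0 : ℝ), ∀ m ∈ M,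
      Tendsto (fun N : ℕ => localSum p β h c ε m (G N) N) atTop (𝓝 (l m)) :=
    (Finset.eventually_all M).2 fun m hm => by
      have := hl m hm
      rwa [HasLocalLimit, hc m hm] at this
  have hdisj : ∀ᶠ ε in 𝓝[>] (0 : ℝ), ∀ m ∈ M, ∀ m' ∈ M, m ≠ m' → 2 * ε < dist m m' := by
    refine (Finset.eventually_all M).2 fun m _ => (Finset.eventually_all M).2 fun m' _ => ?_
    by_cases h0 : m = m'
    · exact Eventually.of_forall fun ε h1 => absurd h0 h1
    · filter_upwards [Ioo_mem_nhdsGT (half_pos (dist_pos.2 h0))] with ε hε _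
      linarith [hε.2]
  -- A single radius serves all the finitely many maximizers and makes their balls disjoint, so each
  -- point off the far region is counted once.
  obtain ⟨ε, ⟨h1, h2⟩, hε : 0 < ε⟩ := ((hloc.and hdisj).and self_mem_nhdsWithin).exists
  obtain ⟨η, hη, hgap⟩ := exists_gap hε (fun m hm => hc m ((hmemM m).1 hm))
    ⟨_, (hmemM _).2 hne.choose_spec⟩
  set far : ℕ → (Fin q → ℝ) → ℝ := fun N t =>
    if ∀ m ∈ M, ε ≤ dist t m then G N (powerSum p t) else 0 with hfar
  have hdecomp : ∀ N t, G N (powerSum p t) =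
      ∑ m ∈ M, (if dist t m < ε then G N (powerSum p t) else 0) + far N t := fun N t => by
    by_cases h0 : ∀ m ∈ M, ε ≤ dist t m
    · rw [Finset.sum_eq_zero fun m hm => if_neg (not_lt.2 (h0 m hm)), hfar]
      simp only [zero_add]
      rw [if_pos h0]
    · have h0' := h0
      push Not at h0'
      obtain ⟨m, hm, hmt⟩ := h0'
      rw [Finset.sum_eq_single m, if_pos hmt, hfar]
      · simp only
        rw [if_neg h0, add_zero]
      · intro m' hm' hmm
        refine if_neg fun h3 => ?_
        have := h2 m hm m' hm' hmm.symm
        have := dist_triangle_left m m' t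
        linarith
      · exact fun h3 => absurd hm h3
  have hfar0 : Tendsto (fun N : ℕ => Real.exp (-(N * c)) * gibbsSum p β h N (far N)) atTop (𝓝 0) := by
    refine squeeze_zero_norm' ?_ (tendsto_far_bound q hη |A| B)
    filter_upwards [hG, eventually_ne_atTop 0] with N hN hN0
    refine abs_gibbsSum_far_le hN0 (far N) (fun t ht => ?_) fun t ht h0 => ?_
    · have hb : |G N (powerSum p t)| ≤ |A| * (1 + N) * Real.exp (B * √N) :=
        (hN t ht).trans (by gcongr; exact le_abs_self A)
      simp only [hfar]
      split_ifs
      · exact hb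
      · rw [abs_zero]; exact (abs_nonneg _).trans hb
    · refine hgap t ht fun m hm => ?_
      by_contra h3
      refine h0 (if_neg fun h4 => h3 (h4 m ((hmemM m).1 hm)))
  have htot := (tendsto_finsetSum M h1).add hfar0
  rw [add_zero] at htot
  refine htot.congr fun N => ?_
  simp only [localSum]
  rw [← Finset.mul_sum, ← gibbsSum_sum, ← mul_add, ← gibbsSum_add]
  simp only [← hdecomp]

/-! ### Local limits at the maximizers -/

theorem tau_comp_perm (p q : ℕ) [NeZero q] (β h : ℝ) (m : Fin q → ℝ) (σ : Equiv.Perm (Fin q)) :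
    tau p q β h (m ∘ σ) = tau p q β h m := by
  have h1 : sParam q (m ∘ σ) = sParam q m := by
    rw [sParam, sParam]
    congr 2
    exact σ.iInf_comp (g := m)
  have h2 : ∏ r, (m ∘ σ) r = ∏ r, m r := Equiv.prod_comp σ m
  rw [tau, tau, h1, h2]

theorem HasLocalLimit.comp_perm {p q : ℕ} [NeZero q] {β h : ℝ} {m : Fin q → ℝ}
    {σ : Equiv.Perm (Fin q)} (hσ : h = 0 ∨ σ = 1) {G : ℕ → ℝ → ℝ} {l : ℝ}
    (hl : HasLocalLimit p β h m G l) : HasLocalLimit p β h (m ∘ σ) G l := by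
  filter_upwards [hl] with ε hε
  simp only [localSum_comp_perm hσ, negFreeEnergy_comp_perm hσ]
  exact hε

theorem continuous_powerSum (p q : ℕ) : Continuous fun t : Fin q → ℝ => powerSum p t := by
  unfold powerSum
  fun_prop

section Critical

variable {p : ℕ} (hp : 2 ≤ p) {d : ℕ} (hd : d ≠ 0) {β h : ℝ} (hβ : 0 < β) (hh : 0 ≤ h)
  (hcrit : IsCritical p (d + 1) β h)

include hp hd hβ hh hcrit

theorem hasLocalLimit_const {m : Fin (d + 1) → ℝ} (hm : m ∈ maximizers p (d + 1) β h)
    {G : ℕ → ℝ → ℝ} {C c δ : ℝ} (hδ : 0 < δ)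
    (hb : ∀ᶠ N : ℕ in atTop, ∀ x, |x - powerSum p m| < δ → |G N x| ≤ C)
    (hl : ∀ x : ℕ → ℝ, Tendsto x atTop (𝓝 (powerSum p m)) →
      Tendsto (fun N => G N (x N)) atTop (𝓝 c)) :
    HasLocalLimit p β h m G (√d / (d + 1) * tau p (d + 1) β h m * c) := by
  obtain ⟨s, hs, j, hj, rfl⟩ := exists_perm_of_mem_maximizers hp hd hβ hh hcrit hm
  have hσ : h = 0 ∨ Equiv.swap 0 j = 1 := hj.imp_right fun h0 => by rw [h0]; exact Equiv.swap_self 0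
  rw [powerSum_comp_perm] at hb hl
  rw [tau_comp_perm]
  refine HasLocalLimit.comp_perm hσ ?_
  have H := nondegenerateAt_of_mem hp hd hβ hh hcrit hs
  obtain ⟨ε₀, hε₀, hball⟩ := Metric.continuousAt_iff.1
    ((continuous_powerSum p (d + 1)).continuousAt (x := xvec (d + 1) s)) δ hδ
  filter_upwards [tendsto_localSum_const hp hd H, Ioo_mem_nhdsGT hε₀] with ε hε hεε
  refine hε G C c ?_ hl
  filter_upwards [hb] with N hN t _ htm
  exact hN _ (hball (htm.trans hεε.2))

theorem hasLocalLimit_zero {m : Fin (d + 1) → ℝ} (hm : m ∈ maximizers p (d + 1) β h)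
    {G : ℕ → ℝ → ℝ} {e : ℕ → ℝ} (he : Tendsto e atTop (𝓝 0)) {δ : ℝ} (hδ : 0 < δ)
    (hb : ∀ᶠ N : ℕ in atTop, ∀ x, |x - powerSum p m| < δ → |G N x| ≤ e N) :
    HasLocalLimit p β h m G 0 := by
  rw [← mul_zero (√d / (d + 1) * tau p (d + 1) β h m)]
  refine hasLocalLimit_const hp hd hβ hh hcrit hm (C := 1) hδ ?_ fun x hx => ?_
  · filter_upwards [hb, he.eventually (eventually_le_nhds zero_lt_one)] with N hN h1 x hx
    exact (hN x hx).trans h1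
  · refine squeeze_zero_norm' ?_ he
    filter_upwards [hb, hx.eventually (Metric.ball_mem_nhds _ hδ)] with N hN h1
    exact hN _ h1

theorem hasLocalLimit_of_eq_one {m : Fin (d + 1) → ℝ} (hm : m ∈ maximizers p (d + 1) β h)
    {G : ℕ → ℝ → ℝ} {δ : ℝ} (hδ : 0 < δ)
    (hb : ∀ᶠ N : ℕ in atTop, ∀ x, |x - powerSum p m| < δ → G N x = 1) :
    HasLocalLimit p β h m G (√d / (d + 1) * tau p (d + 1) β h m) := by
  rw [← mul_one (√d / (d + 1) * tau p (d + 1) β h m)]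
  refine hasLocalLimit_const hp hd hβ hh hcrit hm (C := 1) hδ ?_ fun x hx => ?_
  · filter_upwards [hb] with N hN x hx
    rw [hN x hx, abs_one]
  · refine tendsto_const_nhds.congr' ?_
    filter_upwards [hb, hx.eventually (Metric.ball_mem_nhds _ hδ)] with N hN h1
    exact (hN _ h1).symm

theorem exists_perm_of_powerSum_eq {m : Fin (d + 1) → ℝ} (hm : m ∈ maximizers p (d + 1) β h)
    {s : ℝ} (hs : s ∈ freeFunMaximizers p (d + 1) β h)
    (hms : powerSum p m = powerSum p (xvec (d + 1) s)) :
    ∃ σ : Equiv.Perm (Fin (d + 1)), (h = 0 ∨ σ = 1) ∧ m = xvec (d + 1) s ∘ σ := by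
  obtain ⟨s', hs', j, hj, rfl⟩ := exists_perm_of_mem_maximizers hp hd hβ hh hcrit hm
  rw [powerSum_comp_perm] at hms
  obtain rfl : s' = s := (powerSum_xvec_strictMonoOn hp hd).injOn
    (mem_freeFunMaximizers_iff.1 hs').1 (mem_freeFunMaximizers_iff.1 hs).1 hms
  exact ⟨_, hj.imp_right fun h0 => by rw [h0]; exact Equiv.swap_self 0, rfl⟩

theorem hasLocalLimit_normal {m : Fin (d + 1) → ℝ} (hm : m ∈ maximizers p (d + 1) β h) {s : ℝ}
    (hs : s ∈ freeFunMaximizers p (d + 1) β h) (hs0 : 0 < s)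
    (hms : powerSum p m = powerSum p (xvec (d + 1) s))
    {G : ℕ → ℝ → ℝ} {g : ℝ → ℝ} {B C ρ : ℝ} (hg : Measurable g) (hB : 0 ≤ B)
    (hb : ∀ᶠ N : ℕ in atTop, ∀ x, |G N x| ≤
      C * Real.exp (B * √N * |x - powerSum p (xvec (d + 1) s)|))
    (hl : ∀ z, z ≠ ρ → ∀ v : ℕ → ℝ, Tendsto v atTop (𝓝 z) →
      Tendsto (fun N : ℕ => G N (powerSum p (xvec (d + 1) s) + (√(N : ℝ))⁻¹ * v N)) atTop
        (𝓝 (g z))) :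
    HasLocalLimit p β h m G (√d / (d + 1) * tau p (d + 1) β h m *
      ∫ z, g z ∂(normalLaw (powerSumVar p d β s))) := by
  obtain ⟨σ, hσ, rfl⟩ := exists_perm_of_powerSum_eq hp hd hβ hh hcrit hm hs hms
  rw [tau_comp_perm]
  refine HasLocalLimit.comp_perm hσ ?_
  filter_upwards [tendsto_localSum_normal hp hd (nondegenerateAt_of_mem hp hd hβ hh hcrit hs) hs0]
    with ε hε
  exact hε G g B C ρ hg hB hb hl

theorem hasLocalLimit_uniform {m : Fin (d + 1) → ℝ} (hm : m ∈ maximizers p (d + 1) β h)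
    (h0 : 0 ∈ freeFunMaximizers p (d + 1) β h) (hms : powerSum p m = powerSum p (xvec (d + 1) 0))
    {G : ℕ → ℝ → ℝ} {g : ℝ → ℝ} {B C ρ : ℝ} (hg : Measurable g) (hB : 0 ≤ B) (hC : 0 ≤ C)
    (hb : ∀ᶠ N : ℕ in atTop, ∀ x, |G N x| ≤ C * (1 + N * |x - powerSum p (xvec (d + 1) 0)|) *
      Real.exp (B * √N * |x - powerSum p (xvec (d + 1) 0)|))
    (hl : ∀ z, z ≠ ρ → ∀ v : ℕ → ℝ, Tendsto v atTop (𝓝 z) →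
      Tendsto (fun N : ℕ => G N (powerSum p (xvec (d + 1) 0) + (N : ℝ)⁻¹ * v N)) atTop
        (𝓝 (g z))) :
    HasLocalLimit p β h m G (√d / (d + 1) * tau p (d + 1) β h m *
      ∫ y, g (curvature p d * ∑ r, hyper y r ^ 2) ∂(fluctuationLaw d
        (-kDeriv2 p β (1 / (d + 1))) (-kDeriv2 p β (1 / (d + 1))))) := by
  obtain ⟨σ, hσ, rfl⟩ := exists_perm_of_powerSum_eq hp hd hβ hh hcrit hm h0 hms
  rw [tau_comp_perm]
  refine HasLocalLimit.comp_perm hσ ?_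
  filter_upwards [tendsto_localSum_uniform hp hd (nondegenerateAt_of_mem hp hd hβ hh hcrit h0)]
    with ε hε
  exact hε G g B C ρ hg hB hC hb hl

theorem finite_freeFunMaximizers : (freeFunMaximizers p (d + 1) β h).Finite := by
  by_contra hinf
  obtain ⟨t, ht, hcard⟩ := Set.Infinite.exists_subset_card_eq hinf 3
  obtain ⟨x, y, z, hxy, hxz, hyz, rfl⟩ := Finset.card_eq_three.1 hcard
  have hx : x ∈ freeFunMaximizers p (d + 1) β h := ht (by simp)
  have hy : y ∈ freeFunMaximizers p (d + 1) β h := ht (by simp)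
  have hz : z ∈ freeFunMaximizers p (d + 1) β h := ht (by simp)
  have key := @not_three_maximizers p hp d hd β h hβ hh hcrit
  rcases hxy.lt_or_gt with h1 | h1 <;> rcases hxz.lt_or_gt with h2 | h2 <;>
    rcases hyz.lt_or_gt with h3 | h3
  · exact key hx hy hz h1 h3
  · exact key hx hz hy h2 h3
  · linarith
  · exact key hz hx hy h2 h1
  · exact key hy hx hz h1 h2
  · linarith
  · exact key hy hz hx h3 h2
  · exact key hz hy hx h3 h1

theorem finite_maximizers : (maximizers p (d + 1) β h).Finite := by
  refine ((finite_freeFunMaximizers hp hd hβ hh hcrit).prod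
    (Set.finite_univ (α := Fin (d + 1)))).image
      (fun x => xvec (d + 1) x.1 ∘ Equiv.swap 0 x.2) |>.subset fun m hm => ?_
  obtain ⟨s, hs, j, -, rfl⟩ := exists_perm_of_mem_maximizers hp hd hβ hh hcrit hm
  exact ⟨(s, j), ⟨hs, Set.mem_univ j⟩, rfl⟩

theorem tau_pos {m : Fin (d + 1) → ℝ} (hm : m ∈ maximizers p (d + 1) β h) :
    0 < tau p (d + 1) β h m := by
  obtain ⟨s, hs, j, -, rfl⟩ := exists_perm_of_mem_maximizers hp hd hβ hh hcrit hm
  have H := nondegenerateAt_of_mem hp hd hβ hh hcrit hs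
  rw [tau_comp_perm, tau, sParam_xvec hd H.nonneg]
  have hd0 : (0 : ℝ) < d := by positivity
  have hb := bCoord_pos (d := d) H.lt_one
  have hk : k'' p β ((1 - s) / ((d + 1 : ℕ) : ℝ)) < 0 := by
    have e : (1 - s) / ((d + 1 : ℕ) : ℝ) = bCoord d s := by rw [bCoord]; push_cast; rfl
    rw [e, k''_eq hp β hb]
    exact H.neg_b
  have hf : freeFun'' p (d + 1) β h s < 0 := by
    rw [freeFun''_eq hp d β h (aCoord_pos H.nonneg).ne' hb.ne']
    have := H.neg_ab
    have h2 : (0 : ℝ) < d / (d + 1) ^ 2 := by positivity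
    nlinarith
  refine Real.sqrt_pos.2 (div_pos (mul_pos (inv_pos.2 (by linarith)) (zpow_pos (by linarith) _)) ?_)
  exact Finset.prod_pos fun r _ => xvec_pos H.nonneg H.lt_one r

theorem powerSum_mem_Ico {m : Fin (d + 1) → ℝ} (hm : m ∈ maximizers p (d + 1) β h) :
    powerSum p m < 1 ∧ powerSum p (xvec (d + 1) 0) ≤ powerSum p m := by
  obtain ⟨s, hs, j, -, rfl⟩ := exists_perm_of_mem_maximizers hp hd hβ hh hcrit hm
  have H := nondegenerateAt_of_mem hp hd hβ hh hcrit hs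
  rw [powerSum_comp_perm]
  have hmono := powerSum_xvec_strictMonoOn (p := p) hp hd
  have hsI : s ∈ Set.Icc (0 : ℝ) 1 := ⟨H.nonneg, H.lt_one.le⟩
  refine ⟨?_, hmono.monotoneOn (Set.left_mem_Icc.2 zero_le_one) hsI H.nonneg⟩
  have := hmono hsI (Set.right_mem_Icc.2 zero_le_one) H.lt_one
  simp only at this
  rw [powerSum_xvec p d 1] at this
  have ha : aCoord d 1 = 1 := by rw [aCoord]; field_simp; ring
  have hb : bCoord d 1 = 0 := by rw [bCoord]; simp
  rwa [ha, hb, one_pow, zero_pow (by omega), mul_zero, add_zero] at this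

end Critical

/-! ### Bounds for exponentially tilted functions -/

theorem abs_powerSum_sub_le_one {p q : ℕ} (hp : 1 ≤ p) {t m : Fin q → ℝ}
    (ht : t ∈ stdSimplex ℝ (Fin q)) (hm : m ∈ stdSimplex ℝ (Fin q)) :
    |powerSum p t - powerSum p m| ≤ 1 := by
  have key : ∀ u ∈ stdSimplex ℝ (Fin q), 0 ≤ powerSum p u ∧ powerSum p u ≤ 1 := fun u hu => by
    refine ⟨Finset.sum_nonneg fun r _ => pow_nonneg (hu.1 r) p, ?_⟩
    rw [← hu.2]
    exact Finset.sum_le_sum fun r _ =>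
      pow_le_of_le_one (hu.1 r) (le_one_of_mem_stdSimplex hu r) (by omega)
  have h1 := key t ht
  have h2 := key m hm
  rw [abs_le]
  constructor <;> linarith [h1.1, h1.2, h2.1, h2.2]

/-- Makes the contribution of the dominated maximizers vanish: there y is of order √N and ty is
negative. The quadratic term is included for the scaling by N at the uniform vector. -/
theorem exists_tilt_bound {t : ℝ} (ht : t ≠ 0) : ∃ C > 0, ∀ y, t * y ≤ 0 →
    (1 + |y| + |y| ^ 2) * Real.exp (t * y) ≤ C / (1 + |y|) := by
  set a := |t| with ha
  have ha0 : 0 < a := abs_pos.2 ht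
  -- The cube of 1 + |y| ≤ (1 + 3/a) exp(a|y|/3).
  refine ⟨(1 + 3 / a) ^ 3, by positivity, fun y hy => ?_⟩
  have e : t * y = -(a * |y|) := by rw [ha, ← abs_mul, abs_of_nonpos hy, neg_neg]
  have h1 : 1 + |y| ≤ (1 + 3 / a) * Real.exp (a * |y| / 3) := by
    have h2 : a * |y| / 3 ≤ Real.exp (a * |y| / 3) := by linarith [Real.add_one_le_exp (a * |y| / 3)]
    have h3 : 1 ≤ Real.exp (a * |y| / 3) := Real.one_le_exp (by positivity)
    have h4 := mul_le_mul_of_nonneg_left h2 (by positivity : 0 ≤ 3 / a)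
    have h5 : 3 / a * (a * |y| / 3) = |y| := by field_simp
    linarith
  have h2 := pow_le_pow_left₀ (by positivity) h1 3
  rw [mul_pow, ← Real.exp_nat_mul] at h2
  have h3 : ((3 : ℕ) : ℝ) * (a * |y| / 3) = a * |y| := by push_cast; ring
  rw [h3] at h2
  rw [le_div_iff₀ (by positivity), e, Real.exp_neg]
  have h4 : (1 + |y| + |y| ^ 2) * (1 + |y|) ≤ (1 + |y|) ^ 3 := by
    nlinarith [abs_nonneg y, sq_nonneg |y|]
  rw [mul_right_comm, mul_inv_le_iff₀ (Real.exp_pos _)]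
  linarith

theorem tendsto_div_one_add_sqrt (C : ℝ) {δ : ℝ} (hδ : 0 < δ) :
    Tendsto (fun N : ℕ => C / (1 + √(N : ℝ) * δ)) atTop (𝓝 0) := by
  refine Tendsto.div_atTop tendsto_const_nhds (tendsto_atTop_add_const_left _ 1 ?_)
  exact (Real.tendsto_sqrt_atTop.comp tendsto_natCast_atTop_atTop).atTop_mul_const hδ

/-! ### The mean of the sum of powers near the true parameter -/

/-- The expectation of the sum of the `p`-th powers of the magnetization. -/
def meanPowerSum (p q : ℕ) [NeZero q] (N : ℕ) (b h : ℝ) : ℝ :=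
  gibbsSum p b h N (fun t : Fin q → ℝ => powerSum p t) / gibbsSum p b h N fun _ : Fin q → ℝ => 1

theorem gibbsSum_one_pos (p q : ℕ) [NeZero q] (N : ℕ) (b h : ℝ) :
    0 < gibbsSum p b h N fun _ : Fin q → ℝ => 1 := by
  unfold gibbsSum
  simp only [mul_one]
  exact Finset.sum_pos (fun _ _ => Real.exp_pos _) Finset.univ_nonempty

theorem gibbsSum_const_mul (p : ℕ) {q : ℕ} [NeZero q] (β h : ℝ) (N : ℕ) (c : ℝ)
    (F : (Fin q → ℝ) → ℝ) : gibbsSum p β h N (fun t => c * F t) = c * gibbsSum p β h N F := by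
  simp only [gibbsSum, Finset.mul_sum]
  exact Finset.sum_congr rfl fun X _ => by ring

/-- A shift of β by t/√N multiplies each weight by exp(t√N S). Centring S at a keeps the tilt of
order one near maximizers with S = a, and the extracted constant cancels in ratios. -/
theorem gibbsSum_tilt (p : ℕ) {q : ℕ} [NeZero q] (β h t a : ℝ) {N : ℕ} (hN : N ≠ 0)
    (F : (Fin q → ℝ) → ℝ) :
    gibbsSum p (β + t / √N) h N F = Real.exp (t * (√N * a)) *
      gibbsSum p β h N fun x => F x * Real.exp (t * (√N * (powerSum p x - a))) := by
  have hs : √(N : ℝ) ≠ 0 := by positivity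
  have hsq : (N : ℝ) = √N * √N := (Real.mul_self_sqrt N.cast_nonneg).symm
  rw [gibbsSum, gibbsSum, Finset.mul_sum]
  refine Finset.sum_congr rfl fun X _ => ?_
  have h1 : (N : ℝ) * (t / √N) = t * √N := by
    nth_rewrite 1 [hsq]
    field_simp
  have h2 : Real.exp (energy p q N (β + t / √N) h X) = Real.exp (t * (√N * a)) *
      Real.exp (energy p q N β h X) *
        Real.exp (t * (√N * (powerSum p (magnetization q N X) - a))) := by
    rw [← Real.exp_add, ← Real.exp_add, energy_eq, energy_eq]
    congr 1
    linear_combination powerSum p (magnetization q N X) * h1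
  rw [h2]
  ring

/-- Numerator and denominator have the common shape φ(K(S - a)) exp(t√N(S - a)), with φ the identity
and φ = 1. The scale K will be √N, or N at the uniform vector. -/
theorem meanPowerSum_sub (p q : ℕ) [NeZero q] (β h t a K : ℝ) {N : ℕ} (hN : N ≠ 0) :
    K * (meanPowerSum p q N (β + t / √N) h - a) =
      gibbsSum p β h N (fun x : Fin q → ℝ =>
        K * (powerSum p x - a) * Real.exp (t * (√N * (powerSum p x - a)))) /
      gibbsSum p β h N (fun x : Fin q → ℝ => 1 * Real.exp (t * (√N * (powerSum p x - a)))) := by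
  have h1 := gibbsSum_one_pos p q N (β + t / √N) h
  rw [meanPowerSum, div_sub' h1.ne', mul_div_assoc']
  have h2 : K * ((gibbsSum p (β + t / √N) h N fun t : Fin q → ℝ => powerSum p t) -
      (gibbsSum p (β + t / √N) h N fun _ : Fin q → ℝ => 1) * a) =
      gibbsSum p (β + t / √N) h N fun x : Fin q → ℝ => K * (powerSum p x - a) := by
    rw [gibbsSum_const_mul]
    have := gibbsSum_add p (β + t / √N) h N (fun t : Fin q → ℝ => powerSum p t)
      (fun _ => -a * 1)
    rw [gibbsSum_const_mul] at this
    have e : (fun t : Fin q → ℝ => powerSum p t + -a * 1) = fun x => powerSum p x - a := by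
      funext x; ring
    rw [e] at this
    rw [this]
    ring
  rw [h2, gibbsSum_tilt p β h t a hN, gibbsSum_tilt p β h t a hN,
    mul_div_mul_left _ _ (Real.exp_ne_zero _)]

instance (v : ℝ) : IsProbabilityMeasure (normalLaw v) := by unfold normalLaw; infer_instance

theorem integral_id_mul_exp_normalLaw {v : ℝ} (hv : 0 ≤ v) (t : ℝ) :
    ∫ z, z * Real.exp (t * z) ∂normalLaw v = t * v * Real.exp (v * t ^ 2 / 2) := by
  have h1 : mgf id (gaussianReal 0 v.toNNReal) = fun t => Real.exp (v * t ^ 2 / 2) := by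
    funext u
    rw [mgf_gaussianReal (μ := 0) (v := v.toNNReal) Measure.map_id u, Real.coe_toNNReal v hv,
      zero_mul, zero_add]
  have h2 := deriv_mgf (X := id) (μ := gaussianReal 0 v.toNNReal) (t := t) (by simp)
  rw [h1] at h2
  have h3 : HasDerivAt (fun t : ℝ => Real.exp (v * t ^ 2 / 2))
      (Real.exp (v * t ^ 2 / 2) * (t * v)) t := by
    have := ((((hasDerivAt_id t).pow 2).const_mul v).div_const 2).exp
    refine this.congr_deriv ?_
    simp
    ring
  rw [h3.deriv] at h2
  rw [normalLaw]
  simp only [id] at h2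
  rw [← h2]
  ring

theorem integral_exp_normalLaw {v : ℝ} (hv : 0 ≤ v) (t : ℝ) :
    ∫ z, 1 * Real.exp (t * z) ∂normalLaw v = Real.exp (v * t ^ 2 / 2) := by
  have := mgf_gaussianReal (p := gaussianReal 0 v.toNNReal) (X := id) Measure.map_id t
  rw [Real.coe_toNNReal v hv, zero_mul, zero_add] at this
  simp only [one_mul]
  exact this

theorem negFreeEnergy_eq_of_mem {p d : ℕ} {β h : ℝ} {m m' : Fin (d + 1) → ℝ} (hm : m ∈ maximizers p (d + 1) β h)
    (hm' : m' ∈ maximizers p (d + 1) β h) :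
    negFreeEnergy p (d + 1) β h m = negFreeEnergy p (d + 1) β h m' :=
  le_antisymm ((maximizers_iff.1 hm').2 m (maximizers_iff.1 hm).1)
    ((maximizers_iff.1 hm).2 m' (maximizers_iff.1 hm').1)

theorem abs_powerSum_sub_xvec_le {p : ℕ} (hp : 2 ≤ p) {d : ℕ} {β h s : ℝ} (hs : s ∈ freeFunMaximizers p (d + 1) β h)
    {t : Fin (d + 1) → ℝ} (ht : t ∈ stdSimplex ℝ (Fin (d + 1))) :
    |powerSum p t - powerSum p (xvec (d + 1) s)| ≤ 1 :=
  abs_powerSum_sub_le_one (by omega) ht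
    (xvec_mem_stdSimplex (mem_freeFunMaximizers_iff.1 hs).1)

theorem tendsto_gibbsSum_ratio {p d : ℕ} {β h : ℝ} (hcrit : IsCritical p (d + 1) β h)
    {M : Finset (Fin (d + 1) → ℝ)}
    (hM : ↑M = maximizers p (d + 1) β h) {G₁ G₂ : ℕ → ℝ → ℝ} {A₁ B₁ A₂ B₂ : ℝ}
    (hG₁ : ∀ᶠ N : ℕ in atTop, ∀ t ∈ stdSimplex ℝ (Fin (d + 1)),
      |G₁ N (powerSum p t)| ≤ A₁ * (1 + N) * Real.exp (B₁ * √N))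
    (hG₂ : ∀ᶠ N : ℕ in atTop, ∀ t ∈ stdSimplex ℝ (Fin (d + 1)),
      |G₂ N (powerSum p t)| ≤ A₂ * (1 + N) * Real.exp (B₂ * √N))
    {l₁ l₂ : (Fin (d + 1) → ℝ) → ℝ} (hl₁ : ∀ m ∈ M, HasLocalLimit p β h m G₁ (l₁ m))
    (hl₂ : ∀ m ∈ M, HasLocalLimit p β h m G₂ (l₂ m)) (hne : ∑ m ∈ M, l₂ m ≠ 0) :
    Tendsto (fun N : ℕ => gibbsSum p β h N (fun t : Fin (d + 1) → ℝ => G₁ N (powerSum p t)) /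
      gibbsSum p β h N (fun t : Fin (d + 1) → ℝ => G₂ N (powerSum p t)))
      atTop (𝓝 ((∑ m ∈ M, l₁ m) / ∑ m ∈ M, l₂ m)) := by
  have hmem : ∀ m ∈ M, m ∈ maximizers p (d + 1) β h := fun m hm => by
    rw [← hM]; exact Finset.mem_coe.2 hm
  obtain ⟨m₀, hm₀, -⟩ := hcrit.1
  have hm₀' : m₀ ∈ M := by rw [← Finset.mem_coe, hM]; exact hm₀
  have hc : ∀ m ∈ M, negFreeEnergy p (d + 1) β h m = negFreeEnergy p (d + 1) β h m₀ :=
    fun m hm => negFreeEnergy_eq_of_mem (hmem m hm) hm₀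
  have h1 := tendsto_gibbsSum_of_hasLocalLimit M hM ⟨m₀, hm₀'⟩ hc hG₁ hl₁
  have h2 := tendsto_gibbsSum_of_hasLocalLimit M hM ⟨m₀, hm₀'⟩ hc hG₂ hl₂
  refine (h1.div h2 hne).congr fun N => ?_
  exact mul_div_mul_left _ _ (Real.exp_ne_zero _)

theorem tilt_bound {p : ℕ} (hp : 2 ≤ p) {d : ℕ} {β h s : ℝ} (hs : s ∈ freeFunMaximizers p (d + 1) β h) (t : ℝ)
    {φ : ℝ → ℝ} (hφ1 : ∀ y, |φ y| ≤ 1 + |y|) {K : ℕ → ℝ} (hK : ∀ N : ℕ, |K N| ≤ N)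
    (N : ℕ) (x : Fin (d + 1) → ℝ) (hx : x ∈ stdSimplex ℝ (Fin (d + 1))) :
    |φ (K N * (powerSum p x - powerSum p (xvec (d + 1) s))) *
      Real.exp (t * (√N * (powerSum p x - powerSum p (xvec (d + 1) s))))| ≤
      1 * (1 + N) * Real.exp (|t| * √N) := by
  have h1 := abs_powerSum_sub_xvec_le hp hs hx
  set y := powerSum p x - powerSum p (xvec (d + 1) s)
  rw [abs_mul, Real.abs_exp, one_mul]
  refine mul_le_mul ((hφ1 _).trans ?_) (Real.exp_le_exp.2 ((le_abs_self _).trans ?_))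
    (Real.exp_nonneg _) (by positivity)
  · rw [abs_mul]
    have := mul_le_mul (hK N) h1 (abs_nonneg _) N.cast_nonneg
    linarith
  · rw [abs_mul, abs_mul, abs_of_nonneg (Real.sqrt_nonneg (N : ℝ))]
    exact mul_le_mul_of_nonneg_left (mul_le_of_le_one_right (Real.sqrt_nonneg _) h1) (abs_nonneg _)

/-! ### Tilted local limits and the resulting means -/

section Critical

variable {p : ℕ} (hp : 2 ≤ p) {d : ℕ} (hd : d ≠ 0) {β h : ℝ} (hβ : 0 < β) (hh : 0 ≤ h)
  (hcrit : IsCritical p (d + 1) β h)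

include hp hd hβ hh hcrit

theorem powerSumVar_pos {s : ℝ} (hs : s ∈ freeFunMaximizers p (d + 1) β h) (hs0 : 0 < s) :
    0 < powerSumVar p d β s := by
  have H := nondegenerateAt_of_mem hp hd hβ hh hcrit hs
  have h1 := slope_ne_zero (d := d) hp hs0 H.lt_one
  have h2 := H.neg_ab
  have hd0 : (0 : ℝ) < d := by positivity
  exact mul_pos (by nlinarith) (div_pos hd0 (by linarith))

theorem sum_tau_pos {M : Finset (Fin (d + 1) → ℝ)} (hM : ↑M = maximizers p (d + 1) β h) {s : ℝ}
    (hs : s ∈ freeFunMaximizers p (d + 1) β h) :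
    0 < ∑ m ∈ M, if powerSum p m = powerSum p (xvec (d + 1) s) then tau p (d + 1) β h m else 0 := by
  have hmem : ∀ m ∈ M, m ∈ maximizers p (d + 1) β h := fun m hm => by
    rw [← hM]; exact Finset.mem_coe.2 hm
  have hx : xvec (d + 1) s ∈ M := by
    rw [← Finset.mem_coe, hM]; exact xvec_mem_maximizers hp hd hβ hh hcrit hs
  refine Finset.sum_pos' (fun m hm => ?_) ⟨_, hx, ?_⟩
  · split_ifs
    · exact (tau_pos hp hd hβ hh hcrit (hmem m hm)).le
    · exact le_rfl
  · rw [if_pos rfl]; exact tau_pos hp hd hβ hh hcrit (hmem _ hx)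

/-- Local limits of exponentially tilted functions in the Gaussian scaling. -/
theorem hasLocalLimit_tilt_normal {m : Fin (d + 1) → ℝ} (hm : m ∈ maximizers p (d + 1) β h) {s : ℝ}
    (hs : s ∈ freeFunMaximizers p (d + 1) β h) (hs0 : 0 < s) {t : ℝ} (ht : t ≠ 0)
    (hdom : powerSum p m ≠ powerSum p (xvec (d + 1) s) →
      t * (powerSum p m - powerSum p (xvec (d + 1) s)) < 0)
    {φ : ℝ → ℝ} (hφ : Continuous φ) (hφ1 : ∀ y, |φ y| ≤ 1 + |y|) :
    HasLocalLimit p β h m (fun N x => φ (√N * (x - powerSum p (xvec (d + 1) s))) *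
        Real.exp (t * (√N * (x - powerSum p (xvec (d + 1) s)))))
      ((if powerSum p m = powerSum p (xvec (d + 1) s) then tau p (d + 1) β h m else 0) *
        (√d / (d + 1) * ∫ z, φ z * Real.exp (t * z) ∂normalLaw (powerSumVar p d β s))) := by
  set a := powerSum p (xvec (d + 1) s) with ha
  split_ifs with hms
  · have := hasLocalLimit_normal hp hd hβ hh hcrit hm hs hs0 (by rw [hms])
      (G := fun N x => φ (√N * (x - a)) * Real.exp (t * (√N * (x - a))))
      (g := fun z => φ z * Real.exp (t * z)) (B := 1 + |t|) (C := 1) (ρ := 0)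
      (by fun_prop) (by positivity) (Eventually.of_forall fun N x => ?_) fun z _ v hv => ?_
    · rw [mul_left_comm, ← mul_assoc]; exact this
    · rw [abs_mul, Real.abs_exp, one_mul, ← ha]
      have h1 : |√(N : ℝ) * (x - a)| = √N * |x - a| := by
        rw [abs_mul, abs_of_nonneg (Real.sqrt_nonneg _)]
      have h2 : |φ (√N * (x - a))| ≤ Real.exp (√N * |x - a|) := by
        refine (hφ1 _).trans ?_
        rw [h1]
        linarith [Real.add_one_le_exp (√N * |x - a|)]
      have h3 : Real.exp (t * (√N * (x - a))) ≤ Real.exp (|t| * (√N * |x - a|)) := by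
        refine Real.exp_le_exp.2 ((le_abs_self _).trans ?_)
        rw [abs_mul, h1]
      refine (mul_le_mul h2 h3 (Real.exp_nonneg _) (Real.exp_nonneg _)).trans (le_of_eq ?_)
      rw [← Real.exp_add]
      congr 1
      ring
    · have hc : Continuous fun z : ℝ => φ z * Real.exp (t * z) := by fun_prop
      refine ((hc.tendsto z).comp hv).congr' ?_
      filter_upwards [eventually_ne_atTop 0] with N hN
      have : √(N : ℝ) ≠ 0 := by positivity
      simp only [Function.comp, ← ha]
      rw [add_sub_cancel_left, mul_inv_cancel_left₀ this]
  · rw [zero_mul]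
    have hdom' := hdom hms
    obtain ⟨C, hC, hbd⟩ := exists_tilt_bound ht
    -- Within half the distance to a, the sign of t(x - a) remains that of t(S(m) - a), which is
    -- negative by `hdom`.
    have hδ : 0 < |powerSum p m - a| / 2 := half_pos (abs_pos.2 (sub_ne_zero.2 hms))
    refine hasLocalLimit_zero hp hd hβ hh hcrit hm (tendsto_div_one_add_sqrt C hδ) hδ
      (Eventually.of_forall fun N x hx => ?_)
    have hx1 : t * (x - a) ≤ 0 ∧ |powerSum p m - a| / 2 ≤ |x - a| := by
      have h1 : |powerSum p m - a| ≤ |x - a| + |x - powerSum p m| := by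
        have := abs_sub (x - a) (x - powerSum p m)
        rwa [show x - a - (x - powerSum p m) = powerSum p m - a by ring] at this
      refine ⟨?_, by linarith⟩
      have h2 : t * (x - a) ≤ t * (powerSum p m - a) + |t| * |x - powerSum p m| := by
        have : t * (x - powerSum p m) ≤ |t| * |x - powerSum p m| := by
          rw [← abs_mul]; exact le_abs_self _
        linarith
      have h3 : t * (powerSum p m - a) = -(|t| * |powerSum p m - a|) := by
        rw [← abs_mul, abs_of_neg hdom', neg_neg]
      have h4 : |t| * |x - powerSum p m| ≤ |t| * (|powerSum p m - a| / 2) := by gcongr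
      have h5 : 0 ≤ |t| * |powerSum p m - a| := by positivity
      linarith
    have hy : t * (√N * (x - a)) ≤ 0 := by
      have := mul_nonpos_of_nonneg_of_nonpos (Real.sqrt_nonneg (N : ℝ)) hx1.1
      linarith
    have h1 : |√(N : ℝ) * (x - a)| = √N * |x - a| := by
      rw [abs_mul, abs_of_nonneg (Real.sqrt_nonneg _)]
    rw [abs_mul, Real.abs_exp]
    calc _ ≤ (1 + |√N * (x - a)| + |√N * (x - a)| ^ 2) * Real.exp (t * (√N * (x - a))) := by
          refine mul_le_mul_of_nonneg_right ((hφ1 _).trans ?_) (Real.exp_nonneg _)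
          linarith [sq_nonneg |√N * (x - a)|]
      _ ≤ C / (1 + |√N * (x - a)|) := hbd _ hy
      _ ≤ _ := by
          rw [h1]
          gcongr
          exact hx1.2

/-- Local limits of exponentially tilted functions around the uniform vector. -/
theorem hasLocalLimit_tilt_uniform {m : Fin (d + 1) → ℝ} (hm : m ∈ maximizers p (d + 1) β h)
    (h0 : 0 ∈ freeFunMaximizers p (d + 1) β h) {t : ℝ} (ht : t < 0)
    {φ : ℝ → ℝ} (hφ : Continuous φ) (hφ1 : ∀ y, |φ y| ≤ 1 + |y|) :
    HasLocalLimit p β h m (fun N x => φ (N * (x - powerSum p (xvec (d + 1) 0))) *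
        Real.exp (t * (√N * (x - powerSum p (xvec (d + 1) 0)))))
      ((if powerSum p m = powerSum p (xvec (d + 1) 0) then tau p (d + 1) β h m else 0) *
        (√d / (d + 1) * ∫ y, φ (curvature p d * ∑ r, hyper y r ^ 2) ∂(fluctuationLaw d
        (-kDeriv2 p β (1 / (d + 1))) (-kDeriv2 p β (1 / (d + 1)))))) := by
  have hge := (powerSum_mem_Ico hp hd hβ hh hcrit hm).2
  set a := powerSum p (xvec (d + 1) 0) with ha
  split_ifs with hms
  · have := hasLocalLimit_uniform hp hd hβ hh hcrit hm h0 (by rw [hms])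
      (G := fun N x => φ (N * (x - a)) * Real.exp (t * (√N * (x - a))))
      (g := φ) (B := |t|) (C := 1) (ρ := 0)
      hφ.measurable (by positivity) zero_le_one (Eventually.of_forall fun N x => ?_)
      fun z _ v hv => ?_
    · rw [mul_left_comm, ← mul_assoc]; exact this
    · rw [abs_mul, Real.abs_exp, one_mul, ← ha]
      have h1 : |√(N : ℝ) * (x - a)| = √N * |x - a| := by
        rw [abs_mul, abs_of_nonneg (Real.sqrt_nonneg _)]
      have h2 : |φ (N * (x - a))| ≤ 1 + N * |x - a| := by
        refine (hφ1 _).trans ?_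
        rw [abs_mul, Nat.abs_cast]
      have h3 : Real.exp (t * (√N * (x - a))) ≤ Real.exp (|t| * √N * |x - a|) := by
        refine Real.exp_le_exp.2 ((le_abs_self _).trans ?_)
        rw [abs_mul, h1, mul_assoc]
      exact mul_le_mul h2 h3 (Real.exp_nonneg _) (by positivity)
    -- As S - a is of order 1/N, the exponent t√N(S - a) tends to 0; this is why t drops out of the
    -- limit.
    · have hsq : Tendsto (fun N : ℕ => t * ((√(N : ℝ))⁻¹ * v N)) atTop (𝓝 0) := by
        have := (tendsto_inv_sqrt_nat.mul hv).const_mul t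
        simpa using this
      have hlim := ((hφ.tendsto z).comp hv).mul ((Real.continuous_exp.tendsto 0).comp hsq)
      rw [Real.exp_zero, mul_one] at hlim
      refine hlim.congr' ?_
      filter_upwards [eventually_ne_atTop 0] with N hN
      have hN' : (N : ℝ) ≠ 0 := by positivity
      have hN'' : √(N : ℝ) ≠ 0 := by positivity
      have e : √(N : ℝ) * ((N : ℝ)⁻¹ * v N) = (√(N : ℝ))⁻¹ * v N := by
        have : (N : ℝ) = √N * √N := (Real.mul_self_sqrt N.cast_nonneg).symm
        nth_rewrite 2 [this]
        field_simp
      simp only [Function.comp, ← ha]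
      rw [add_sub_cancel_left, mul_inv_cancel_left₀ hN', e]
  · rw [zero_mul]
    have hlt : a < powerSum p m := lt_of_le_of_ne hge (Ne.symm hms)
    obtain ⟨C, hC, hbd⟩ := exists_tilt_bound ht.ne
    set δ := (powerSum p m - a) / 2 with hδd
    have hδ : 0 < δ := half_pos (sub_pos.2 hlt)
    refine hasLocalLimit_zero hp hd hβ hh hcrit hm
      (tendsto_div_one_add_sqrt ((1 + 1 / δ) * C) hδ) hδ (Eventually.of_forall fun N x hx => ?_)
    have hx1 : δ ≤ x - a := by
      have := (abs_lt.1 hx).1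
      linarith
    have hsqrt := Real.sqrt_nonneg (N : ℝ)
    have hy : t * (√N * (x - a)) ≤ 0 :=
      mul_nonpos_of_nonpos_of_nonneg ht.le (mul_nonneg hsqrt (by linarith))
    have h1 : |√(N : ℝ) * (x - a)| = √N * (x - a) := abs_of_nonneg (mul_nonneg hsqrt (by linarith))
    -- Away from the uniform vector x - a ≥ δ, so N(x - a) is at most 1/δ times the square of √N(x -
    -- a).
    have h2 : |φ (N * (x - a))| ≤ (1 + 1 / δ) * (1 + |√N * (x - a)| + |√N * (x - a)| ^ 2) := by
      refine (hφ1 _).trans ?_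
      rw [h1, abs_of_nonneg (mul_nonneg N.cast_nonneg (by linarith)), mul_pow,
        Real.sq_sqrt N.cast_nonneg]
      have h3 : (N : ℝ) * (x - a) ≤ 1 / δ * (N * (x - a) ^ 2) := by
        rw [one_div, ← div_eq_inv_mul, le_div_iff₀ hδ, sq, mul_assoc]
        gcongr
        linarith
      have h4 : 0 ≤ √N * (x - a) := mul_nonneg hsqrt (by linarith)
      have h5 : 0 ≤ (N : ℝ) * (x - a) ^ 2 := by positivity
      have h6 : 0 ≤ 1 / δ := by positivity
      nlinarith [mul_nonneg h6 h4]
    rw [abs_mul, Real.abs_exp]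
    calc _ ≤ (1 + 1 / δ) * (1 + |√N * (x - a)| + |√N * (x - a)| ^ 2) *
            Real.exp (t * (√N * (x - a))) := mul_le_mul_of_nonneg_right h2 (Real.exp_nonneg _)
      _ ≤ (1 + 1 / δ) * (C / (1 + |√N * (x - a)|)) := by
          rw [mul_assoc]
          exact mul_le_mul_of_nonneg_left (hbd _ hy) (by positivity)
      _ ≤ _ := by
          rw [h1, mul_div_assoc']
          gcongr

/-- All maximizers outside the level of S(x_s) are suppressed by the tilt, and the limit tV is the
mean of a centred normal law of variance V tilted by exp(tz). The weights τ cancel, since the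
dominating maximizers share the same limit law of S. -/
theorem tendsto_meanPowerSum_normal {M : Finset (Fin (d + 1) → ℝ)}
    (hM : ↑M = maximizers p (d + 1) β h) {s : ℝ}
    (hs : s ∈ freeFunMaximizers p (d + 1) β h) (hs0 : 0 < s) {t : ℝ} (ht : t ≠ 0)
    (hdom : ∀ m ∈ M, powerSum p m ≠ powerSum p (xvec (d + 1) s) →
      t * (powerSum p m - powerSum p (xvec (d + 1) s)) < 0) :
    Tendsto (fun N : ℕ => √(N : ℝ) * (meanPowerSum p (d + 1) N (β + t / √N) h -
      powerSum p (xvec (d + 1) s))) atTop (𝓝 (t * powerSumVar p d β s)) := by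
  have hmem : ∀ m ∈ M, m ∈ maximizers p (d + 1) β h := fun m hm => by
    rw [← hM]; exact Finset.mem_coe.2 hm
  have hV := powerSumVar_pos hp hd hβ hh hcrit hs hs0
  have hK : ∀ N : ℕ, |√(N : ℝ)| ≤ N := fun N => by
    rw [abs_of_nonneg (Real.sqrt_nonneg _)]
    rcases Nat.eq_zero_or_pos N with rfl | hN
    · simp
    · have : (1 : ℝ) ≤ N := by exact_mod_cast hN
      exact Real.sqrt_le_iff.2 ⟨N.cast_nonneg, by nlinarith⟩
  have hone : ∀ y : ℝ, |(1 : ℝ)| ≤ 1 + |y| := fun y => by rw [abs_one]; linarith [abs_nonneg y]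
  have hid : ∀ y : ℝ, |y| ≤ 1 + |y| := fun y => by linarith
  have hW := sum_tau_pos hp hd hβ hh hcrit hM hs
  have hκ : (0 : ℝ) < √d / (d + 1) := by positivity
  have key := tendsto_gibbsSum_ratio hcrit hM
    (Eventually.of_forall fun N x hx => tilt_bound hp hs t hid hK N x hx)
    (Eventually.of_forall fun N x hx => tilt_bound hp hs t hone hK N x hx)
    (fun m hm => hasLocalLimit_tilt_normal hp hd hβ hh hcrit (hmem m hm) hs hs0 ht (hdom m hm)
      continuous_id hid)
    (fun m hm => hasLocalLimit_tilt_normal hp hd hβ hh hcrit (hmem m hm) hs hs0 ht (hdom m hm)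
      continuous_const hone) ?_
  · rw [← Finset.sum_mul, ← Finset.sum_mul, mul_div_mul_left _ _ hW.ne',
      mul_div_mul_left _ _ hκ.ne', integral_exp_normalLaw hV.le] at key
    simp only [id] at key
    rw [integral_id_mul_exp_normalLaw hV.le, mul_div_cancel_right₀ _ (Real.exp_ne_zero _)] at key
    refine key.congr' ?_
    filter_upwards [eventually_ne_atTop 0] with N hN
    rw [meanPowerSum_sub p (d + 1) β h t _ _ hN]
  · rw [← Finset.sum_mul, integral_exp_normalLaw hV.le]
    exact (mul_pos hW (mul_pos hκ (Real.exp_pos _))).ne'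

/-- The uniform vector has the least S, so t < 0 selects it; what remains is the untilted mean of
the quadratic form, whatever the value of t. -/
theorem tendsto_meanPowerSum_uniform {M : Finset (Fin (d + 1) → ℝ)}
    (hM : ↑M = maximizers p (d + 1) β h) (h0 : 0 ∈ freeFunMaximizers p (d + 1) β h) {t : ℝ}
    (ht : t < 0) :
    Tendsto (fun N : ℕ => (N : ℝ) * (meanPowerSum p (d + 1) N (β + t / √N) h -
      powerSum p (xvec (d + 1) 0))) atTop
      (𝓝 (curvature p d * (d / -kDeriv2 p β (1 / (d + 1))))) := by
  have hmem : ∀ m ∈ M, m ∈ maximizers p (d + 1) β h := fun m hm => by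
    rw [← hM]; exact Finset.mem_coe.2 hm
  have hα : 0 < -kDeriv2 p β (1 / (d + 1)) := by
    have := (nondegenerateAt_of_mem hp hd hβ hh hcrit h0).neg_b
    rw [show bCoord d 0 = 1 / (d + 1) by simp [bCoord]] at this
    linarith
  have hK : ∀ N : ℕ, |(N : ℝ)| ≤ N := fun N => by rw [Nat.abs_cast]
  have hone : ∀ y : ℝ, |(1 : ℝ)| ≤ 1 + |y| := fun y => by rw [abs_one]; linarith [abs_nonneg y]
  have hid : ∀ y : ℝ, |y| ≤ 1 + |y| := fun y => by linarith
  have hW := sum_tau_pos hp hd hβ hh hcrit hM h0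
  have hκ : (0 : ℝ) < √d / (d + 1) := by positivity
  have key := tendsto_gibbsSum_ratio hcrit hM
    (Eventually.of_forall fun N x hx => tilt_bound hp h0 t hid hK N x hx)
    (Eventually.of_forall fun N x hx => tilt_bound hp h0 t hone hK N x hx)
    (fun m hm => hasLocalLimit_tilt_uniform hp hd hβ hh hcrit (hmem m hm) h0 ht continuous_id hid)
    (fun m hm => hasLocalLimit_tilt_uniform hp hd hβ hh hcrit (hmem m hm) h0 ht continuous_const
      hone) ?_
  · rw [← Finset.sum_mul, ← Finset.sum_mul, mul_div_mul_left _ _ hW.ne',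
      mul_div_mul_left _ _ hκ.ne'] at key
    simp only [id, integral_const, probReal_univ, smul_eq_mul, mul_one, div_one] at key
    rw [integral_const_mul, integral_sum_hyper_sq hd hα] at key
    refine key.congr' ?_
    filter_upwards [eventually_ne_atTop 0] with N hN
    rw [meanPowerSum_sub p (d + 1) β h t _ _ hN]
  · rw [← Finset.sum_mul]
    simp only [integral_const, probReal_univ, smul_eq_mul, mul_one]
    exact (mul_pos hW hκ).ne'

end Critical

/-! ### Asymptotic probabilities of sublevel sets of the sum of powers -/

theorem pottsMeasure_real (p q N : ℕ) [NeZero q] (β h : ℝ) (A : Set (Fin N → Fin q)) :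
    (pottsMeasure p q N β h).real A = ∑ X, A.indicator (pottsProb p q N β h) X := by
  rw [Measure.real, PMF.toMeasure_apply_fintype,
    ENNReal.toReal_sum fun X _ => ?_]
  · refine Finset.sum_congr rfl fun X _ => ?_
    by_cases hX : X ∈ A
    · rw [Set.indicator_of_mem hX, Set.indicator_of_mem hX]
      exact ENNReal.toReal_ofReal (pottsProb_nonneg p q N β h X)
    · rw [Set.indicator_of_notMem hX, Set.indicator_of_notMem hX, ENNReal.toReal_zero]
  · by_cases hX : X ∈ A
    · rw [Set.indicator_of_mem hX]; exact ENNReal.ofReal_ne_top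
    · rw [Set.indicator_of_notMem hX]; exact ENNReal.zero_ne_top

open Classical in
theorem pottsMeasure_real_powerSum (p q N : ℕ) [NeZero q] (β h : ℝ) (A : Set ℝ) :
    (pottsMeasure p q N β h).real {X | powerSum p (magnetization q N X) ∈ A} =
      gibbsSum p β h N (fun t : Fin q → ℝ => if powerSum p t ∈ A then 1 else 0) /
        gibbsSum p β h N (fun _ : Fin q → ℝ => 1) := by
  have hq : (q : ℝ) ^ N ≠ 0 := pow_ne_zero _ (Nat.cast_ne_zero.mpr (NeZero.ne q))
  rw [pottsMeasure_real, gibbsSum, Finset.sum_div]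
  refine Finset.sum_congr rfl fun X _ => ?_
  have e : pottsProb p q N β h X = Real.exp (energy p q N β h X) /
      gibbsSum p β h N (fun _ : Fin q → ℝ => 1) := by
    rw [pottsProb, partitionFunction, mul_div_cancel₀ _ hq, gibbsSum]
    simp only [mul_one]
    ring
  by_cases hX : powerSum p (magnetization q N X) ∈ A
  · rw [Set.indicator_of_mem (by exact hX), if_pos hX, mul_one, e]
  · rw [Set.indicator_of_notMem (by exact hX), if_neg hX, mul_zero, zero_div]

section Critical

variable {p : ℕ} (hp : 2 ≤ p) {d : ℕ} (hd : d ≠ 0) {β h : ℝ} (hβ : 0 < β) (hh : 0 ≤ h)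
  (hcrit : IsCritical p (d + 1) β h)

include hp hd hβ hh hcrit

open Classical in
theorem tendsto_pottsMeasure_of_hasLocalLimit {M : Finset (Fin (d + 1) → ℝ)}
    (hM : ↑M = maximizers p (d + 1) β h) (A : ℕ → Set ℝ) {l : (Fin (d + 1) → ℝ) → ℝ}
    (hl : ∀ m ∈ M, HasLocalLimit p β h m (fun N x => if x ∈ A N then 1 else 0)
      (√d / (d + 1) * l m)) :
    Tendsto (fun N => (pottsMeasure p (d + 1) N β h).real
      {X | powerSum p (magnetization (d + 1) N X) ∈ A N}) atTop
      (𝓝 ((∑ m ∈ M, l m) / ∑ m ∈ M, tau p (d + 1) β h m)) := by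
  have hmem : ∀ m ∈ M, m ∈ maximizers p (d + 1) β h := fun m hm => by
    rw [← hM]; exact Finset.mem_coe.2 hm
  have hκ : (0 : ℝ) < √d / (d + 1) := by positivity
  obtain ⟨m₀, hm₀, -⟩ := hcrit.1
  have hT : 0 < ∑ m ∈ M, tau p (d + 1) β h m :=
    Finset.sum_pos (fun m hm => tau_pos hp hd hβ hh hcrit (hmem m hm))
      ⟨m₀, by rw [← Finset.mem_coe, hM]; exact hm₀⟩
  have hle : ∀ (N : ℕ) (c : ℝ), |c| ≤ 1 → |c| ≤ 1 * (1 + (N : ℝ)) * Real.exp (0 * √N) :=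
    fun N c hc => by
      rw [zero_mul, Real.exp_zero, one_mul, mul_one]
      linarith [N.cast_nonneg (α := ℝ)]
  have key := tendsto_gibbsSum_ratio hcrit hM (G₂ := fun _ _ => 1)
    (Eventually.of_forall fun N x _ => hle N _ (by split_ifs <;> simp))
    (Eventually.of_forall fun N x _ => hle N _ (by simp)) hl
    (fun m hm => hasLocalLimit_of_eq_one hp hd hβ hh hcrit (hmem m hm) one_pos
      (Eventually.of_forall fun N x _ => rfl)) ?_
  · rw [← Finset.mul_sum, ← Finset.mul_sum, mul_div_mul_left _ _ hκ.ne'] at key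
    refine key.congr fun N => ?_
    rw [pottsMeasure_real_powerSum]
  · rw [← Finset.mul_sum]
    exact (mul_pos hκ hT).ne'

open Classical in
theorem hasLocalLimit_Iic_of_lt {m : Fin (d + 1) → ℝ} (hm : m ∈ maximizers p (d + 1) β h) {a : ℝ}
    (hma : powerSum p m < a) {r : ℕ → ℝ} (hr : Tendsto r atTop (𝓝 a)) :
    HasLocalLimit p β h m (fun N x => if x ∈ Set.Iic (r N) then 1 else 0)
      (√d / (d + 1) * tau p (d + 1) β h m) := by
  refine hasLocalLimit_of_eq_one hp hd hβ hh hcrit hm (half_pos (sub_pos.2 hma)) ?_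
  filter_upwards [hr.eventually (lt_mem_nhds (by linarith : (powerSum p m + a) / 2 < a))] with N hN x hx
  exact if_pos (Set.mem_Iic.2 (by linarith [(abs_lt.1 hx).2]))

open Classical in
theorem hasLocalLimit_Iic_of_gt {m : Fin (d + 1) → ℝ} (hm : m ∈ maximizers p (d + 1) β h) {a : ℝ}
    (hma : a < powerSum p m) {r : ℕ → ℝ} (hr : Tendsto r atTop (𝓝 a)) :
    HasLocalLimit p β h m (fun N x => if x ∈ Set.Iic (r N) then 1 else 0) 0 := by
  refine hasLocalLimit_zero hp hd hβ hh hcrit hm (tendsto_const_nhds (x := (0 : ℝ)))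
    (half_pos (sub_pos.2 hma)) ?_
  filter_upwards [hr.eventually (gt_mem_nhds (by linarith : a < (powerSum p m + a) / 2))] with N hN x hx
  rw [if_neg (fun h1 => by linarith [(abs_lt.1 hx).1, Set.mem_Iic.1 h1]), abs_zero]

-- The threshold approaches S(x_s) at distance of order 1/√N. Maximizers with smaller S contribute
-- their whole weight, those on the same level a Gaussian probability, those above nothing.
open Classical in
theorem tendsto_pottsMeasure_Iic_normal {M : Finset (Fin (d + 1) → ℝ)}
    (hM : ↑M = maximizers p (d + 1) β h) {s : ℝ}
    (hs : s ∈ freeFunMaximizers p (d + 1) β h) (hs0 : 0 < s) {r : ℕ → ℝ} {ρ : ℝ}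
    (hr : Tendsto (fun N : ℕ => √(N : ℝ) * (r N - powerSum p (xvec (d + 1) s))) atTop (𝓝 ρ)) :
    Tendsto (fun N => (pottsMeasure p (d + 1) N β h).real
      {X | powerSum p (magnetization (d + 1) N X) ≤ r N}) atTop
      (𝓝 ((∑ m ∈ M, if powerSum p m < powerSum p (xvec (d + 1) s) then tau p (d + 1) β h m else
        if powerSum p m = powerSum p (xvec (d + 1) s) then tau p (d + 1) β h m *
          (normalLaw (powerSumVar p d β s)).real (Set.Iic ρ) else 0) /
          ∑ m ∈ M, tau p (d + 1) β h m)) := by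
  have hmem : ∀ m ∈ M, m ∈ maximizers p (d + 1) β h := fun m hm => by
    rw [← hM]; exact Finset.mem_coe.2 hm
  set a := powerSum p (xvec (d + 1) s) with ha
  have hra : Tendsto r atTop (𝓝 a) := by
    have h1 := (tendsto_inv_sqrt_nat.mul hr).add_const a
    rw [zero_mul, zero_add] at h1
    refine h1.congr' ?_
    filter_upwards [eventually_ne_atTop 0] with N hN
    have : √(N : ℝ) ≠ 0 := by positivity
    rw [inv_mul_cancel_left₀ this, sub_add_cancel]
  refine tendsto_pottsMeasure_of_hasLocalLimit hp hd hβ hh hcrit hM (fun N => Set.Iic (r N))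
    fun m hm => ?_
  split_ifs with h1 h2
  · exact hasLocalLimit_Iic_of_lt hp hd hβ hh hcrit (hmem m hm) h1 hra
  · have := hasLocalLimit_normal hp hd hβ hh hcrit (hmem m hm) hs hs0 h2
      (G := fun N x => if x ∈ Set.Iic (r N) then 1 else 0)
      (g := (Set.Iic ρ).indicator 1) (B := 0) (C := 1) (ρ := ρ)
      (measurable_one.indicator measurableSet_Iic) le_rfl
      (Eventually.of_forall fun N x => by split_ifs <;> simp) fun z hz v hv => ?_
    · rwa [integral_indicator_one measurableSet_Iic, mul_assoc] at this
    · have hiff : ∀ N : ℕ, N ≠ 0 → (a + (√(N : ℝ))⁻¹ * v N ∈ Set.Iic (r N) ↔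
          v N ≤ √(N : ℝ) * (r N - a)) := fun N hN => by
        have : 0 < √(N : ℝ) := by positivity
        rw [Set.mem_Iic, ← div_eq_inv_mul, ← le_sub_iff_add_le', div_le_iff₀' this]
      rcases hz.lt_or_gt with h3 | h3
      · rw [Set.indicator_of_mem (Set.mem_Iic.2 h3.le), Pi.one_apply]
        refine tendsto_const_nhds.congr' ?_
        filter_upwards [hv.eventually_lt hr h3, eventually_ne_atTop 0] with N hN hN0
        exact (if_pos ((hiff N hN0).2 hN.le)).symm
      · rw [Set.indicator_of_notMem (fun h4 => not_lt.2 (Set.mem_Iic.1 h4) h3)]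
        refine tendsto_const_nhds.congr' ?_
        filter_upwards [hr.eventually_lt hv h3, eventually_ne_atTop 0] with N hN hN0
        exact (if_neg fun h4 => not_le.2 hN ((hiff N hN0).1 h4)).symm
  · rw [mul_zero]
    exact hasLocalLimit_Iic_of_gt hp hd hβ hh hcrit (hmem m hm)
      (lt_of_le_of_ne (not_lt.1 h1) (Ne.symm h2)) hra

-- No maximizer has S below that of the uniform vector, so only the uniform level contributes.
open Classical in
theorem tendsto_pottsMeasure_Iic_uniform {M : Finset (Fin (d + 1) → ℝ)}
    (hM : ↑M = maximizers p (d + 1) β h)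
    (h0 : 0 ∈ freeFunMaximizers p (d + 1) β h) {r : ℕ → ℝ} {ρ : ℝ}
    (hr : Tendsto (fun N : ℕ => (N : ℝ) * (r N - powerSum p (xvec (d + 1) 0))) atTop (𝓝 ρ)) :
    Tendsto (fun N => (pottsMeasure p (d + 1) N β h).real
      {X | powerSum p (magnetization (d + 1) N X) ≤ r N}) atTop
      (𝓝 ((∑ m ∈ M, if powerSum p m = powerSum p (xvec (d + 1) 0) then tau p (d + 1) β h m *
          (fluctuationLaw d (-kDeriv2 p β (1 / (d + 1))) (-kDeriv2 p β (1 / (d + 1)))).real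
            {y | curvature p d * ∑ r, hyper y r ^ 2 ≤ ρ} else 0) /
          ∑ m ∈ M, tau p (d + 1) β h m)) := by
  have hmem : ∀ m ∈ M, m ∈ maximizers p (d + 1) β h := fun m hm => by
    rw [← hM]; exact Finset.mem_coe.2 hm
  set a := powerSum p (xvec (d + 1) 0) with ha
  have hra : Tendsto r atTop (𝓝 a) := by
    have h1 := ((tendsto_inv_atTop_nhds_zero_nat (𝕜 := ℝ)).mul hr).add_const a
    rw [zero_mul, zero_add] at h1
    refine h1.congr' ?_
    filter_upwards [eventually_ne_atTop 0] with N hN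
    have : (N : ℝ) ≠ 0 := by positivity
    rw [inv_mul_cancel_left₀ this, sub_add_cancel]
  refine tendsto_pottsMeasure_of_hasLocalLimit hp hd hβ hh hcrit hM (fun N => Set.Iic (r N))
    fun m hm => ?_
  split_ifs with h2
  · have := hasLocalLimit_uniform hp hd hβ hh hcrit (hmem m hm) h0 h2
      (G := fun N x => if x ∈ Set.Iic (r N) then 1 else 0)
      (g := (Set.Iic ρ).indicator 1) (B := 0) (C := 1) (ρ := ρ)
      (measurable_one.indicator measurableSet_Iic) le_rfl zero_le_one
      (Eventually.of_forall fun N x => ?_) fun z hz v hv => ?_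
    · have hms : MeasurableSet {y : Fin d → ℝ | curvature p d * ∑ r, hyper y r ^ 2 ≤ ρ} :=
        measurableSet_le (((continuous_finsetSum _ fun r _ =>
          ((continuous_apply r).comp continuous_hyper).pow 2).measurable).const_mul _)
          measurable_const
      have e : (fun y : Fin d → ℝ => (Set.Iic ρ).indicator (1 : ℝ → ℝ)
          (curvature p d * ∑ r, hyper y r ^ 2)) =
          {y : Fin d → ℝ | curvature p d * ∑ r, hyper y r ^ 2 ≤ ρ}.indicator 1 := rfl
      rwa [e, integral_indicator_one hms, mul_assoc] at this
    · have : (1 : ℝ) ≤ 1 * (1 + N * |x - powerSum p (xvec (d + 1) 0)|) *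
          Real.exp (0 * √N * |x - powerSum p (xvec (d + 1) 0)|) := by
        rw [zero_mul, zero_mul, Real.exp_zero, one_mul, mul_one]
        have : 0 ≤ (N : ℝ) * |x - powerSum p (xvec (d + 1) 0)| := by positivity
        linarith
      refine le_trans ?_ this
      split_ifs <;> simp
    · have hiff : ∀ N : ℕ, N ≠ 0 → (a + (N : ℝ)⁻¹ * v N ∈ Set.Iic (r N) ↔
          v N ≤ (N : ℝ) * (r N - a)) := fun N hN => by
        have : 0 < (N : ℝ) := by positivity
        rw [Set.mem_Iic, ← div_eq_inv_mul, ← le_sub_iff_add_le', div_le_iff₀' this]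
      rcases hz.lt_or_gt with h3 | h3
      · rw [Set.indicator_of_mem (Set.mem_Iic.2 h3.le), Pi.one_apply]
        refine tendsto_const_nhds.congr' ?_
        filter_upwards [hv.eventually_lt hr h3, eventually_ne_atTop 0] with N hN hN0
        exact (if_pos ((hiff N hN0).2 hN.le)).symm
      · rw [Set.indicator_of_notMem (fun h4 => not_lt.2 (Set.mem_Iic.1 h4) h3)]
        refine tendsto_const_nhds.congr' ?_
        filter_upwards [hr.eventually_lt hv h3, eventually_ne_atTop 0] with N hN hN0
        exact (if_neg fun h4 => not_le.2 hN ((hiff N hN0).1 h4)).symm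
  · rw [mul_zero]
    exact hasLocalLimit_Iic_of_gt hp hd hβ hh hcrit (hmem m hm)
      (lt_of_le_of_ne (powerSum_mem_Ico hp hd hβ hh hcrit (hmem m hm)).2 (Ne.symm h2)) hra

end Critical

/-! ### Extremal configurations -/

theorem fluctuationLaw_real_eq_zero {d : ℕ} (hd : d ≠ 0) {α γ : ℝ} (hα : 0 < α)
    (hγ : 0 < α + d * γ) {A : Set (Fin d → ℝ)} (hA : MeasurableSet A) (h0 : volume A = 0) :
    (fluctuationLaw d α γ).real A = 0 := by
  have h1 := integral_exp_quadratic hd hα hγ (g := A.indicator 1)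
    (measurable_one.indicator hA)
  rw [integral_indicator_one hA] at h1
  have h2 : ∫ y, Real.exp (-(1 / 2) * (α * ∑ i, y i ^ 2 + γ * (∑ i, y i) ^ 2)) *
      A.indicator 1 y = 0 := by
    rw [← integral_zero (Fin d → ℝ) ℝ]
    refine integral_congr_ae ?_
    filter_upwards [measure_eq_zero_iff_ae_notMem.1 h0] with y hy
    rw [Set.indicator_of_notMem hy, mul_zero]
  rw [h2, mul_zero] at h1
  have h3 : (√α)⁻¹ ^ (d - 1) * (√(α + d * γ))⁻¹ ≠ 0 := by positivity
  exact (mul_eq_zero.1 h1.symm).resolve_left h3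

/-- The configuration in which the colours are distributed cyclically. -/
def cyclicConfig (q N : ℕ) [NeZero q] (i : Fin N) : Fin q := Fin.ofNat q i

theorem colourCount_cyclicConfig (q N : ℕ) [NeZero q] (r : Fin q) :
    colourCount (cyclicConfig q N) r = N / q + if (r : ℕ) < N % q then 1 else 0 := by
  have h1 := Nat.count_modEq_card N (Nat.pos_of_ne_zero (NeZero.ne q)) (r : ℕ)
  rw [Nat.mod_eq_of_lt r.2] at h1
  rw [← h1, Nat.count_eq_card_filter_range, colourCount]
  refine Finset.card_bij (fun i _ => (i : ℕ)) (fun i hi => ?_) (fun i _ j _ hij => Fin.ext hij)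
    fun k hk => ?_
  · rw [Finset.mem_filter] at hi ⊢
    refine ⟨Finset.mem_range.2 i.2, ?_⟩
    rw [Nat.ModEq, Nat.mod_eq_of_lt r.2, ← hi.2]
    rfl
  · rw [Finset.mem_filter, Finset.mem_range] at hk
    refine ⟨⟨k, hk.1⟩, ?_, rfl⟩
    rw [Finset.mem_filter]
    refine ⟨Finset.mem_univ _, Fin.ext ?_⟩
    have := hk.2
    rw [Nat.ModEq, Nat.mod_eq_of_lt r.2] at this
    exact this

theorem abs_magnetization_cyclicConfig_sub_le (q : ℕ) [NeZero q] {N : ℕ} (hN : N ≠ 0) (r : Fin q) :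
    |magnetization q N (cyclicConfig q N) r - 1 / q| ≤ 1 / N := by
  rw [magnetization_eq, colourCount_cyclicConfig]
  have hq : (0 : ℝ) < q := Nat.cast_pos.2 (Nat.pos_of_ne_zero (NeZero.ne q))
  have hN' : (0 : ℝ) < N := by positivity
  have h1 : (q : ℝ) * ((N / q : ℕ) : ℝ) + ((N % q : ℕ) : ℝ) = N := by
    exact_mod_cast Nat.div_add_mod N q
  have h2 : ((N % q : ℕ) : ℝ) < q := by
    exact_mod_cast Nat.mod_lt N (Nat.pos_of_ne_zero (NeZero.ne q))
  have h3 : (0 : ℝ) ≤ ((N % q : ℕ) : ℝ) := Nat.cast_nonneg _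
  set c : ℝ := ((N / q + if (r : ℕ) < N % q then 1 else 0 : ℕ) : ℝ) with hc
  have h4 : c = ((N / q : ℕ) : ℝ) ∨ (c = ((N / q : ℕ) : ℝ) + 1) := by
    rw [hc]; split_ifs <;> simp
  have e : c / N - 1 / q = (c * q - N) / (N * q) := by field_simp
  rw [e, abs_div, abs_of_pos (mul_pos hN' hq), div_le_div_iff₀ (mul_pos hN' hq) hN', one_mul,
    mul_comm (N : ℝ) q]
  refine mul_le_mul_of_nonneg_right ?_ hN'.le
  rw [abs_le]
  rcases h4 with h4 | h4 <;> rw [h4] <;> constructor <;> nlinarith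

/-- The proportions of this configuration differ from 1/q by at most 1/N, so on the fluctuation
scale its deviation tends to 0. It supplies an upper bound for the minimal value of S, accurate to
o(1/N). -/
theorem tendsto_powerSum_cyclicConfig (p d : ℕ) :
    Tendsto (fun N : ℕ => (N : ℝ) * (powerSum p (magnetization (d + 1) N (cyclicConfig (d + 1) N)) -
      powerSum p (xvec (d + 1) 0))) atTop (𝓝 0) := by
  set u : ℕ → Fin d → ℝ := fun N i =>
    √(N : ℝ) * (magnetization (d + 1) N (cyclicConfig (d + 1) N) i.succ - 1 / ((d + 1 : ℕ) : ℝ)) with hu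
  have hu0 : Tendsto u atTop (𝓝 0) := by
    refine tendsto_pi_nhds.2 fun i => squeeze_zero_norm' ?_ tendsto_inv_sqrt_nat
    filter_upwards [eventually_ne_atTop 0] with N hN
    have hs : (0 : ℝ) < √N := by positivity
    rw [hu, Real.norm_eq_abs, abs_mul, abs_of_pos hs]
    calc _ ≤ √(N : ℝ) * (1 / N) :=
          mul_le_mul_of_nonneg_left (abs_magnetization_cyclicConfig_sub_le (d + 1) hN i.succ) hs.le
      _ = (√(N : ℝ))⁻¹ := by
          nth_rewrite 2 [← Real.mul_self_sqrt (Nat.cast_nonneg (α := ℝ) N)]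
          field_simp
  have h1 := tendsto_powerSum_second (p := p) hu0
  have h2 : ∑ r, hyper (0 : Fin d → ℝ) r ^ 2 = 0 := by simp [sum_hyper_sq]
  rw [h2, mul_zero] at h1
  refine h1.congr' ?_
  filter_upwards [eventually_ne_atTop 0] with N hN
  have hs : √(N : ℝ) ≠ 0 := by positivity
  have e : xvec (d + 1) 0 + (√(N : ℝ))⁻¹ • hyper (u N) =
      magnetization (d + 1) N (cyclicConfig (d + 1) N) := by
    have hsucc : ∀ i : Fin d, (xvec (d + 1) 0 + (√(N : ℝ))⁻¹ • hyper (u N)) i.succ =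
        magnetization (d + 1) N (cyclicConfig (d + 1) N) i.succ := fun i => by
      simp only [Pi.add_apply, Pi.smul_apply, smul_eq_mul, hyper, Fin.cons_succ, hu,
        xvec_zero_param]
      rw [inv_mul_cancel_left₀ hs]
      push_cast
      ring
    have hsum : ∑ r, (xvec (d + 1) 0 + (√(N : ℝ))⁻¹ • hyper (u N)) r = 1 := by
      simp only [Pi.add_apply, Pi.smul_apply, smul_eq_mul, Finset.sum_add_distrib,
        ← Finset.mul_sum, sum_hyper, sum_xvec, mul_zero, add_zero]
    have hsum' := (magnetization_mem_stdSimplex hN (cyclicConfig (d + 1) N)).2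
    funext r
    refine Fin.cases ?_ hsucc r
    rw [Fin.sum_univ_succ] at hsum hsum'
    rw [Finset.sum_congr rfl fun i _ => hsucc i] at hsum
    linarith
  rw [e]

theorem powerSum_const_config {p : ℕ} (hp : p ≠ 0) {q N : ℕ} [NeZero q] (hN : N ≠ 0) :
    powerSum p (magnetization q N fun _ => 0) = 1 := by
  have : ∀ r : Fin q, magnetization q N (fun _ => 0) r ^ p = if r = 0 then 1 else 0 := fun r => by
    have hN' : (N : ℝ) ≠ 0 := by exact_mod_cast hN
    by_cases h0 : r = 0
    · simp [magnetization, h0, hN']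
    · simp [magnetization, Ne.symm h0, h0, hp]
  simp [powerSum, this]

section Critical

variable {p : ℕ} (hp : 2 ≤ p) {d : ℕ} (hd : d ≠ 0) {β h : ℝ} (hβ : 0 < β) (hh : 0 ≤ h)
  (hcrit : IsCritical p (d + 1) β h)

include hp hd hβ hh hcrit

theorem tendsto_pottsMeasure_max {M : Finset (Fin (d + 1) → ℝ)}
    (hM : ↑M = maximizers p (d + 1) β h) :
    Tendsto (fun N => (pottsMeasure p (d + 1) N β h).real
      {X | powerSum p (magnetization (d + 1) N X) ∈ Set.Ici 1}) atTop (𝓝 0) := by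
  have hmem : ∀ m ∈ M, m ∈ maximizers p (d + 1) β h := fun m hm => by
    rw [← hM]; exact Finset.mem_coe.2 hm
  have := tendsto_pottsMeasure_of_hasLocalLimit hp hd hβ hh hcrit hM (fun _ => Set.Ici 1)
    (l := fun _ => 0) fun m hm => ?_
  · simpa using this
  · rw [mul_zero]
    have hlt := (powerSum_mem_Ico hp hd hβ hh hcrit (hmem m hm)).1
    refine hasLocalLimit_zero hp hd hβ hh hcrit (hmem m hm) (tendsto_const_nhds (x := (0 : ℝ)))
      (sub_pos.2 hlt) (Eventually.of_forall fun N x hx => ?_)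
    rw [if_neg (fun h1 => by linarith [(abs_lt.1 hx).2, Set.mem_Ici.1 h1]), abs_zero]

/-- If the uniform vector is a maximizer, the limit is the probability that a positive definite form
of a Gaussian vector is at most 0, which vanishes. Otherwise every maximizer has S strictly above
the threshold. -/
theorem tendsto_pottsMeasure_min {M : Finset (Fin (d + 1) → ℝ)}
    (hM : ↑M = maximizers p (d + 1) β h) {r : ℕ → ℝ}
    (hr : Tendsto (fun N : ℕ => (N : ℝ) * (r N - powerSum p (xvec (d + 1) 0))) atTop (𝓝 0)) :
    Tendsto (fun N => (pottsMeasure p (d + 1) N β h).real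
      {X | powerSum p (magnetization (d + 1) N X) ≤ r N}) atTop (𝓝 0) := by
  have hmem : ∀ m ∈ M, m ∈ maximizers p (d + 1) β h := fun m hm => by
    rw [← hM]; exact Finset.mem_coe.2 hm
  by_cases h0 : 0 ∈ freeFunMaximizers p (d + 1) β h
  · have h1 := tendsto_pottsMeasure_Iic_uniform hp hd hβ hh hcrit hM h0 hr
    have hα : 0 < -kDeriv2 p β (1 / (d + 1)) := by
      have := (nondegenerateAt_of_mem hp hd hβ hh hcrit h0).neg_b
      rw [show bCoord d 0 = 1 / (d + 1) by simp [bCoord]] at this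
      linarith
    have hz : (fluctuationLaw d (-kDeriv2 p β (1 / (d + 1))) (-kDeriv2 p β (1 / (d + 1)))).real
        {y | curvature p d * ∑ r, hyper y r ^ 2 ≤ 0} = 0 := by
      refine fluctuationLaw_real_eq_zero hd hα (by positivity) (measurableSet_le
        (((continuous_finsetSum _ fun r _ => ((continuous_apply r).comp
          continuous_hyper).pow 2).measurable).const_mul _) measurable_const) ?_
      refine measure_mono_null (fun y hy => ?_) (volume_hyper_sq_eq hd 0)
      have h2 : curvature p d * ∑ r, hyper y r ^ 2 ≤ 0 := hy
      have h3 : 0 ≤ ∑ r, hyper y r ^ 2 := Finset.sum_nonneg fun _ _ => sq_nonneg _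
      have h4 := curvature_pos hp d
      refine le_antisymm ?_ h3
      by_contra h5
      push Not at h5
      have := mul_pos h4 h5
      linarith
    rw [hz] at h1
    simpa using h1
  · have hra : Tendsto r atTop (𝓝 (powerSum p (xvec (d + 1) 0))) := by
      have h1 := ((tendsto_inv_atTop_nhds_zero_nat (𝕜 := ℝ)).mul hr).add_const
        (powerSum p (xvec (d + 1) 0))
      rw [zero_mul, zero_add] at h1
      refine h1.congr' ?_
      filter_upwards [eventually_ne_atTop 0] with N hN
      have : (N : ℝ) ≠ 0 := by positivity
      rw [inv_mul_cancel_left₀ this, sub_add_cancel]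
    have h1 := tendsto_pottsMeasure_of_hasLocalLimit hp hd hβ hh hcrit hM
      (fun N => Set.Iic (r N)) (l := fun _ => 0) fun m hm => ?_
    · simpa using h1
    · rw [mul_zero]
      refine hasLocalLimit_Iic_of_gt hp hd hβ hh hcrit (hmem m hm) ?_ hra
      obtain ⟨s, hs, j, -, rfl⟩ := exists_perm_of_mem_maximizers hp hd hβ hh hcrit (hmem m hm)
      have hsI := (mem_freeFunMaximizers_iff.1 hs).1
      have hs0 : 0 < s := hsI.1.lt_of_ne (by rintro rfl; exact h0 hs)
      rw [powerSum_comp_perm]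
      exact powerSum_xvec_strictMonoOn hp hd (Set.left_mem_Icc.2 zero_le_one) hsI hs0

/-- With high probability the sum of powers is neither maximal nor minimal. -/
theorem tendsto_pottsMeasure_extremal :
    Tendsto (fun N => (pottsMeasure p (d + 1) N β h).real
      {X | (∀ Y : Fin N → Fin (d + 1), powerSum p (magnetization (d + 1) N Y) ≤
          powerSum p (magnetization (d + 1) N X)) ∨
        ∀ Y : Fin N → Fin (d + 1), powerSum p (magnetization (d + 1) N X) ≤
          powerSum p (magnetization (d + 1) N Y)}) atTop (𝓝 0) := by
  have hM := (finite_maximizers hp hd hβ hh hcrit).coe_toFinset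
  have h1 := (tendsto_pottsMeasure_max hp hd hβ hh hcrit hM).add
    (tendsto_pottsMeasure_min hp hd hβ hh hcrit hM (tendsto_powerSum_cyclicConfig p d))
  rw [add_zero] at h1
  refine squeeze_zero' (Eventually.of_forall fun N => measureReal_nonneg) ?_ h1
  filter_upwards [eventually_ne_atTop 0] with N hN
  refine (measureReal_mono ?_).trans (measureReal_union_le _ _)
  -- A maximal S is compared with the constant configuration, where S = 1, and a minimal S with the
  -- cyclic one.
  rintro X (hX | hX)
  · have := hX fun _ => 0
    rw [powerSum_const_config (by omega) hN] at this
    exact Or.inl this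
  · exact Or.inr (hX _)

end Critical

/-! ### The maximum likelihood estimator -/

theorem hasDerivAt_sum_exp {ι : Type*} [Fintype ι] (w c : ι → ℝ) (b : ℝ) :
    HasDerivAt (fun b => ∑ k, w k * Real.exp (b * c k)) (∑ k, w k * c k * Real.exp (b * c k)) b := by
  refine HasDerivAt.fun_sum fun k _ => ?_
  refine (((hasDerivAt_id b).mul_const (c k)).exp.const_mul (w k)).congr_deriv ?_
  simp only [id]
  ring

/-- Rates of both signs make the sum tend to infinity at both ends of the line. -/
theorem exists_isMinOn_sum_exp {ι : Type*} [Fintype ι] {w c : ι → ℝ} (hw : ∀ k, 0 < w k) {i j : ι}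
    (hi : c i < 0) (hj : 0 < c j) :
    ∃ b, IsMinOn (fun b => ∑ k, w k * Real.exp (b * c k)) Set.univ b := by
  have hcont : Continuous fun b : ℝ => ∑ k, w k * Real.exp (b * c k) := by fun_prop
  have hlow : ∀ (k : ι) (b : ℝ), w k * Real.exp (b * c k) ≤ ∑ k, w k * Real.exp (b * c k) :=
    fun k b => Finset.single_le_sum (f := fun k => w k * Real.exp (b * c k))
      (fun k _ => mul_nonneg (hw k).le (Real.exp_nonneg _)) (Finset.mem_univ k)
  have hlim : Tendsto (fun b : ℝ => ∑ k, w k * Real.exp (b * c k)) (cocompact ℝ) atTop := by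
    rw [cocompact_eq_atBot_atTop, tendsto_sup]
    constructor
    · refine tendsto_atTop_mono (hlow i) ?_
      exact (Real.tendsto_exp_atTop.comp (tendsto_id.atBot_mul_const_of_neg hi)).const_mul_atTop (hw i)
    · refine tendsto_atTop_mono (hlow j) ?_
      exact (Real.tendsto_exp_atTop.comp (tendsto_id.atTop_mul_const hj)).const_mul_atTop (hw j)
  obtain ⟨b, hb⟩ := hcont.exists_forall_le hlim
  exact ⟨b, fun x _ => hb x⟩

/-- By strict convexity the derivative is strictly increasing, and it vanishes at the minimizer; its
sign at b therefore locates b. -/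
theorem le_iff_of_isMinOn_sum_exp {ι : Type*} [Fintype ι] {w c : ι → ℝ} (hw : ∀ k, 0 < w k) {i : ι}
    (hi : c i < 0) {b₀ : ℝ}
    (hb₀ : IsMinOn (fun b => ∑ k, w k * Real.exp (b * c k)) Set.univ b₀) (b : ℝ) :
    b₀ ≤ b ↔ 0 ≤ ∑ k, w k * c k * Real.exp (b * c k) := by
  have h0 := (hb₀.isLocalMin univ_mem).hasDerivAt_eq_zero (hasDerivAt_sum_exp w c b₀)
  have hmono : StrictMono fun b => ∑ k, w k * c k * Real.exp (b * c k) := fun x y hxy => by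
    have hle : ∀ k, c k * Real.exp (x * c k) ≤ c k * Real.exp (y * c k) := fun k => by
      rcases le_total 0 (c k) with hk | hk
      · exact mul_le_mul_of_nonneg_left (Real.exp_le_exp.2 (mul_le_mul_of_nonneg_right hxy.le hk)) hk
      · exact mul_le_mul_of_nonpos_left (Real.exp_le_exp.2 (mul_le_mul_of_nonpos_right hxy.le hk)) hk
    refine Finset.sum_lt_sum (fun k _ => ?_) ⟨i, Finset.mem_univ i, ?_⟩
    · rw [mul_assoc, mul_assoc]
      exact mul_le_mul_of_nonneg_left (hle k) (hw k).le
    · rw [mul_assoc, mul_assoc]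
      exact mul_lt_mul_of_pos_left (mul_lt_mul_of_neg_left
        (Real.exp_lt_exp.2 (mul_lt_mul_of_neg_right hxy hi)) hi) (hw i)
  rw [← hmono.le_iff_le]
  simp only [h0]

theorem pottsProb_eq_div (p q N : ℕ) [NeZero q] (b h : ℝ) (X : Fin N → Fin q) :
    pottsProb p q N b h X = Real.exp (N * (h * magnetization q N X 0)) /
      ∑ Y : Fin N → Fin q, Real.exp (N * (h * magnetization q N Y 0)) *
        Real.exp (b * (N * (powerSum p (magnetization q N Y) -
          powerSum p (magnetization q N X)))) := by
  have hq : (q : ℝ) ^ N ≠ 0 := pow_ne_zero _ (Nat.cast_ne_zero.mpr (NeZero.ne q))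
  have h1 : ∑ Y : Fin N → Fin q, Real.exp (energy p q N b h Y) =
      Real.exp (b * (N * powerSum p (magnetization q N X))) *
      ∑ Y : Fin N → Fin q, Real.exp (N * (h * magnetization q N Y 0)) *
        Real.exp (b * (N * (powerSum p (magnetization q N Y) -
          powerSum p (magnetization q N X)))) := by
    rw [Finset.mul_sum]
    refine Finset.sum_congr rfl fun Y _ => ?_
    rw [← Real.exp_add, ← Real.exp_add, energy_eq]
    congr 1
    ring
  have h2 : Real.exp (energy p q N b h X) = Real.exp (b * (N * powerSum p (magnetization q N X))) *
      Real.exp (N * (h * magnetization q N X 0)) := by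
    rw [← Real.exp_add, energy_eq]
    congr 1
    ring
  rw [pottsProb, partitionFunction, mul_div_cancel₀ _ hq, h1, h2, one_div_mul_eq_div,
    mul_div_mul_left _ _ (Real.exp_ne_zero _)]

/-- When the sufficient statistic is not extremal, the estimator is characterized by the
likelihood equation. -/
theorem mle_le_iff {p q : ℕ} [NeZero q] {h : ℝ} {βhat : (N : ℕ) → (Fin N → Fin q) → ℝ}
    (hβhat : IsMLE p q h βhat) {N : ℕ} (hN : N ≠ 0) {X Y Y' : Fin N → Fin q}
    (hY : powerSum p (magnetization q N Y) < powerSum p (magnetization q N X))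
    (hY' : powerSum p (magnetization q N X) < powerSum p (magnetization q N Y')) (b : ℝ) :
    βhat N X ≤ b ↔ powerSum p (magnetization q N X) ≤ meanPowerSum p q N b h := by
  have hN' : (0 : ℝ) < N := by positivity
  set w : (Fin N → Fin q) → ℝ := fun Y => Real.exp (N * (h * magnetization q N Y 0)) with hw
  set c : (Fin N → Fin q) → ℝ := fun Y => N * (powerSum p (magnetization q N Y) -
    powerSum p (magnetization q N X)) with hc
  have hwpos : ∀ Y, 0 < w Y := fun Y => Real.exp_pos _
  have hcY : c Y < 0 := mul_neg_of_pos_of_neg hN' (sub_neg.2 hY)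
  have hcY' : 0 < c Y' := mul_pos hN' (sub_pos.2 hY')
  -- With the numerator free of b, maximizing the likelihood amounts to minimizing the denominator,
  -- a sum of exponentials with positive weights.
  have hiff : ∀ b₀, IsMaxOn (fun b' => pottsProb p q N b' h X) Set.univ b₀ ↔
      IsMinOn (fun b => ∑ Y, w Y * Real.exp (b * c Y)) Set.univ b₀ := fun b₀ => by
    have hpos : ∀ b : ℝ, 0 < ∑ Y, w Y * Real.exp (b * c Y) := fun b =>
      Finset.sum_pos (fun Y _ => mul_pos (hwpos Y) (Real.exp_pos _)) Finset.univ_nonempty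
    refine forall₂_congr fun b' _ => ?_
    simp only [Set.mem_ofPred_eq, pottsProb_eq_div]
    exact div_le_div_iff_of_pos_left (hwpos X) (hpos b') (hpos b₀)
  obtain ⟨b₀, hb₀⟩ := exists_isMinOn_sum_exp hwpos hcY hcY'
  have hmin := (hiff _).1 (hβhat N X ⟨b₀, (hiff b₀).2 hb₀⟩)
  rw [le_iff_of_isMinOn_sum_exp hwpos hcY hmin, meanPowerSum, le_div_iff₀ (gibbsSum_one_pos p q N b h)]
  -- The derivative is a positive multiple of the unnormalized difference between the mean of S
  -- under b and the observed S.
  have e : ∑ Y, w Y * c Y * Real.exp (b * c Y) =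
      N * Real.exp (-(b * (N * powerSum p (magnetization q N X)))) *
      ((gibbsSum p b h N fun t : Fin q → ℝ => powerSum p t) -
        powerSum p (magnetization q N X) * gibbsSum p b h N fun _ : Fin q → ℝ => 1) := by
    rw [gibbsSum, gibbsSum, Finset.mul_sum, ← Finset.sum_sub_distrib, Finset.mul_sum]
    refine Finset.sum_congr rfl fun Y _ => ?_
    have h2 : w Y * Real.exp (b * c Y) = Real.exp (energy p q N b h Y) *
        Real.exp (-(b * (N * powerSum p (magnetization q N X)))) := by
      rw [hw, hc, ← Real.exp_add, ← Real.exp_add, energy_eq]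
      congr 1
      ring
    rw [mul_right_comm, h2, hc]
    ring
  rw [e]
  have hk : 0 < N * Real.exp (-(b * (N * powerSum p (magnetization q N X)))) :=
    mul_pos hN' (Real.exp_pos _)
  rw [mul_nonneg_iff_of_pos_left hk, sub_nonneg]

/-! ### Convergence in distribution from distribution functions -/

/-- A chain is closed under pairwise unions and intersections, so differences of its members form a
π-system, and their measures converge by subtraction. This replaces the convergence criterion by
distribution functions and serves ℝ and the extended line alike. -/
theorem tendsto_probabilityMeasure_of_chain {E ι : Type*} [TopologicalSpace E]
    [SecondCountableTopology E] [MeasurableSpace E] [OpensMeasurableSpace E] {l : Filter ι}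
    [l.IsCountablyGenerated] {μ : ι → ProbabilityMeasure E} {ν : ProbabilityMeasure E}
    {D : Set (Set E)} (hchain : ∀ U ∈ D, ∀ V ∈ D, U ⊆ V ∨ V ⊆ U)
    (hmeas : ∀ U ∈ D, MeasurableSet U)
    (hconv : ∀ U ∈ D, Tendsto (fun i => (μ i : Measure E).real U) l (𝓝 ((ν : Measure E).real U)))
    (hnhds : ∀ u : Set E, IsOpen u → ∀ x ∈ u, ∃ U ∈ D, ∃ V ∈ D, U \ V ∈ 𝓝 x ∧ U \ V ⊆ u) :
    Tendsto μ l (𝓝 ν) := by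
  have hpi : IsPiSystem {s | ∃ U ∈ D, ∃ V ∈ D, s = U \ V} := by
    rintro _ ⟨U, hU, V, hV, rfl⟩ _ ⟨U', hU', V', hV', rfl⟩ -
    have h1 : ∃ W ∈ D, U ∩ U' = W := by
      rcases hchain U hU U' hU' with h0 | h0
      · exact ⟨U, hU, Set.inter_eq_left.2 h0⟩
      · exact ⟨U', hU', Set.inter_eq_right.2 h0⟩
    have h2 : ∃ W ∈ D, V ∪ V' = W := by
      rcases hchain V hV V' hV' with h0 | h0
      · exact ⟨V', hV', Set.union_eq_right.2 h0⟩
      · exact ⟨V, hV, Set.union_eq_left.2 h0⟩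
    obtain ⟨W, hW, e1⟩ := h1
    obtain ⟨W', hW', e2⟩ := h2
    refine ⟨W, hW, W', hW', ?_⟩
    rw [← e1, ← e2]
    ext x
    simp only [Set.mem_inter_iff, Set.mem_sdiff, Set.mem_union]
    tauto
  refine hpi.tendsto_probabilityMeasure_of_tendsto_of_mem ?_ ?_ ?_
  · rintro _ ⟨U, hU, V, hV, rfl⟩
    exact (hmeas U hU).diff (hmeas V hV)
  · intro u hu x hx
    obtain ⟨U, hU, V, hV, h1, h2⟩ := hnhds u hu x hx
    exact ⟨_, ⟨U, hU, V, hV, rfl⟩, h1, h2⟩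
  · rintro _ ⟨U, hU, V, hV, rfl⟩
    rw [← NNReal.tendsto_coe]
    change Tendsto (fun i => (μ i : Measure E).real (U \ V)) l (𝓝 ((ν : Measure E).real (U \ V)))
    rcases hchain U hU V hV with h0 | h0
    · simp only [Set.sdiff_eq_empty.2 h0, measureReal_empty]
      exact tendsto_const_nhds
    · have e : ∀ P : ProbabilityMeasure E, (P : Measure E).real (U \ V) =
          (P : Measure E).real U - (P : Measure E).real V := fun P =>
        measureReal_sdiff h0 (hmeas V hV)
      simp only [e]
      exact (hconv U hU).sub (hconv V hV)

theorem exists_ne_zero_between {a b : ℝ} (hab : a < b) : ∃ t, t ≠ 0 ∧ a < t ∧ t < b := by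
  obtain ⟨t, h1, h2⟩ := exists_between hab
  by_cases h0 : t = 0
  · obtain ⟨u, h3, h4⟩ := exists_between h2
    exact ⟨u, by rintro rfl; exact absurd h0 h3.ne, h1.trans h3, h4⟩
  · exact ⟨t, h0, h1, h2⟩

/-- The point 0 is left out because the limit laws may have an atom there; nonzero thresholds are
dense and suffice. -/
theorem convergesUnderPotts_of_cdf {p q : ℕ} [NeZero q] {β h : ℝ}
    {T : (N : ℕ) → (Fin N → Fin q) → ℝ} {ν : Measure ℝ} [hν : IsProbabilityMeasure ν]
    (hcdf : ∀ t : ℝ, t ≠ 0 → Tendsto (fun N => (pottsMeasure p q N β h).real {X | T N X ≤ t}) atTop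
      (𝓝 (ν.real (Set.Iic t)))) : ConvergesUnderPotts p q β h T ν := by
  refine ⟨hν, ⟨fun N => (measurable_of_finite _).aemeasurable, aemeasurable_id, ?_⟩⟩
  refine tendsto_probabilityMeasure_of_chain (D := Set.Iic '' {t : ℝ | t ≠ 0}) ?_ ?_ ?_ ?_
  · rintro _ ⟨s, -, rfl⟩ _ ⟨t, -, rfl⟩
    simpa using le_total s t
  · rintro _ ⟨t, -, rfl⟩
    exact measurableSet_Iic
  · rintro _ ⟨t, ht, rfl⟩
    simp only [ProbabilityMeasure.coe_mk, Measure.map_id]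
    refine (hcdf t ht).congr fun N => ?_
    rw [map_measureReal_apply (measurable_of_finite _) measurableSet_Iic]
    rfl
  · intro u hu x hx
    obtain ⟨a, b, hab, hsub⟩ := mem_nhds_iff_exists_Ioo_subset.1 (hu.mem_nhds hx)
    obtain ⟨s, hs, has, hsx⟩ := exists_ne_zero_between hab.1
    obtain ⟨t, ht, hxt, htb⟩ := exists_ne_zero_between hab.2
    refine ⟨_, ⟨t, ht, rfl⟩, _, ⟨s, hs, rfl⟩, ?_, ?_⟩
    · filter_upwards [Ioo_mem_nhds hsx hxt] with y hy
      exact ⟨hy.2.le, not_le.2 hy.1⟩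
    · rintro y ⟨hy1, hy2⟩
      exact hsub ⟨has.trans (not_le.1 hy2), lt_of_le_of_lt hy1 htb⟩

theorem exists_real_ne_zero_between {a b : EReal} (hab : a < b) :
    ∃ t : ℝ, t ≠ 0 ∧ a < t ∧ (t : EReal) < b := by
  obtain ⟨s, h1, h2⟩ := EReal.lt_iff_exists_real_btwn.1 hab
  obtain ⟨t, h3, h4⟩ := EReal.lt_iff_exists_real_btwn.1 h2
  obtain ⟨u, hu, h5, h6⟩ := exists_ne_zero_between (EReal.coe_lt_coe_iff.1 h3)
  exact ⟨u, hu, h1.trans (EReal.coe_lt_coe_iff.2 h5), (EReal.coe_lt_coe_iff.2 h6).trans h4⟩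

/-- The empty set and the whole space join the chain in order to produce neighbourhoods of -∞ and
+∞. -/
theorem convergesUnderPotts_coe_of_cdf {p q : ℕ} [NeZero q] {β h : ℝ}
    {T : (N : ℕ) → (Fin N → Fin q) → ℝ} {ν : Measure EReal} [hν : IsProbabilityMeasure ν]
    (hcdf : ∀ t : ℝ, t ≠ 0 → Tendsto (fun N => (pottsMeasure p q N β h).real {X | T N X ≤ t}) atTop
      (𝓝 (ν.real (Set.Iic (t : EReal))))) :
    ConvergesUnderPotts p q β h (fun N X => (T N X : EReal)) ν := by
  refine ⟨hν, ⟨fun N => (measurable_of_finite _).aemeasurable, aemeasurable_id, ?_⟩⟩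
  refine tendsto_probabilityMeasure_of_chain
    (D := insert ∅ (insert Set.univ ((fun t : ℝ => Set.Iic (t : EReal)) '' {t : ℝ | t ≠ 0})))
    ?_ ?_ ?_ ?_
  · rintro _ (rfl | rfl | ⟨s, -, rfl⟩) _ (rfl | rfl | ⟨t, -, rfl⟩) <;> simp
    exact le_total s t
  · rintro _ (rfl | rfl | ⟨t, -, rfl⟩)
    · exact MeasurableSet.empty
    · exact MeasurableSet.univ
    · exact measurableSet_Iic
  · rintro _ (rfl | rfl | ⟨t, ht, rfl⟩)
    · simp
    · simp only [ProbabilityMeasure.coe_mk, Measure.map_id,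
        map_measureReal_apply (measurable_of_finite _) MeasurableSet.univ, Set.preimage_univ,
        probReal_univ]
      exact tendsto_const_nhds
    · simp only [ProbabilityMeasure.coe_mk, Measure.map_id]
      refine (hcdf t ht).congr fun N => ?_
      rw [map_measureReal_apply (measurable_of_finite _) measurableSet_Iic]
      congr 1
      ext X
      simp
  · intro u hu x hx
    have hlow : ∃ V ∈ insert ∅ (insert Set.univ
        ((fun t : ℝ => Set.Iic (t : EReal)) '' {t : ℝ | t ≠ 0})), Vᶜ ∈ 𝓝 x ∧
        ∀ y ∉ V, y ≤ x → y ∈ u := by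
      rcases eq_or_ne x ⊥ with rfl | hbot
      · refine ⟨∅, Or.inl rfl, by simp, fun y _ hy => ?_⟩
        rw [le_bot_iff.1 hy]; exact hx
      · obtain ⟨a, hax, ha⟩ := exists_Ioc_subset_of_mem_nhds (hu.mem_nhds hx)
          ⟨⊥, bot_lt_iff_ne_bot.2 hbot⟩
        obtain ⟨t, ht, hat, htx⟩ := exists_real_ne_zero_between hax
        refine ⟨_, Or.inr (Or.inr ⟨t, ht, rfl⟩), ?_, fun y hy hyx => ha ⟨?_, hyx⟩⟩
        · rw [Set.compl_Iic]; exact Ioi_mem_nhds htx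
        · exact hat.trans (not_le.1 hy)
    have hhigh : ∃ V ∈ insert ∅ (insert Set.univ
        ((fun t : ℝ => Set.Iic (t : EReal)) '' {t : ℝ | t ≠ 0})), V ∈ 𝓝 x ∧
        ∀ y ∈ V, x ≤ y → y ∈ u := by
      rcases eq_or_ne x ⊤ with rfl | htop
      · refine ⟨Set.univ, Or.inr (Or.inl rfl), by simp, fun y _ hy => ?_⟩
        rw [top_le_iff.1 hy]; exact hx
      · obtain ⟨b, hxb, hb⟩ := exists_Ico_subset_of_mem_nhds (hu.mem_nhds hx)
          ⟨⊤, lt_top_iff_ne_top.2 htop⟩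
        obtain ⟨t, ht, hxt, htb⟩ := exists_real_ne_zero_between hxb
        refine ⟨_, Or.inr (Or.inr ⟨t, ht, rfl⟩), Iic_mem_nhds hxt, fun y hy hyx => hb ⟨hyx, ?_⟩⟩
        exact lt_of_le_of_lt hy htb
    obtain ⟨V, hV, hVn, hVs⟩ := hlow
    obtain ⟨U, hU, hUn, hUs⟩ := hhigh
    refine ⟨U, hU, V, hV, Filter.inter_mem hUn hVn, fun y hy => ?_⟩
    rcases le_total y x with h1 | h1
    · exact hVs y hy.2 h1
    · exact hUs y hy.1 h1

/-! ### The distribution function of the estimator -/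

/-- Off the event that S is extremal the two events coincide, and that event has vanishing
probability. The arbitrary values of the estimator when no maximizer exists are thus harmless. -/
theorem tendsto_mle_cdf {p : ℕ} (hp : 2 ≤ p) {d : ℕ} (hd : d ≠ 0) {β h : ℝ} (hβ : 0 < β)
    (hh : 0 ≤ h) (hcrit : IsCritical p (d + 1) β h)
    {βhat : (N : ℕ) → (Fin N → Fin (d + 1)) → ℝ} (hβhat : IsMLE p (d + 1) h βhat) {t L : ℝ}
    (hL : Tendsto (fun N : ℕ => (pottsMeasure p (d + 1) N β h).real
      {X | powerSum p (magnetization (d + 1) N X) ≤ meanPowerSum p (d + 1) N (β + t / √N) h})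
      atTop (𝓝 L)) :
    Tendsto (fun N : ℕ => (pottsMeasure p (d + 1) N β h).real
      {X | √(N : ℝ) * (βhat N X - β) ≤ t}) atTop (𝓝 L) := by
  have hE := tendsto_pottsMeasure_extremal hp hd hβ hh hcrit
  have key : ∀ N : ℕ, N ≠ 0 → ∀ X : Fin N → Fin (d + 1),
      X ∉ {X : Fin N → Fin (d + 1) | (∀ Y : Fin N → Fin (d + 1),
        powerSum p (magnetization (d + 1) N Y) ≤ powerSum p (magnetization (d + 1) N X)) ∨
        ∀ Y : Fin N → Fin (d + 1), powerSum p (magnetization (d + 1) N X) ≤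
          powerSum p (magnetization (d + 1) N Y)} →
      (√(N : ℝ) * (βhat N X - β) ≤ t ↔
        powerSum p (magnetization (d + 1) N X) ≤ meanPowerSum p (d + 1) N (β + t / √N) h) :=
    fun N hN X hX => by
      simp only [Set.mem_ofPred_eq, not_or] at hX
      push Not at hX
      obtain ⟨⟨Y', hY'⟩, Y, hY⟩ := hX
      have hs : (0 : ℝ) < √N := by positivity
      rw [← mle_le_iff hβhat hN hY hY', ← le_div_iff₀' hs, sub_le_iff_le_add']
  have h1 := hL.add hE
  have h2 := hL.sub hE
  rw [add_zero] at h1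
  rw [sub_zero] at h2
  refine tendsto_of_tendsto_of_tendsto_of_le_of_le' h2 h1 ?_ ?_
  · filter_upwards [eventually_ne_atTop 0] with N hN
    rw [sub_le_iff_le_add]
    refine (measureReal_mono fun X hX => ?_).trans (measureReal_union_le _ _)
    by_cases hXE : X ∈ {X : Fin N → Fin (d + 1) | (∀ Y : Fin N → Fin (d + 1),
        powerSum p (magnetization (d + 1) N Y) ≤ powerSum p (magnetization (d + 1) N X)) ∨
        ∀ Y : Fin N → Fin (d + 1), powerSum p (magnetization (d + 1) N X) ≤
          powerSum p (magnetization (d + 1) N Y)}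
    · exact Or.inr hXE
    · exact Or.inl ((key N hN X hXE).2 hX)
  · filter_upwards [eventually_ne_atTop 0] with N hN
    refine (measureReal_mono fun X hX => ?_).trans (measureReal_union_le _ _)
    by_cases hXE : X ∈ {X : Fin N → Fin (d + 1) | (∀ Y : Fin N → Fin (d + 1),
        powerSum p (magnetization (d + 1) N Y) ≤ powerSum p (magnetization (d + 1) N X)) ∨
        ∀ Y : Fin N → Fin (d + 1), powerSum p (magnetization (d + 1) N X) ≤
          powerSum p (magnetization (d + 1) N Y)}
    · exact Or.inr hXE
    · exact Or.inl ((key N hN X hXE).1 hX)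

/-! ### The limit laws -/

theorem normalLaw_map_neg (v : ℝ) : (normalLaw v).map (fun z => -z) = normalLaw v := by
  rw [normalLaw, gaussianReal_map_neg, neg_zero]

theorem normalLaw_real_neg_preimage (v : ℝ) {A : Set ℝ} (hA : MeasurableSet A) :
    (normalLaw v).real {z | -z ∈ A} = (normalLaw v).real A := by
  conv_rhs => rw [← normalLaw_map_neg v, map_measureReal_apply measurable_neg hA]
  rfl

/-- Rescaling by 1/v; this is how the variance of S turns into its inverse for the estimator. -/
theorem normalLaw_real_Iic_mul {v : ℝ} (hv : 0 < v) (t : ℝ) :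
    (normalLaw v).real (Set.Iic (t * v)) = (normalLaw v⁻¹).real (Set.Iic t) := by
  have h1 : (normalLaw v).map (fun z => v⁻¹ * z) = normalLaw v⁻¹ := by
    rw [normalLaw, gaussianReal_map_const_mul, mul_zero, normalLaw]
    congr 1
    ext
    rw [NNReal.coe_mul, Real.coe_toNNReal _ hv.le, Real.coe_toNNReal _ (inv_pos.2 hv).le,
      NNReal.coe_mk]
    field_simp
  rw [← h1, map_measureReal_apply (by fun_prop) measurableSet_Iic]
  congr 1
  ext z
  rw [Set.mem_preimage, Set.mem_Iic, Set.mem_Iic, ← div_eq_inv_mul, div_le_iff₀ hv]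

instance (v : ℝ) : IsProbabilityMeasure (posHalfNormal v) :=
  Measure.isProbabilityMeasure_map (by fun_prop)

instance (v : ℝ) : IsProbabilityMeasure (negHalfNormal v) :=
  Measure.isProbabilityMeasure_map (by fun_prop)

theorem negHalfNormal_Iic_of_neg (v : ℝ) {t : ℝ} (ht : t < 0) :
    (negHalfNormal v).real (Set.Iic t) = 2 * (normalLaw v).real (Set.Iic t) := by
  rw [negHalfNormal, map_measureReal_apply (by fun_prop) measurableSet_Iic]
  have e : (fun z : ℝ => -|z|) ⁻¹' Set.Iic t = Set.Iic t ∪ {z | -z ∈ Set.Iic t} := by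
    ext z
    simp only [Set.mem_preimage, Set.mem_Iic, Set.mem_union, Set.mem_ofPred_eq]
    rcases abs_cases z with ⟨h1, h2⟩ | ⟨h1, h2⟩ <;> rw [h1]
    · constructor
      · exact Or.inr
      · rintro (h | h) <;> linarith
    · constructor
      · intro h; left; linarith
      · rintro (h | h) <;> linarith
  have hm : MeasurableSet {z : ℝ | -z ∈ Set.Iic t} := measurable_neg measurableSet_Iic
  rw [e, measureReal_union _ hm,
    normalLaw_real_neg_preimage v measurableSet_Iic, two_mul]
  refine Set.disjoint_left.2 fun z hz hz' => ?_
  have h1 : z ≤ t := hz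
  have h2 : -z ≤ t := hz'
  linarith

theorem negHalfNormal_Iic_of_nonneg (v : ℝ) {t : ℝ} (ht : 0 ≤ t) :
    (negHalfNormal v).real (Set.Iic t) = 1 := by
  rw [negHalfNormal, map_measureReal_apply (by fun_prop) measurableSet_Iic]
  have e : (fun z : ℝ => -|z|) ⁻¹' Set.Iic t = Set.univ :=
    Set.eq_univ_of_forall fun z => by
      rw [Set.mem_preimage, Set.mem_Iic]
      linarith [abs_nonneg z]
  rw [e, probReal_univ]

theorem posHalfNormal_Iic_of_neg (v : ℝ) {t : ℝ} (ht : t < 0) :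
    (posHalfNormal v).real (Set.Iic t) = 0 := by
  rw [posHalfNormal, map_measureReal_apply (by fun_prop) measurableSet_Iic]
  have e : (fun z : ℝ => |z|) ⁻¹' Set.Iic t = ∅ :=
    Set.eq_empty_of_forall_notMem fun z hz => by
      rw [Set.mem_preimage, Set.mem_Iic] at hz
      linarith [abs_nonneg z]
  rw [e, measureReal_empty]

theorem posHalfNormal_Iic_of_nonneg (v : ℝ) {t : ℝ} (ht : 0 ≤ t) :
    (posHalfNormal v).real (Set.Iic t) = 2 * (normalLaw v).real (Set.Iic t) - 1 := by
  rw [posHalfNormal, map_measureReal_apply (by fun_prop) measurableSet_Iic]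
  have e : (fun z : ℝ => |z|) ⁻¹' Set.Iic t = (Set.Ioi t ∪ {z | -z ∈ Set.Ioi t})ᶜ := by
    ext z
    simp only [Set.mem_preimage, Set.mem_Iic, Set.mem_compl_iff, Set.mem_union, Set.mem_Ioi,
      Set.mem_ofPred_eq, not_or, not_lt, abs_le]
    constructor
    · rintro ⟨h1, h2⟩; exact ⟨h2, by linarith⟩
    · rintro ⟨h1, h2⟩; exact ⟨by linarith, h1⟩
  have hm : MeasurableSet {z : ℝ | -z ∈ Set.Ioi t} := measurable_neg measurableSet_Ioi
  have hdisj : Disjoint (Set.Ioi t) {z : ℝ | -z ∈ Set.Ioi t} :=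
    Set.disjoint_left.2 fun z hz hz' => by
      have h1 : t < z := hz
      have h2 : t < -z := hz'
      linarith
  have h3 : (normalLaw v).real (Set.Ioi t) = 1 - (normalLaw v).real (Set.Iic t) := by
    rw [← Set.compl_Iic, probReal_compl_eq_one_sub measurableSet_Iic]
  rw [e, probReal_compl_eq_one_sub (measurableSet_Ioi.union hm), measureReal_union hdisj hm,
    normalLaw_real_neg_preimage v measurableSet_Ioi, h3]
  ring

section Mixture

variable {E : Type*} [MeasurableSpace E] {A B C : Measure E} [IsProbabilityMeasure A]
  [IsProbabilityMeasure B] [IsProbabilityMeasure C] {a b c : ℝ}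

theorem mixture_real (ha : 0 ≤ a) (hb : 0 ≤ b) (hc : 0 ≤ c) (S : Set E) :
    (ENNReal.ofReal a • A + ENNReal.ofReal b • B + ENNReal.ofReal c • C).real S =
      a * A.real S + b * B.real S + c * C.real S := by
  have hA := measure_ne_top A S
  have hB := measure_ne_top B S
  have hC := measure_ne_top C S
  simp only [Measure.real, Measure.add_apply, Measure.smul_apply, smul_eq_mul]
  rw [ENNReal.toReal_add (ENNReal.add_ne_top.2 ⟨ENNReal.mul_ne_top ENNReal.ofReal_ne_top hA,
      ENNReal.mul_ne_top ENNReal.ofReal_ne_top hB⟩) (ENNReal.mul_ne_top ENNReal.ofReal_ne_top hC),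
    ENNReal.toReal_add (ENNReal.mul_ne_top ENNReal.ofReal_ne_top hA)
      (ENNReal.mul_ne_top ENNReal.ofReal_ne_top hB),
    ENNReal.toReal_mul, ENNReal.toReal_mul, ENNReal.toReal_mul, ENNReal.toReal_ofReal ha,
    ENNReal.toReal_ofReal hb, ENNReal.toReal_ofReal hc]

theorem isProbabilityMeasure_mixture (ha : 0 ≤ a) (hb : 0 ≤ b) (hc : 0 ≤ c)
    (habc : a + b + c = 1) :
    IsProbabilityMeasure
      (ENNReal.ofReal a • A + ENNReal.ofReal b • B + ENNReal.ofReal c • C) := by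
  constructor
  simp only [Measure.add_apply, Measure.smul_apply, smul_eq_mul, measure_univ, mul_one]
  rw [← ENNReal.ofReal_add ha hb, ← ENNReal.ofReal_add (add_nonneg ha hb) hc, habc,
    ENNReal.ofReal_one]

end Mixture

theorem dirac_real_Iic {E : Type*} [TopologicalSpace E] [LinearOrder E] [OrderClosedTopology E]
    [MeasurableSpace E] [OpensMeasurableSpace E] (a t : E) :
    (Measure.dirac a).real (Set.Iic t) = if a ≤ t then 1 else 0 := by
  rw [Measure.real, Measure.dirac_apply' _ measurableSet_Iic]
  by_cases h : a ≤ t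
  · rw [Set.indicator_of_mem (Set.mem_Iic.2 h), if_pos h]; simp
  · rw [Set.indicator_of_notMem (fun h' => h (Set.mem_Iic.1 h')), if_neg h, ENNReal.toReal_zero]

theorem asympVar_eq {p : ℕ} (hp : 2 ≤ p) {d : ℕ} (hd : d ≠ 0) {β h s : ℝ}
    (H : NondegenerateAt p d β h s) (hs0 : 0 < s) :
    asympVar p (d + 1) β h s (xvec (d + 1) s) = (powerSumVar p d β s)⁻¹ := by
  obtain ⟨k, rfl⟩ := Nat.exists_eq_succ_of_ne_zero hd
  have hone : xvec (k + 1 + 1) s 1 = bCoord (k + 1) s := xvec_succ_eq (k + 1) s 0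
  have hsl := (slope_ne_zero (d := k + 1) hp hs0 H.lt_one).ne
  have hab := H.neg_ab
  rw [asympVar, xvec_zero_eq, hone, freeFun''_eq hp (k + 1) β h (aCoord_pos H.nonneg).ne'
    (bCoord_pos H.lt_one).ne', powerSumVar]
  rw [slope, neg_ne_zero, mul_ne_zero_iff] at hsl
  rw [slope]
  have hne : -kDeriv2 p β (bCoord (k + 1) s) +
      ((k + 1 : ℕ) : ℝ) * -kDeriv2 p β (aCoord (k + 1) s) ≠ 0 := by linarith
  obtain ⟨hp0, hΔ⟩ := hsl
  generalize hA : kDeriv2 p β (aCoord (k + 1) s) = A at *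
  generalize hB : kDeriv2 p β (bCoord (k + 1) s) = B at *
  generalize aCoord (k + 1) s ^ (p - 1) - bCoord (k + 1) s ^ (p - 1) = Δ at *
  push_cast at hne ⊢
  have hk : (k : ℝ) + 1 ≠ 0 := by positivity
  have e : -B + ((k : ℝ) + 1) * -A = -(((k : ℝ) + 1) * A + B) := by ring
  rw [e] at hne ⊢
  have e2 : ((k : ℝ) + 1) * A + B ≠ 0 := fun h0 => hne (by rw [h0, neg_zero])
  rw [show ((k : ℝ) + 1 + 1 - 1) = k + 1 by ring]
  field_simp

theorem lpNorm_lt_of_powerSum_lt {p q : ℕ} (hp : p ≠ 0) {t m : Fin q → ℝ} (ht : ∀ r, 0 ≤ t r)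
    (hm : ∀ r, 0 ≤ m r) (h : powerSum p t < powerSum p m) : lpNorm p q t < lpNorm p q m := by
  have e : ∀ u : Fin q → ℝ, (∀ r, 0 ≤ u r) → ∑ r, |u r| ^ p = powerSum p u := fun u hu =>
    Finset.sum_congr rfl fun r _ => by rw [abs_of_nonneg (hu r)]
  rw [lpNorm, lpNorm, e t ht, e m hm]
  exact Real.rpow_lt_rpow (Finset.sum_nonneg fun r _ => pow_nonneg (ht r) p) h (by positivity)

/-! ### Enumerations of the maximizers -/

section Enumeration

variable {p q : ℕ} [NeZero q] {β h : ℝ} {K : ℕ} {m : ℕ → Fin q → ℝ}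

theorem one_mem_of_bijOn (hm : Set.BijOn m (Set.Icc 1 K) (maximizers p q β h))
    (hne : (maximizers p q β h).Nonempty) : 1 ∈ Set.Icc 1 K := by
  obtain ⟨x, hx⟩ := hne
  obtain ⟨i, hi, -⟩ := hm.surjOn hx
  exact ⟨le_rfl, hi.1.trans hi.2⟩

theorem powerSum_first_le (hp : p ≠ 0) (hm : Set.BijOn m (Set.Icc 1 K) (maximizers p q β h))
    (hmono : MonotoneOn (fun i => lpNorm p q (m i)) (Set.Icc 1 K)) {x : Fin q → ℝ}
    (hx : x ∈ maximizers p q β h) : powerSum p (m 1) ≤ powerSum p x := by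
  have h1 := one_mem_of_bijOn hm ⟨x, hx⟩
  obtain ⟨i, hi, rfl⟩ := hm.surjOn hx
  by_contra hlt
  push Not at hlt
  have := lpNorm_lt_of_powerSum_lt hp (hm.mapsTo hi).1.1 (hm.mapsTo h1).1.1 hlt
  exact absurd (hmono h1 hi hi.1) (not_le.2 this)

theorem sum_enumeration (hm : Set.BijOn m (Set.Icc 1 K) (maximizers p q β h))
    {M : Finset (Fin q → ℝ)} (hM : ↑M = maximizers p q β h) (g : (Fin q → ℝ) → ℝ) :
    ∑ i ∈ Finset.Icc 1 K, g (m i) = ∑ x ∈ M, g x := by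
  rw [← hM, ← Finset.coe_Icc] at hm
  exact Finset.sum_nbij m hm.mapsTo hm.injOn hm.surjOn fun _ _ => rfl

end Enumeration

/-! ### Assembly of the three limit laws -/

section Critical

variable {p : ℕ} (hp : 2 ≤ p) {d : ℕ} (hd : d ≠ 0) {β h : ℝ} (hβ : 0 < β) (hh : 0 ≤ h)
  (hcrit : IsCritical p (d + 1) β h)

include hp hd hβ hh hcrit

theorem freeFunMaximizers_eq_pair {s t : ℝ} (hs : s ∈ freeFunMaximizers p (d + 1) β h)
    (ht : t ∈ freeFunMaximizers p (d + 1) β h) (hst : s < t) :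
    freeFunMaximizers p (d + 1) β h = {s, t} := by
  refine Set.Subset.antisymm (fun u hu => ?_) (by rintro u (rfl | rfl) <;> assumption)
  by_contra hcon
  simp only [Set.mem_insert_iff, Set.mem_singleton_iff, not_or] at hcon
  have key := @not_three_maximizers p hp d hd β h hβ hh hcrit
  rcases lt_or_gt_of_ne hcon.1 with h1 | h1
  · exact key hu hs ht h1 hst
  · rcases lt_or_gt_of_ne hcon.2 with h2 | h2
    · exact key hs hu ht h1 h2
    · exact key hs ht hu hst h2

/-- Convergence of the distribution function when the dominating maximizers are not uniform. -/
theorem tendsto_mle_cdf_normal {βhat : (N : ℕ) → (Fin N → Fin (d + 1)) → ℝ}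
    (hβhat : IsMLE p (d + 1) h βhat) {M : Finset (Fin (d + 1) → ℝ)}
    (hM : ↑M = maximizers p (d + 1) β h) {s : ℝ} (hs : s ∈ freeFunMaximizers p (d + 1) β h)
    (hs0 : 0 < s) {t : ℝ} (ht : t ≠ 0)
    (hdom : ∀ m ∈ M, powerSum p m ≠ powerSum p (xvec (d + 1) s) →
      t * (powerSum p m - powerSum p (xvec (d + 1) s)) < 0) :
    Tendsto (fun N : ℕ => (pottsMeasure p (d + 1) N β h).real
      {X | √(N : ℝ) * (βhat N X - β) ≤ t}) atTop
      (𝓝 ((∑ m ∈ M, if powerSum p m < powerSum p (xvec (d + 1) s) then tau p (d + 1) β h m else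
        if powerSum p m = powerSum p (xvec (d + 1) s) then tau p (d + 1) β h m *
          (normalLaw (asympVar p (d + 1) β h s (xvec (d + 1) s))).real (Set.Iic t) else 0) /
          ∑ m ∈ M, tau p (d + 1) β h m)) := by
  have h1 := tendsto_pottsMeasure_Iic_normal hp hd hβ hh hcrit hM hs hs0
    (tendsto_meanPowerSum_normal hp hd hβ hh hcrit hM hs hs0 ht hdom)
  rw [normalLaw_real_Iic_mul (powerSumVar_pos hp hd hβ hh hcrit hs hs0),
    ← asympVar_eq hp hd (nondegenerateAt_of_mem hp hd hβ hh hcrit hs) hs0] at h1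
  exact tendsto_mle_cdf hp hd hβ hh hcrit hβhat h1

/-- Convergence of the distribution function at negative points when the uniform vector is a
maximizer. -/
theorem tendsto_mle_cdf_uniform {βhat : (N : ℕ) → (Fin N → Fin (d + 1)) → ℝ}
    (hβhat : IsMLE p (d + 1) h βhat) {M : Finset (Fin (d + 1) → ℝ)}
    (hM : ↑M = maximizers p (d + 1) β h) (h0 : 0 ∈ freeFunMaximizers p (d + 1) β h) {t : ℝ}
    (ht : t < 0) :
    Tendsto (fun N : ℕ => (pottsMeasure p (d + 1) N β h).real
      {X | √(N : ℝ) * (βhat N X - β) ≤ t}) atTop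
      (𝓝 ((∑ m ∈ M, if powerSum p m = powerSum p (xvec (d + 1) 0) then
        tau p (d + 1) β h m * gamma1 p (d + 1) β h else 0) / ∑ m ∈ M, tau p (d + 1) β h m)) := by
  have hα : kDeriv2 p β (1 / (d + 1)) < 0 := by
    have := (nondegenerateAt_of_mem hp hd hβ hh hcrit h0).neg_b
    rwa [show bCoord d 0 = 1 / (d + 1) by simp [bCoord]] at this
  have h1 := tendsto_pottsMeasure_Iic_uniform hp hd hβ hh hcrit hM h0
    (tendsto_meanPowerSum_uniform hp hd hβ hh hcrit hM h0 ht)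
  simp only [mul_le_mul_iff_right₀ (curvature_pos hp d)] at h1
  rw [gamma1_eq hp hd hα]
  exact tendsto_mle_cdf hp hd hβ hh hcrit hβhat h1

theorem maximizers_eq_pair_of_field_pos (h0 : 0 < h) {s t : ℝ}
    (hF : freeFunMaximizers p (d + 1) β h = {s, t}) :
    maximizers p (d + 1) β h = {xvec (d + 1) s, xvec (d + 1) t} := by
  ext m
  constructor
  · intro hm
    obtain ⟨u, hu, j, hj, rfl⟩ := exists_perm_of_mem_maximizers hp hd hβ hh hcrit hm
    rw [hj.resolve_left h0.ne', Equiv.swap_self]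
    rw [hF] at hu
    rcases hu with rfl | rfl
    · exact Or.inl rfl
    · exact Or.inr rfl
  · rintro (rfl | rfl)
    · exact xvec_mem_maximizers hp hd hβ hh hcrit (by rw [hF]; exact Or.inl rfl)
    · exact xvec_mem_maximizers hp hd hβ hh hcrit (by rw [hF]; exact Or.inr rfl)

/-- Two positive maximizers of f force h > 0, so H has exactly two maximizers. For t < 0 the level
of s₁ dominates and gives p₁Φ₁(t); for t > 0 the level of s₂ gives p₁ + (1 - p₁)Φ₂(t). These are the
distribution functions of the mixture on either side of 0. -/
theorem convergesUnderPotts_strong {βhat : (N : ℕ) → (Fin N → Fin (d + 1)) → ℝ}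
    (hβhat : IsMLE p (d + 1) h βhat) {s₁ s₂ p₁ : ℝ}
    (hs₁ : 0 < s₁) (hs : s₁ < s₂) (hF : freeFunMaximizers p (d + 1) β h = {s₁, s₂})
    (hp₁ : p₁ = tau p (d + 1) β h (xvec (d + 1) s₁) /
      (tau p (d + 1) β h (xvec (d + 1) s₁) + tau p (d + 1) β h (xvec (d + 1) s₂))) :
    ConvergesUnderPotts p (d + 1) β h (fun N X => √(N : ℝ) * (βhat N X - β))
      (ENNReal.ofReal (p₁ / 2) • negHalfNormal (asympVar p (d + 1) β h s₁ (xvec (d + 1) s₁)) +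
        ENNReal.ofReal ((1 - p₁) / 2) •
          posHalfNormal (asympVar p (d + 1) β h s₂ (xvec (d + 1) s₂)) +
        ENNReal.ofReal (1 / 2) • Measure.dirac (0 : ℝ)) := by
  have hm₁ : s₁ ∈ freeFunMaximizers p (d + 1) β h := by rw [hF]; exact Or.inl rfl
  have hm₂ : s₂ ∈ freeFunMaximizers p (d + 1) β h := by rw [hF]; exact Or.inr rfl
  have hh0 := field_pos_of_two_positive hp hd hβ hh hcrit hm₁ hm₂ hs₁ hs
  have hne : xvec (d + 1) s₁ ≠ xvec (d + 1) s₂ := fun h0 => hs.ne (xvec_injective hd h0)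
  have hM : ((({xvec (d + 1) s₁, xvec (d + 1) s₂} : Finset (Fin (d + 1) → ℝ))) : Set _) =
      maximizers p (d + 1) β h := by
    rw [maximizers_eq_pair_of_field_pos hp hd hβ hh hcrit hh0 hF]
    push_cast
    rfl
  have hτ₁ := tau_pos hp hd hβ hh hcrit (xvec_mem_maximizers hp hd hβ hh hcrit hm₁)
  have hτ₂ := tau_pos hp hd hβ hh hcrit (xvec_mem_maximizers hp hd hβ hh hcrit hm₂)
  have hlt : powerSum p (xvec (d + 1) s₁) < powerSum p (xvec (d + 1) s₂) :=
    powerSum_xvec_strictMonoOn hp hd (mem_freeFunMaximizers_iff.1 hm₁).1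
      (mem_freeFunMaximizers_iff.1 hm₂).1 hs
  set τ₁ := tau p (d + 1) β h (xvec (d + 1) s₁) with hτ₁d
  set τ₂ := tau p (d + 1) β h (xvec (d + 1) s₂) with hτ₂d
  have h0 : 0 ≤ p₁ := by rw [hp₁]; positivity
  have h1 : p₁ ≤ 1 := by rw [hp₁]; exact div_le_one_of_le₀ (by linarith) (by positivity)
  have e1 : 0 ≤ p₁ / 2 := by linarith
  have e2 : 0 ≤ (1 - p₁) / 2 := by linarith
  have e3 : (0 : ℝ) ≤ 1 / 2 := by norm_num
  have hprob := isProbabilityMeasure_mixture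
    (A := negHalfNormal (asympVar p (d + 1) β h s₁ (xvec (d + 1) s₁)))
    (B := posHalfNormal (asympVar p (d + 1) β h s₂ (xvec (d + 1) s₂)))
    (C := Measure.dirac (0 : ℝ)) e1 e2 e3 (by ring)
  refine convergesUnderPotts_of_cdf fun t ht => ?_
  rw [mixture_real e1 e2 e3, dirac_real_Iic]
  rcases ht.lt_or_gt with ht' | ht'
  · have key := tendsto_mle_cdf_normal hp hd hβ hh hcrit hβhat hM hm₁ hs₁ ht ?_
    · rw [Finset.sum_pair hne, Finset.sum_pair hne, if_neg (lt_irrefl _), if_pos rfl,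
        if_neg hlt.not_gt, if_neg hlt.ne', ← hτ₁d, ← hτ₂d] at key
      rw [negHalfNormal_Iic_of_neg _ ht', posHalfNormal_Iic_of_neg _ ht', if_neg (not_le.2 ht')]
      convert key using 2
      rw [hp₁]
      field_simp
      ring
    · intro m hm hmne
      rw [Finset.mem_insert, Finset.mem_singleton] at hm
      rcases hm with rfl | rfl
      · exact absurd rfl hmne
      · exact mul_neg_of_neg_of_pos ht' (sub_pos.2 hlt)
  · have key := tendsto_mle_cdf_normal hp hd hβ hh hcrit hβhat hM hm₂ (hs₁.trans hs) ht ?_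
    · rw [Finset.sum_pair hne, Finset.sum_pair hne, if_neg (lt_irrefl _), if_pos rfl,
        if_pos hlt, ← hτ₁d, ← hτ₂d] at key
      rw [negHalfNormal_Iic_of_nonneg _ ht'.le, posHalfNormal_Iic_of_nonneg _ ht'.le,
        if_pos ht'.le]
      convert key using 2
      rw [hp₁]
      field_simp
      ring
    · intro m hm hmne
      rw [Finset.mem_insert, Finset.mem_singleton] at hm
      rcases hm with rfl | rfl
      · exact mul_neg_of_pos_of_neg ht' (sub_neg.2 hlt)
      · exact absurd rfl hmne

/-- All maximizers are permutations of one x_s and share the value of S. The tilt does not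
discriminate between them, and the weights cancel. -/
theorem convergesUnderPotts_weak {βhat : (N : ℕ) → (Fin N → Fin (d + 1)) → ℝ}
    (hβhat : IsMLE p (d + 1) h βhat) {s : ℝ} (hs : 0 < s)
    (hF : freeFunMaximizers p (d + 1) β h = {s}) :
    ConvergesUnderPotts p (d + 1) β h (fun N X => √(N : ℝ) * (βhat N X - β))
      (normalLaw (asympVar p (d + 1) β h s (xvec (d + 1) s))) := by
  have hms : s ∈ freeFunMaximizers p (d + 1) β h := by rw [hF]; exact rfl
  have hM := (finite_maximizers hp hd hβ hh hcrit).coe_toFinset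
  set M := (finite_maximizers hp hd hβ hh hcrit).toFinset
  have hmem : ∀ m ∈ M, m ∈ maximizers p (d + 1) β h := fun m hm => by
    rw [← hM]; exact Finset.mem_coe.2 hm
  have hS : ∀ m ∈ M, powerSum p m = powerSum p (xvec (d + 1) s) := fun m hm => by
    obtain ⟨u, hu, j, -, rfl⟩ := exists_perm_of_mem_maximizers hp hd hβ hh hcrit (hmem m hm)
    rw [hF] at hu
    rw [powerSum_comp_perm, hu]
  have hT : 0 < ∑ m ∈ M, tau p (d + 1) β h m := by
    refine Finset.sum_pos (fun m hm => tau_pos hp hd hβ hh hcrit (hmem m hm)) ⟨xvec (d + 1) s, ?_⟩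
    rw [← Finset.mem_coe, hM]
    exact xvec_mem_maximizers hp hd hβ hh hcrit hms
  refine convergesUnderPotts_of_cdf fun t ht => ?_
  have key := tendsto_mle_cdf_normal hp hd hβ hh hcrit hβhat hM hms hs ht
    fun m hm hne => absurd (hS m hm) hne
  rw [Finset.sum_congr rfl fun m hm => by rw [if_neg (hS m hm).not_lt, if_pos (hS m hm)],
    ← Finset.sum_mul, mul_comm, mul_div_cancel_right₀ _ hT.ne'] at key
  exact key

/-- For t < 0 the limit is the constant p₁γ₁, hence an atom at -∞. For t > 0 the permutations of x_s
dominate, with total weight 1 - p₁, and the limit is p₁ + (1 - p₁)Φ(t). -/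
theorem convergesUnderPotts_transition {βhat : (N : ℕ) → (Fin N → Fin (d + 1)) → ℝ}
    (hβhat : IsMLE p (d + 1) h βhat) {s p₁ : ℝ} (hs : 0 < s)
    (hF : freeFunMaximizers p (d + 1) β h = {0, s}) {M : Finset (Fin (d + 1) → ℝ)}
    (hM : ↑M = maximizers p (d + 1) β h)
    (hp₁ : p₁ = tau p (d + 1) β h (xvec (d + 1) 0) / ∑ m ∈ M, tau p (d + 1) β h m) :
    ConvergesUnderPotts p (d + 1) β h (fun N X => ((√(N : ℝ) * (βhat N X - β) : ℝ) : EReal))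
      (ENNReal.ofReal (p₁ * gamma1 p (d + 1) β h) • Measure.dirac (⊥ : EReal) +
        ENNReal.ofReal ((1 - p₁) / 2) •
          (posHalfNormal (asympVar p (d + 1) β h s (xvec (d + 1) s))).map (fun x : ℝ => (x : EReal)) +
        ENNReal.ofReal ((1 + p₁) / 2 - p₁ * gamma1 p (d + 1) β h) • Measure.dirac (0 : EReal)) := by
  classical
  have hm0 : 0 ∈ freeFunMaximizers p (d + 1) β h := by rw [hF]; exact Or.inl rfl
  have hms : s ∈ freeFunMaximizers p (d + 1) β h := by rw [hF]; exact Or.inr rfl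
  have hmem : ∀ m ∈ M, m ∈ maximizers p (d + 1) β h := fun m hm => by
    rw [← hM]; exact Finset.mem_coe.2 hm
  have hlt : powerSum p (xvec (d + 1) 0) < powerSum p (xvec (d + 1) s) :=
    powerSum_xvec_strictMonoOn hp hd (mem_freeFunMaximizers_iff.1 hm0).1
      (mem_freeFunMaximizers_iff.1 hms).1 hs
  have hx0 : xvec (d + 1) 0 ∈ M := by
    rw [← Finset.mem_coe, hM]
    exact xvec_mem_maximizers hp hd hβ hh hcrit hm0
  have hS : ∀ m ∈ M, m ≠ xvec (d + 1) 0 → powerSum p m = powerSum p (xvec (d + 1) s) :=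
    fun m hm hne => by
      obtain ⟨u, hu, j, -, rfl⟩ := exists_perm_of_mem_maximizers hp hd hβ hh hcrit (hmem m hm)
      rw [hF] at hu
      rcases hu with rfl | rfl
      · refine absurd ?_ hne
        funext r
        simp only [Function.comp, xvec_zero_param]
      · rw [powerSum_comp_perm]
  set T := ∑ m ∈ M, tau p (d + 1) β h m with hTd
  set τ₀ := tau p (d + 1) β h (xvec (d + 1) 0) with hτ₀d
  have hτ₀ : 0 < τ₀ := tau_pos hp hd hβ hh hcrit (hmem _ hx0)
  have hτ₀T : τ₀ ≤ T := Finset.single_le_sum (f := fun m => tau p (d + 1) β h m)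
    (fun m hm => (tau_pos hp hd hβ hh hcrit (hmem m hm)).le) hx0
  have hT : 0 < T := hτ₀.trans_le hτ₀T
  have h0 : 0 ≤ p₁ := by rw [hp₁]; exact div_nonneg hτ₀.le hT.le
  have h1 : p₁ ≤ 1 := by rw [hp₁]; exact div_le_one_of_le₀ hτ₀T hT.le
  set γ := gamma1 p (d + 1) β h with hγd
  have hγ0 : 0 ≤ γ := measureReal_nonneg
  have hγ1 : γ ≤ 1 := by
    rw [hγd, gamma1]
    exact measureReal_le_one
  have e1 : 0 ≤ p₁ * γ := mul_nonneg h0 hγ0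
  have e2 : 0 ≤ (1 - p₁) / 2 := by linarith
  have e3 : 0 ≤ (1 + p₁) / 2 - p₁ * γ := by nlinarith
  have hmap : IsProbabilityMeasure ((posHalfNormal (asympVar p (d + 1) β h s (xvec (d + 1) s))).map
      (fun x : ℝ => (x : EReal))) :=
    Measure.isProbabilityMeasure_map measurable_coe_real_ereal.aemeasurable
  have hprob := isProbabilityMeasure_mixture (A := Measure.dirac (⊥ : EReal))
    (B := (posHalfNormal (asympVar p (d + 1) β h s (xvec (d + 1) s))).map
      (fun x : ℝ => (x : EReal)))
    (C := Measure.dirac (0 : EReal)) e1 e2 e3 (by ring)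
  refine convergesUnderPotts_coe_of_cdf fun t ht => ?_
  have hpre : (fun x : ℝ => (x : EReal)) ⁻¹' Set.Iic (t : EReal) = Set.Iic t := by
    ext x
    simp
  rw [mixture_real e1 e2 e3, dirac_real_Iic, dirac_real_Iic, if_pos bot_le,
    map_measureReal_apply measurable_coe_real_ereal measurableSet_Iic, hpre]
  rcases ht.lt_or_gt with ht' | ht'
  · have key := tendsto_mle_cdf_uniform hp hd hβ hh hcrit hβhat hM hm0 ht'
    rw [Finset.sum_eq_single_of_mem _ hx0 fun m hm hne => if_neg (by rw [hS m hm hne]; exact hlt.ne'),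
      if_pos rfl, mul_div_right_comm, ← hτ₀d, ← hTd, ← hp₁] at key
    rw [posHalfNormal_Iic_of_neg _ ht', if_neg (by rw [not_le]; exact_mod_cast ht'), mul_one,
      mul_zero, mul_zero, add_zero, add_zero]
    exact key
  · have key := tendsto_mle_cdf_normal hp hd hβ hh hcrit hβhat hM hms hs ht ?_
    · have hsum : T = τ₀ + ∑ m ∈ M.erase (xvec (d + 1) 0), tau p (d + 1) β h m :=
        (Finset.add_sum_erase M _ hx0).symm
      rw [← Finset.add_sum_erase M _ hx0, if_pos hlt,
        Finset.sum_congr rfl fun m hm => by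
          rw [if_neg (hS m (Finset.mem_of_mem_erase hm) (Finset.ne_of_mem_erase hm)).not_lt,
            if_pos (hS m (Finset.mem_of_mem_erase hm) (Finset.ne_of_mem_erase hm))],
        ← Finset.sum_mul, eq_sub_of_add_eq' hsum.symm, ← hτ₀d, ← hTd] at key
      rw [posHalfNormal_Iic_of_nonneg _ ht'.le, if_pos (by exact_mod_cast ht'.le)]
      convert key using 2
      rw [hp₁]
      field_simp
      ring
    · intro m hm hmne
      by_cases hm0 : m = xvec (d + 1) 0
      · rw [hm0]
        exact mul_neg_of_pos_of_neg ht' (sub_neg.2 hlt)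
      · exact absurd (hS m hm hm0) hmne

end Critical

end TensorPotts

end

/-! ### The three regimes -/

theorem theorem3p6 (p q : ℕ) [NeZero q] (hp : 2 ≤ p) (hq : 2 ≤ q) (β h : ℝ) (hβ : 0 < β)
    (hh : 0 ≤ h) (hcrit : TensorPotts.IsCritical p q β h)
    (βhat : (N : ℕ) → (Fin N → Fin q) → ℝ) (hβhat : TensorPotts.IsMLE p q h βhat) :
    (TensorPotts.maximizers p q β h).Finite ∧
    ∀ (K : ℕ) (m : ℕ → Fin q → ℝ),
      Set.BijOn m (Set.Icc 1 K) (TensorPotts.maximizers p q β h) →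
      MonotoneOn (fun i => TensorPotts.lpNorm p q (m i)) (Set.Icc 1 K) →
      ∀ p₁ : ℝ,
        p₁ = TensorPotts.tau p q β h (m 1) /
          ∑ i ∈ Finset.Icc 1 K, TensorPotts.tau p q β h (m i) →
      -- strongly critical points other than the transition point
      (TensorPotts.IsStronglyCritical p q β h → (β, h) ≠ (TensorPotts.betaC p q, 0) →
        ∃ s₁ s₂ : ℝ, 0 < s₁ ∧ s₁ < s₂ ∧
          TensorPotts.freeFunMaximizers p q β h = {s₁, s₂} ∧
          m 1 = TensorPotts.xvec q s₁ ∧ m 2 = TensorPotts.xvec q s₂ ∧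
          TensorPotts.ConvergesUnderPotts p q β h
            (fun N X => √(N : ℝ) * (βhat N X - β))
            (ENNReal.ofReal (p₁ / 2) •
                TensorPotts.negHalfNormal (TensorPotts.asympVar p q β h s₁ (m 1)) +
              ENNReal.ofReal ((1 - p₁) / 2) •
                TensorPotts.posHalfNormal (TensorPotts.asympVar p q β h s₂ (m 2)) +
              ENNReal.ofReal (1 / 2) • MeasureTheory.Measure.dirac (0 : ℝ))) ∧
      -- weakly critical points
      (TensorPotts.IsWeaklyCritical p q β h →
        ∃ s : ℝ, 0 < s ∧ TensorPotts.freeFunMaximizers p q β h = {s} ∧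
          TensorPotts.ConvergesUnderPotts p q β h
            (fun N X => √(N : ℝ) * (βhat N X - β))
            (TensorPotts.normalLaw
              (TensorPotts.asympVar p q β h s (TensorPotts.xvec q s)))) ∧
      -- the transition point; the convergence is in the extended real line
      ((β, h) = (TensorPotts.betaC p q, 0) →
        ∃ s : ℝ, 0 < s ∧ TensorPotts.freeFunMaximizers p q β h = {0, s} ∧
          TensorPotts.ConvergesUnderPotts p q β h
            (fun N X => ((√(N : ℝ) * (βhat N X - β) : ℝ) : EReal))
            (ENNReal.ofReal (p₁ * TensorPotts.gamma1 p q β h) •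
                MeasureTheory.Measure.dirac (⊥ : EReal) +
              ENNReal.ofReal ((1 - p₁) / 2) •
                (TensorPotts.posHalfNormal
                  (TensorPotts.asympVar p q β h s (TensorPotts.xvec q s))).map
                    (fun x : ℝ => (x : EReal)) +
              ENNReal.ofReal ((1 + p₁) / 2 - p₁ * TensorPotts.gamma1 p q β h) •
                MeasureTheory.Measure.dirac (0 : EReal))) := by
  classical
  obtain ⟨d, rfl⟩ := Nat.exists_eq_succ_of_ne_zero (by omega : q ≠ 0)
  have hd : d ≠ 0 := by omega
  have hfin := TensorPotts.finite_maximizers hp hd hβ hh hcrit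
  refine ⟨hfin, fun K m hm hmono p₁ hp₁ => ?_⟩
  have hne : (TensorPotts.maximizers p (d + 1) β h).Nonempty := hcrit.1.nonempty
  have h1K := TensorPotts.one_mem_of_bijOn hm hne
  rw [TensorPotts.sum_enumeration hm hfin.coe_toFinset] at hp₁
  have hfirst : ∀ s ∈ TensorPotts.freeFunMaximizers p (d + 1) β h,
      TensorPotts.powerSum p (m 1) ≤ TensorPotts.powerSum p (TensorPotts.xvec (d + 1) s) :=
    fun s hs => TensorPotts.powerSum_first_le (by omega) hm hmono
      (TensorPotts.xvec_mem_maximizers hp hd hβ hh hcrit hs)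
  refine ⟨fun hstrong hneq => ?_, fun hweak => ?_, fun hc => ?_⟩
  · obtain ⟨s₁, s₂, hs, hs₁, hs₂⟩ : ∃ s₁ s₂, s₁ < s₂ ∧
        s₁ ∈ TensorPotts.freeFunMaximizers p (d + 1) β h ∧
        s₂ ∈ TensorPotts.freeFunMaximizers p (d + 1) β h := by
      obtain ⟨x, hx, y, hy, hxy⟩ := hstrong.2
      rcases hxy.lt_or_gt with h1 | h1
      · exact ⟨x, y, h1, hx, hy⟩
      · exact ⟨y, x, h1, hy, hx⟩
    have hF := TensorPotts.freeFunMaximizers_eq_pair hp hd hβ hh hcrit hs₁ hs₂ hs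
    have hs₁0 : 0 < s₁ := by
      refine (TensorPotts.mem_freeFunMaximizers_iff.1 hs₁).1.1.lt_of_ne ?_
      rintro rfl
      exact hneq (TensorPotts.eq_betaC_of_zero_mem hp hd hβ hh hcrit hs₁ hs₂ hs)
    have hh0 := TensorPotts.field_pos_of_two_positive hp hd hβ hh hcrit hs₁ hs₂ hs₁0 hs
    have hmax := TensorPotts.maximizers_eq_pair_of_field_pos hp hd hβ hh hcrit hh0 hF
    have hlt : TensorPotts.powerSum p (TensorPotts.xvec (d + 1) s₁) <
        TensorPotts.powerSum p (TensorPotts.xvec (d + 1) s₂) :=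
      TensorPotts.powerSum_xvec_strictMonoOn hp hd
        (TensorPotts.mem_freeFunMaximizers_iff.1 hs₁).1
        (TensorPotts.mem_freeFunMaximizers_iff.1 hs₂).1 hs
    have hm1 : m 1 = TensorPotts.xvec (d + 1) s₁ := by
      have h2 := hm.mapsTo h1K
      rw [hmax] at h2
      rcases h2 with h2 | h2
      · exact h2
      · have h3 := hfirst s₁ hs₁
        rw [h2] at h3
        exact absurd h3 (not_le.2 hlt)
    have hm2 : m 2 = TensorPotts.xvec (d + 1) s₂ := by
      obtain ⟨i, hi, hi2⟩ := hm.surjOn (TensorPotts.xvec_mem_maximizers hp hd hβ hh hcrit hs₂)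
      have hi1 : i ≠ 1 := by
        rintro rfl
        rw [hm1] at hi2
        exact hs.ne (TensorPotts.xvec_injective hd hi2)
      -- The second maximizer is enumerated at an index other than 1, so the list has at least two
      -- entries.
      have h2K : 2 ∈ Set.Icc 1 K := ⟨by omega, by have := hi.1; have := hi.2; omega⟩
      have h2 := hm.mapsTo h2K
      rw [hmax] at h2
      rcases h2 with h2 | h2
      · exact absurd (hm.injOn h2K h1K (h2.trans hm1.symm)) (by omega)
      · exact h2
    refine ⟨s₁, s₂, hs₁0, hs, hF, hm1, hm2, ?_⟩
    have hMeq : hfin.toFinset = {TensorPotts.xvec (d + 1) s₁, TensorPotts.xvec (d + 1) s₂} := by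
      rw [← Finset.coe_inj, hfin.coe_toFinset, hmax]
      push_cast
      rfl
    rw [hMeq, Finset.sum_pair fun h0 => hs.ne (TensorPotts.xvec_injective hd h0), hm1] at hp₁
    rw [hm1, hm2]
    exact TensorPotts.convergesUnderPotts_strong hp hd hβ hh hcrit hβhat hs₁0 hs hF hp₁
  · obtain ⟨s, hs, huniq⟩ := hweak.2
    have hF : TensorPotts.freeFunMaximizers p (d + 1) β h = {s} :=
      Set.Subset.antisymm (fun u hu => huniq u hu) (by rintro u rfl; exact hs)
    obtain ⟨u, hu, hu0⟩ := TensorPotts.exists_pos_mem hp hd hβ hh hcrit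
    obtain rfl : u = s := huniq u hu
    exact ⟨u, hu0, hF, TensorPotts.convergesUnderPotts_weak hp hd hβ hh hcrit hβhat hu0 hF⟩
  · have h0 := TensorPotts.zero_mem_of_eq_betaC hβ hc
    obtain ⟨s, hs, hs0⟩ := TensorPotts.exists_pos_mem hp hd hβ hh hcrit
    have hF := TensorPotts.freeFunMaximizers_eq_pair hp hd hβ hh hcrit h0 hs hs0
    -- The first entry has the least S, which is that of the uniform vector, and the uniform vector
    -- is its only permutation.
    have hm1 : m 1 = TensorPotts.xvec (d + 1) 0 := by
      have h2 := hm.mapsTo h1K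
      have h3 := le_antisymm (hfirst 0 h0) (TensorPotts.powerSum_mem_Ico hp hd hβ hh hcrit h2).2
      obtain ⟨σ, -, h4⟩ := TensorPotts.exists_perm_of_powerSum_eq hp hd hβ hh hcrit h2 h0 h3
      rw [h4]
      funext r
      simp only [Function.comp, TensorPotts.xvec_zero_param]
    rw [hm1] at hp₁
    exact ⟨s, hs0, hF, TensorPotts.convergesUnderPotts_transition hp hd hβ hh hcrit hβhat hs0 hF
      hfin.coe_toFinset hp₁⟩
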